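/- **Setting.** A generalised degenerate (GD) string $T=T[1]\cdots T[n]$, $n\ge 1$, over a finite alphabet of $\sigma$ characters is a sequence of non-empty finite sets $T[i]$ of strings of length $k_i\ge 1$. Let $N=\sum_i |T[i]|\,k_i$ and $W=\sum_i k_i$. A string $P$ of length $m$ has a match in $T$ starting at column $c$ if $c=a+\sum_{x<i}k_x$ with $1\le a\le k_i$, and either $P$ is a substring of some $S\in T[i]$ starting at its $a$-th character, or $P=S_i[a..k_i]\,S_{i+1}\cdots S_{j-1}\,S_j[1..b]$ for some $i<j$, $S_x\in T[x]$ and $1\le b\le k_j$. Assume $k_i<m$ for all $i$. For $0\le h\le m-1$ let $f_1(h)=1$ if $P$ has a match in $T$ starting at column $h+r\cdot m$ for some integer $r$ with $m\cdot r<W$, and $f_1(h)=0$ otherwise. **Model (Word-QRAM).** The quantum registers hold words of $w=O(\log(m+N+\sigma))$ qubits. The elementary operations are: Hadamard and Pauli $Z$ gates on a qubit; adding modulo 2 to a register a constant, or an arithmetic or logic operation ($+$, $-$, $\bmod$, comparison, and, or) of two other registers; and QRAM access, in superposition, to the characters $P[a]$ and $T[i][s][c]$. The running time is the number of elementary operations.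 **The for-loop.** On input $|h\rangle|0\cdots0\rangle$ the algorithm sets $j\leftarrow (1-h)\bmod m$ (the number of characters of $P$ consumed so far), $a\leftarrow[j=0]$ (is the current prefix active), $M\leftarrow 0$ (match found), and for $i=1,\dots,n$ it computes three bits: * $ext$: is $P[j+1..j+k_i]\in T[i]$; * $sm$: is $P[j+1..m]$ a prefix of a string of $T[i]$; * $pm$: is $P[1..j+k_i-m]$ a suffix of a string of $T[i]$. If $j+k_i<m$ it then sets $a\leftarrow a\wedge ext$; otherwise it sets $M\leftarrow M\vee(sm\wedge a)$ and $a\leftarrow pm$, using the old $a$ in the first assignment. Finally $j\leftarrow (j+k_i)\bmod m$. New registers for $j,a,M$ are used in every iteration. The three bits are computed by a Grover search $G_2$ over the strings of $T[i]$, whose oracle is a Grover search $G_3$ for a position at which two strings differ. A Grover search over a space of size $2^q$ consists of $\kappa L(L+1)$ runs from the uniform superposition, where $L$ is the bit length of $m+N$ and $\kappa$ is a constant; the numbers of Grover iterations in the runs cycle through $0,1,2,4,\dots,2^{\lfloor q/2\rfloor}$, with the last number repeated to make the cycle $L+1$ long. Each run ends with an evaluation of the oracle, the disjunction of the values found is copied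 to the output, and the runs are undone. The resulting circuit depends only on $\kappa,m,n,N$, the $k_i$ and the $|T[i]|$. **Lemma.** There are absolute constants $\kappa,e\in\mathbb N$ and $C\in\mathbb R$ such that for all $\sigma,n,m,P,T$ as above the for-loop of the quantum algorithm computes $f_1$ with success probability greater than $2/3$ in time $\tilde O\bigl(\sum_{i=1}^n\sqrt{|T[i]|\,k_i}\bigr)$. Precisely: for every initial superposition $\sum_{h=0}^{m-1}\alpha_h|h\rangle|0\cdots0\rangle$ and every $h$ with $\alpha_h\ne0$, measuring the final state gives, with probability greater than $\tfrac23|\alpha_h|^2$, the value $h$ in the identifier register together with $f_1(h)$ in the last match register; and the running time is at most $$C\,\bigl(\log (m+N)\bigr)^{e}\sum_{i=1}^n\sqrt{|T[i]|\cdot k_i}.$$ -/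

import Mathlib

open Finset

/-! ### Generalised degenerate strings -/

/-- A GD string with `n` segments over the alphabet `Fin σ`, as it is stored in memory: segment `i`
is a non-empty set of `card i` pairwise distinct strings `str i s`, all of length `width i ≥ 1`. -/
structure GDString (σ n : ℕ) where
  width : Fin n → ℕ
  card : Fin n → ℕ
  str : ∀ i, Fin (card i) → Fin (width i) → Fin σ
  width_pos : ∀ i, 0 < width i
  card_pos : ∀ i, 0 < card i
  str_injective : ∀ i, Function.Injective (str i)

namespace GDString

variable {σ n : ℕ}

/-- The size `N`: total number of characters. -/
def size (T : GDString σ n) : ℕ := ∑ i, T.card i * T.width i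

/-- The width `W`: total number of columns. -/
def totalWidth (T : GDString σ n) : ℕ := ∑ i, T.width i

/-- The number of columns that precede segment `i`. -/
def offset (T : GDString σ n) (i : Fin n) : ℕ := ∑ x ∈ univ.filter (· < i), T.width x

/-- The `s`-th string of segment `i` as a list of characters. -/
def word (T : GDString σ n) (i : Fin n) (s : Fin (T.card i)) : List (Fin σ) :=
  List.ofFn (T.str i s)

/-- `P` has a match in `T` that starts at column `c` (columns are numbered from 1): either `P` is a
substring of one string of a segment `i`, starting at its `a`-th character, or
`P = S_i[a..k_i] S_{i+1} ⋯ S_{j-1} S_j[1..b]` with `i < j`, `S_x ∈ T[x]`, and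
`c = a + k_1 + ⋯ + k_{i-1}` in both cases. -/
def MatchStartsAt (T : GDString σ n) {m : ℕ} (P : Fin m → Fin σ) (c : ℕ) : Prop :=
  (∃ (i : Fin n) (s : Fin (T.card i)) (a : ℕ), 1 ≤ a ∧ a ≤ T.width i ∧ c = a + T.offset i ∧
      List.ofFn P <+: (T.word i s).drop (a - 1)) ∨
  (∃ (i j : Fin n) (S : ∀ x, Fin (T.card x)) (a b : ℕ), i < j ∧
      1 ≤ a ∧ a ≤ T.width i ∧ 1 ≤ b ∧ b ≤ T.width j ∧ c = a + T.offset i ∧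
      List.ofFn P = (T.word i (S i)).drop (a - 1) ++
        ((List.finRange n).filter (fun x => i < x ∧ x < j)).flatMap (fun x => T.word x (S x)) ++
        (T.word j (S j)).take b)

/-- The outer oracle: `f₁ h = 1` iff `P` has a match starting at a column `h + m * r` for some
integer `r` with `m * r < W`. (As columns are positive and `h < m`, only `r ≥ 0` can occur.) -/
def f₁ (T : GDString σ n) {m : ℕ} (P : Fin m → Fin σ) (h : Fin m) : Prop :=
  ∃ r : ℕ, m * r < T.totalWidth ∧ T.MatchStartsAt P (h + m * r)

end GDString

/-! ### The Word-QRAM: registers, elementary operations, semantics -/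

/-- The two nested Grover searches inside the loop: over the characters of a string (`G₃`) and over
the strings of a segment (`G₂`). -/
inductive Level
  | chars
  | strings
deriving DecidableEq

instance : Fintype Level := ⟨{.chars, .strings}, fun x => by cases x <;> decide⟩

/-- Names of scratch registers. -/
inductive Scratch
  | zero | one | patLen | card | sum | isLess | rem | over
  | addrP | addrT | charP | charT | differ | inside | mismatch
  | inSegment | anyMismatch | hit
  | extended | stays | starts | ended | full
  | shift | start
deriving DecidableEq

instance : Fintype Scratch :=
  ⟨{.zero, .one, .patLen, .card, .sum, .isLess, .rem, .over, .addrP, .addrT, .charP, .charT,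
    .differ, .inside, .mismatch, .inSegment, .anyMismatch, .hit, .extended, .stays, .starts,
    .ended, .full, .shift, .start}, fun x => by cases x <;> decide⟩

/-- The quantum registers, each holding one word. `M` is the number of runs in a Grover search. -/
inductive Reg (n M : ℕ)
  /-- the thread identifier `h` (register ID) -/
  | id
  /-- `pos i` holds `j_{i,h}`, `act i` holds `a_{i,h}`, `mat i` holds `m_{i,h}` (registers prefix,
  active, match) right before iteration `i`, and after the last one for `i = n` -/
  | pos (i : Fin (n + 1))
  | act (i : Fin (n + 1))
  | mat (i : Fin (n + 1))
  /-- `k_i` and the outcomes of the extension, suffix match and prefix match tests -/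
  | width (i : Fin n)
  | ext (i : Fin n)
  | suf (i : Fin n)
  | pre (i : Fin n)
  /-- the index that run `t` of a Grover search ranges over -/
  | cand (l : Level) (t : Fin M)
  /-- `acc l t` tells whether one of the first `t` runs has ended in a solution -/
  | acc (l : Level) (t : Fin (M + 1))
  | isZero (l : Level)
  | tmp (x : Scratch)
deriving DecidableEq, Fintype

/-- Arithmetic and logic operations on words. -/
inductive WordOp
  | add | sub | mod | lt | eq | ne | and | andNot | or

def WordOp.eval {w : ℕ} : WordOp → BitVec w → BitVec w → BitVec w
  | .add, a, b => a + b
  | .sub, a, b => a - b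
  | .mod, a, b => a % b
  | .lt, a, b => if a.toNat < b.toNat then 1#w else 0#w
  | .eq, a, b => if a = b then 1#w else 0#w
  | .ne, a, b => if a = b then 0#w else 1#w
  | .and, a, b => a &&& b
  | .andNot, a, b => a &&& ~~~b
  | .or, a, b => a ||| b

/-- Elementary operations. `d` is always the destination register; its contents are replaced by
their bitwise sum modulo 2 with the result, so that each operation is its own inverse.
* `had r b`, `pauliZ r b`: the Hadamard gate and the Pauli `Z` gate on qubit `b` of register `r`;
* `load v d`: adds the constant `v`;
* `op f a b d`: adds `f(a, b)`;
* `readP a d`: QRAM access to the pattern, adds `P[a]` (positions are numbered from 0);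
* `readT i s c d`: QRAM access to the text, adds `T[i][s][c]` (numbered from 0). -/
inductive Gate (n M : ℕ)
  | had (r : Reg n M) (b : ℕ)
  | pauliZ (r : Reg n M) (b : ℕ)
  | load (v : ℕ) (d : Reg n M)
  | op (f : WordOp) (a b d : Reg n M)
  | readP (a d : Reg n M)
  | readT (i : Fin n) (s c d : Reg n M)

/-- A circuit is a sequence of elementary operations, in the order of execution. Its running time is
the length of the list. -/
abbrev Circuit (n M : ℕ) := List (Gate n M)

/-- Computational basis states: an assignment of `w`-bit words to the registers. -/
abbrev Basis (n M w : ℕ) := Reg n M → BitVec w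

/-- State vectors in the computational basis. -/
abbrev QState (n M w : ℕ) := Basis n M w → ℂ

/-- Adds `g` of the other registers to register `d` (the destination itself is read as `0` by `g`).
This is an involution on basis states whatever `g` is. -/
def addTo {n M w : ℕ} (d : Reg n M) (g : Basis n M w → BitVec w) (x : Basis n M w) :
    Basis n M w :=
  Function.update x d (x d ^^^ g (Function.update x d 0#w))

/-- The word stored in the QRAM at position `a` of the pattern (`0` outside the array). -/
def patternCell {σ m : ℕ} (P : Fin m → Fin σ) (w a : ℕ) : BitVec w :=
  if h : a < m then BitVec.ofNat w (P ⟨a, h⟩) else 0#w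

/-- The word stored in the QRAM for character `c` of string `s` of segment `i` (`0` outside the
array). -/
def textCell {σ n : ℕ} (T : GDString σ n) (w : ℕ) (i : Fin n) (s c : ℕ) : BitVec w :=
  if h : s < T.card i ∧ c < T.width i then BitVec.ofNat w (T.str i ⟨s, h.1⟩ ⟨c, h.2⟩) else 0#w

/-- The unitary operator of an elementary operation. A classical operation permutes the basis states
by an involution `g`, and hence maps the vector `ψ` to `ψ ∘ g`. -/
noncomputable def Gate.apply {σ n m M w : ℕ} (P : Fin m → Fin σ) (T : GDString σ n) :
    Gate n M → QState n M w → QState n M w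
  | .had r b, ψ => fun x =>
      if b < w then
        ((if (x r).getLsbD b then -ψ x else ψ x) +
          ψ (Function.update x r (x r ^^^ BitVec.twoPow w b))) / (√2 : ℝ)
      else ψ x
  | .pauliZ r b, ψ => fun x => if (x r).getLsbD b then -ψ x else ψ x
  | .load v d, ψ => fun x => ψ (addTo d (fun _ => BitVec.ofNat w v) x)
  | .op f a b d, ψ => fun x => ψ (addTo d (fun y => f.eval (y a) (y b)) x)
  | .readP a d, ψ => fun x => ψ (addTo d (fun y => patternCell P w (y a).toNat) x)
  | .readT i s c d, ψ => fun x =>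
      ψ (addTo d (fun y => textCell T w i (y s).toNat (y c).toNat) x)

/-- Runs a circuit on a state, with `P` and `T` in the QRAM. -/
noncomputable def Circuit.run {σ n m M w : ℕ} (P : Fin m → Fin σ) (T : GDString σ n)
    (C : Circuit n M) (ψ : QState n M w) : QState n M w :=
  C.foldl (fun φ g => g.apply P T φ) ψ

open Classical in
/-- The probability that a measurement in the computational basis has an outcome in `E`. -/
noncomputable def measureProb {n M w : ℕ} (ψ : QState n M w) (E : Basis n M w → Prop) : ℝ :=
  ∑ x, if E x then ‖ψ x‖ ^ 2 else 0

/-- The state `∑_h α_h |h⟩_ID |0 ⋯ 0⟩`. -/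
noncomputable def initialState {m : ℕ} (n M w : ℕ) (α : Fin m → ℂ) : QState n M w :=
  fun x => ∑ h : Fin m,
    if x = Function.update (fun _ => 0#w) Reg.id (BitVec.ofNat w h) then α h else 0

/-! ### Grover search -/

section Search

variable {n M : ℕ}

/-- Hadamard gates on the `q` low qubits of `r`. -/
def hadamards (q : ℕ) (r : Reg n M) : Circuit n M := (List.range q).map (Gate.had r)

/-- One Grover iteration on the `q` low qubits of `r`: the sign is flipped where the circuit
`oracle` computes the value 1 in register `b`, and then the state is reflected about the uniform
superposition. (Each operation is its own inverse, so a reversed list is the inverse circuit.) -/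
def groverStep (l : Level) (q : ℕ) (r b : Reg n M) (oracle : Circuit n M) : Circuit n M :=
  oracle ++ [.pauliZ b 0] ++ oracle.reverse ++
  hadamards q r ++
  [.op .eq r (.tmp .zero) (.isZero l), .pauliZ (.isZero l) 0,
    .op .eq r (.tmp .zero) (.isZero l)] ++
  hadamards q r

/-- The number of Grover iterations in run `t` on a space of size `2 ^ q`. As the number of solutions
is unknown, the runs cycle through `0, 1, 2, 4, 8, …, 2 ^ (q / 2)` (the last number is repeated, so
that a cycle consists of `L + 1` runs). -/
def iterations (L q t : ℕ) : ℕ := 2 ^ min (t % (L + 1)) (q / 2 + 1) / 2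

/-- Run `t` of a Grover search over `cand l t`: uniform superposition, Grover iterations, and a final
evaluation of the oracle, whose value is recorded in the accumulated disjunction. -/
def groverRun (L : ℕ) (l : Level) (q : ℕ) (b : Reg n M) (oracle : Reg n M → Circuit n M)
    (t : Fin M) : Circuit n M :=
  hadamards q (.cand l t) ++
  (List.replicate (iterations L q t)
    (groverStep l q (.cand l t) b (oracle (.cand l t)))).flatten ++
  oracle (.cand l t) ++ [.op .or (.acc l t.castSucc) b (.acc l t.succ)] ++
  (oracle (.cand l t)).reverse

/-- Grover search: performs all `M` runs, adds the bit "a solution was found" to `out`, and undoes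
the runs. Here `oracle r` computes in register `b` whether the index in register `r` is a
solution. -/
def groverSearch (L : ℕ) (l : Level) (q : ℕ) (b out : Reg n M) (oracle : Reg n M → Circuit n M) :
    Circuit n M :=
  let runs : Circuit n M := (List.finRange M).flatMap (groverRun L l q b oracle)
  runs ++ [.op .or (.acc l (Fin.last M)) (.tmp .zero) out] ++ runs.reverse

/-- The oracle `f₃`: is `c < len` and `P[p + c] ≠ T[i][s][q + c]`? All arguments are registers. -/
def mismatchOracle (i : Fin n) (p q len s c : Reg n M) : Circuit n M :=
  [.op .add p c (.tmp .addrP),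
   .op .add q c (.tmp .addrT),
   .readP (.tmp .addrP) (.tmp .charP),
   .readT i s (.tmp .addrT) (.tmp .charT),
   .op .ne (.tmp .charP) (.tmp .charT) (.tmp .differ),
   .op .lt c len (.tmp .inside),
   .op .and (.tmp .differ) (.tmp .inside) (.tmp .mismatch)]

/-- The oracle `f₂`: is `s < |T[i]|` and `P[p .. p + len - 1] = T[i][s][q .. q + len - 1]`? It is
computed by the search `G₃` for a mismatch. -/
def stringOracle (L : ℕ) (i : Fin n) (ki : ℕ) (p q len s : Reg n M) : Circuit n M :=
  [.op .lt s (.tmp .card) (.tmp .inSegment)] ++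
  groverSearch L .chars (Nat.clog 2 ki) (.tmp .mismatch) (.tmp .anyMismatch)
    (mismatchOracle i p q len s) ++
  [.op .andNot (.tmp .inSegment) (.tmp .anyMismatch) (.tmp .hit)]

/-- The search `G₂`: adds to `out` whether `P[p .. p + len - 1] = T[i][s][q .. q + len - 1]` for some
string `s` of the segment `T[i]` of `ci` strings of length `ki`. -/
def segmentSearch (L : ℕ) (i : Fin n) (ki ci : ℕ) (p q len out : Reg n M) : Circuit n M :=
  groverSearch L .strings (Nat.clog 2 ci) (.tmp .hit) out (stringOracle L i ki p q len)

/-! ### The for-loop -/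

/-- Initialisation: `j_{1,h} = (1 - h) mod m`, so that thread `h` is at position `0` of the pattern
exactly at the columns `h + r m`; the empty prefix is active and every other prefix is not. -/
def initCircuit (m : ℕ) : Circuit n M :=
  let prep : Circuit n M :=
    [.load 1 (.tmp .one),
     .load m (.tmp .patLen),
     .op .add (.tmp .one) (.tmp .patLen) (.tmp .shift),
     .op .sub (.tmp .shift) .id (.tmp .start)]
  prep ++
  [.op .mod (.tmp .start) (.tmp .patLen) (.pos 0),
   .op .eq (.pos 0) (.tmp .zero) (.act 0)] ++
  prep.reverse

/-- Iteration `i` of the for-loop. With `j = j_{i,h}` characters of `P` consumed so far: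
* `ext`: is `P[j .. j + k_i - 1]` in `T[i]`;
* `suf`: is `P[j .. m - 1]` a prefix of a string of `T[i]`;
* `pre`: is `P[0 .. j + k_i - m - 1]` a suffix of a string of `T[i]`;
then, if `j + k_i < m`, `a_{i+1,h} = a_{i,h} ∧ ext` and `m_{i+1,h} = m_{i,h}`; otherwise
`a_{i+1,h} = pre` and `m_{i+1,h} = m_{i,h} ∨ (suf ∧ a_{i,h})`; and
`j_{i+1,h} = (j + k_i) mod m`. -/
def loopBody (L m : ℕ) (k c : Fin n → ℕ) (i : Fin n) : Circuit n M :=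
  let j : Reg n M := .pos i.castSucc
  let a : Reg n M := .act i.castSucc
  let prep : Circuit n M :=
    [.load m (.tmp .patLen),
     .load (c i) (.tmp .card),
     .op .add j (.width i) (.tmp .sum),
     .op .lt (.tmp .sum) (.tmp .patLen) (.tmp .isLess),
     .op .sub (.tmp .patLen) j (.tmp .rem),
     .op .sub (.tmp .sum) (.tmp .patLen) (.tmp .over)]
  let update : Circuit n M :=
    [.op .and a (.ext i) (.tmp .extended),
     .op .and (.tmp .isLess) (.tmp .extended) (.tmp .stays),
     .op .andNot (.pre i) (.tmp .isLess) (.tmp .starts),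
     .op .and (.suf i) a (.tmp .ended),
     .op .andNot (.tmp .ended) (.tmp .isLess) (.tmp .full)]
  [.load (k i) (.width i)] ++ prep ++
  segmentSearch L i (k i) (c i) j (.tmp .zero) (.width i) (.ext i) ++
  segmentSearch L i (k i) (c i) j (.tmp .zero) (.tmp .rem) (.suf i) ++
  segmentSearch L i (k i) (c i) (.tmp .zero) (.tmp .rem) (.tmp .over) (.pre i) ++
  update ++
  [.op .or (.tmp .stays) (.tmp .starts) (.act i.succ),
   .op .or (.mat i.castSucc) (.tmp .full) (.mat i.succ),
   .op .mod (.tmp .sum) (.tmp .patLen) (.pos i.succ)] ++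
  update.reverse ++ prep.reverse

/-- The whole computation of the outer oracle: initialisation and the for-loop over the segments.
The circuit depends only on `m`, the `k_i` and the `|T[i]|`; `P` and `T` are accessed by the QRAM. -/
def forLoop (L m : ℕ) (k c : Fin n → ℕ) : Circuit n M :=
  initCircuit m ++ (List.finRange n).flatMap (loopBody L m k c)

end Search

/-! ### Choice of the parameters -/

/-- The bit length of `m + N`. -/
def logSize (m N : ℕ) : ℕ := Nat.size (m + N)

/-- The word size: enough bits for `2 (m + N + σ)`. -/
def wordSize (σ m N : ℕ) : ℕ := Nat.size (m + N + σ) + 1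

/-- The number of runs in each Grover search: `κ * logSize m N` times the length of a cycle of
iteration numbers. -/
def numRuns (κ m N : ℕ) : ℕ := κ * logSize m N * (logSize m N + 1)

/-!
# Quantum string matching in generalised degenerate strings

*The control flow.* Let thread `h` have consumed `j` characters of the current prefix of the pattern.
Its bits mean `GDString.Active` (the last `j` columns agree with `P[1..j]`) and `GDString.Matched` (a
full match has ended in a column seen so far). Since every segment is shorter than the pattern, at
most one boundary of the grid `h + r * m` falls within a segment; `GDString.active_succ_of_lt`,
`GDString.active_succ_of_le` and `GDString.matched_succ` say that the update rules of the loop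
preserve these meanings. Once some string is fixed in every segment, a match is equality with a factor
of the concatenation, and the choices in different segments are independent. Hence the final match bit
is `f₁ h` (`GDString.f₁_iff_matched`).

*Exact Grover search.* If a fraction `sin² θ > 0` of the `2 ^ q` candidates are solutions, then `k`
iterations find one with probability `sin² ((2 * k + 1) * θ)` (`successProb_eq`). The numbers
`k = 0, 1, 2, 4, …` multiply the angle by `1, 3, 5, 9, …`; as `θ ≥ 2 ^ (-q / 2)` and each factor is at
most three times the one before, one of the angles lies in `[π / 6, π / 2]` (`exists_sin_sq_ge`).
So every cycle of runs succeeds with probability at least `1 / 4`, and `K` cycles fail with probability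
at most `(3 / 4) ^ K`.

*Imperfect oracles.* Each operation is a linear isometry and its own inverse, so reversing a list of
operations inverts the circuit. The notion of correctness that composes is `Reaches`: a circuit maps
a basis state to a basis state up to an error `ε` in norm. An oracle is called in a superposition of
candidates and leaves the candidate register alone, so its errors in the different branches are
orthogonal, and the error on the superposition is still at most `ε` (`norm_sum_smul_sub_le`). Thus each
call costs at most `ε`, however many candidates there are. After its runs a search is close to a
superposition of basis states in nearly all of which the accumulated disjunction has the right value;
copying this bit and undoing the runs therefore returns the work registers to zero, up to a small
error (`reaches_groverSearch`). This is used for the search `G₃` over characters, and then, with the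
oracle built from `G₃`, for the search `G₂` over strings (`reaches_segmentSearch`).

*Choice of constants.* With `200 * L` cycles a search with an exact oracle has error at most
`2 ^ (1 - 40 * L)`, which stays negligible after multiplication by the number of runs, iterations and
segments, each of which is polynomial in `2 ^ L`. So the thread state at the end of the loop is
`1 / 10`-close to the ideal basis state, and the right outcome has probability at least
`(9 / 10) ^ 2 > 2 / 3`. Superpositions of threads are harmless because the loop never writes the
identifier register (`lt_measureProb`). For the time, a search over `2 ^ q` candidates has `O(L ^ 2)`
runs of at most `2 ^ (q / 2)` iterations, and nesting two of them gives
`O(L ^ 5 * √(|T[i]| * k_i))` operations for segment `i` (`length_forLoop_le`).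
-/

noncomputable section

/-! ### Superpositions and orthogonality -/

/-- The Hilbert space of state vectors, with the `ℓ²` norm. -/
abbrev StateSpace (n M w : ℕ) := EuclideanSpace ℂ (Basis n M w)

/-- The state vector of a computational basis state. -/
def ket {n M w : ℕ} (z : Basis n M w) : StateSpace n M w := EuclideanSpace.single z 1

section Orthogonality

variable {n M w : ℕ}

theorem ket_apply (z x : Basis n M w) : (ket z).ofLp x = if x = z then 1 else 0 := by
  simp [ket]

theorem norm_ket (z : Basis n M w) : ‖ket z‖ = 1 := by simp [ket]

theorem inner_ket (z : Basis n M w) (ψ : StateSpace n M w) : inner ℂ (ket z) ψ = ψ.ofLp z := by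
  simp [ket, EuclideanSpace.inner_single_left]

/-- The vectors whose amplitudes vanish outside `A`. -/
def supportedOn (A : Set (Basis n M w)) : Submodule ℂ (StateSpace n M w) where
  carrier := {ψ | ∀ x ∉ A, ψ.ofLp x = 0}
  add_mem' := by
    intro a b ha hb x hx
    simp [ha x hx, hb x hx]
  zero_mem' := by intro x _; simp
  smul_mem' := by
    intro c a ha x hx
    simp [ha x hx]

theorem ket_mem_supportedOn {A : Set (Basis n M w)} {z : Basis n M w} (hz : z ∈ A) :
    ket z ∈ supportedOn A := by
  intro x hx
  rw [ket_apply, if_neg]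
  rintro rfl
  exact hx hz

theorem supportedOn_mono {A B : Set (Basis n M w)} (h : A ⊆ B) {ψ : StateSpace n M w}
    (hψ : ψ ∈ supportedOn A) : ψ ∈ supportedOn B := fun x hx => hψ x fun hA => hx (h hA)

theorem inner_eq_zero_of_disjoint {A B : Set (Basis n M w)} (h : Disjoint A B)
    {ψ φ : StateSpace n M w} (hψ : ψ ∈ supportedOn A) (hφ : φ ∈ supportedOn B) :
    inner ℂ ψ φ = 0 := by
  rw [PiLp.inner_apply]
  refine Finset.sum_eq_zero fun x _ => ?_
  by_cases hx : x ∈ A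
  · rw [hφ x (Set.disjoint_left.1 h hx), inner_zero_right]
  · rw [hψ x hx, inner_zero_left]

variable {κ : Type*}

/-- Pythagoras for linear combinations of pairwise orthogonal vectors. -/
theorem norm_sq_sum_smul (I : Finset κ) (f : κ → ℂ) (v : κ → StateSpace n M w)
    (h : ∀ s ∈ I, ∀ t ∈ I, s ≠ t → inner ℂ (v s) (v t) = 0) :
    ‖∑ s ∈ I, f s • v s‖ ^ 2 = ∑ s ∈ I, ‖f s‖ ^ 2 * ‖v s‖ ^ 2 := by
  classical
  induction I using Finset.induction_on with
  | empty => simp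
  | insert a I ha ih =>
    rw [Finset.sum_insert ha, Finset.sum_insert ha, ← ih fun s hs t ht =>
      h s (Finset.mem_insert_of_mem hs) t (Finset.mem_insert_of_mem ht), sq,
      norm_add_sq_eq_norm_sq_add_norm_sq_of_inner_eq_zero (𝕜 := ℂ), norm_smul]
    · ring
    · rw [inner_smul_left, inner_sum, Finset.sum_eq_zero, mul_zero]
      intro t ht
      rw [inner_smul_right, h a (Finset.mem_insert_self _ _) t (Finset.mem_insert_of_mem ht),
        mul_zero]
      rintro rfl
      exact ha ht

/-- If the vectors `v s` lie in pairwise disjoint blocks of basis states, and so do the vectors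
`u s`, with the same blocks, then a superposition of vectors `v s` that are `ε`-close to `u s` is
`ε`-close to the superposition of the `u s`. -/
theorem norm_sum_smul_sub_le (I : Finset κ) (f : κ → ℂ) (v u : κ → StateSpace n M w)
    (A : κ → Set (Basis n M w)) (hA : ∀ s ∈ I, ∀ t ∈ I, s ≠ t → Disjoint (A s) (A t))
    (hv : ∀ s ∈ I, v s ∈ supportedOn (A s)) (hu : ∀ s ∈ I, u s ∈ supportedOn (A s))
    {ε c : ℝ} (hε : 0 ≤ ε) (hc : 0 ≤ c) (h : ∀ s ∈ I, ‖v s - u s‖ ≤ ε)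
    (hf : ∑ s ∈ I, ‖f s‖ ^ 2 ≤ c ^ 2) :
    ‖∑ s ∈ I, f s • v s - ∑ s ∈ I, f s • u s‖ ≤ ε * c := by
  rw [← Finset.sum_sub_distrib]
  simp_rw [← smul_sub]
  refine le_of_sq_le_sq ?_ (by positivity)
  rw [norm_sq_sum_smul]
  · calc ∑ s ∈ I, ‖f s‖ ^ 2 * ‖v s - u s‖ ^ 2 ≤ ∑ s ∈ I, ‖f s‖ ^ 2 * ε ^ 2 := by
          refine Finset.sum_le_sum fun s hs => ?_
          have := h s hs
          gcongr
      _ = (∑ s ∈ I, ‖f s‖ ^ 2) * ε ^ 2 := by rw [Finset.sum_mul]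
      _ ≤ c ^ 2 * ε ^ 2 := by gcongr
      _ = (ε * c) ^ 2 := by ring
  · intro s hs t ht hst
    exact inner_eq_zero_of_disjoint (hA s hs t ht hst)
      (sub_mem (hv s hs) (hu s hs)) (sub_mem (hv t ht) (hu t ht))

end Orthogonality

/-! ### Elementary operations as isometries -/

section Unitary

variable {σ n m M w : ℕ}

theorem addTo_addTo (d : Reg n M) (g : Basis n M w → BitVec w) (x : Basis n M w) :
    addTo d g (addTo d g x) = x := by
  funext r
  by_cases h : r = d
  · subst h
    simp [addTo]
  · simp [addTo, h]

/-- The effect of a classical operation on basis states; the Hadamard and Pauli gates are left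
out. -/
def Gate.exec (P : Fin m → Fin σ) (T : GDString σ n) : Gate n M → Basis n M w → Basis n M w
  | .had _ _ => id
  | .pauliZ _ _ => id
  | .load v d => addTo d (fun _ => BitVec.ofNat w v)
  | .op f a b d => addTo d (fun y => f.eval (y a) (y b))
  | .readP a d => addTo d (fun y => patternCell P w (y a).toNat)
  | .readT i s c d => addTo d (fun y => textCell T w i (y s).toNat (y c).toNat)

/-- Operations other than the Hadamard and Pauli gates. -/
def Gate.IsClassical : Gate n M → Prop
  | .had _ _ => False
  | .pauliZ _ _ => False
  | _ => True

theorem Gate.exec_exec (P : Fin m → Fin σ) (T : GDString σ n) (g : Gate n M) (x : Basis n M w) :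
    g.exec P T (g.exec P T x) = x := by
  cases g <;> simp [Gate.exec, addTo_addTo]

theorem Gate.apply_of_isClassical (P : Fin m → Fin σ) (T : GDString σ n) {g : Gate n M}
    (hg : g.IsClassical) (ψ : QState n M w) : g.apply P T ψ = fun x => ψ (g.exec P T x) := by
  cases g <;> first | exact hg.elim | rfl

/-- Flipping qubit `b` of register `r`. -/
def flipBit (r : Reg n M) (b : ℕ) (x : Basis n M w) : Basis n M w :=
  Function.update x r (x r ^^^ BitVec.twoPow w b)

theorem flipBit_flipBit (r : Reg n M) (b : ℕ) (x : Basis n M w) :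
    flipBit r b (flipBit r b x) = x := by
  simp [flipBit]

theorem getLsbD_flipBit {r : Reg n M} {b : ℕ} (hb : b < w) (c : ℕ) (x : Basis n M w) :
    (flipBit r b x r).getLsbD c = ((x r).getLsbD c ^^ decide (b = c)) := by
  simp [flipBit, BitVec.getLsbD_twoPow, hb]

theorem Gate.apply_had (P : Fin m → Fin σ) (T : GDString σ n) {r : Reg n M} {b : ℕ} (hb : b < w)
    (ψ : QState n M w) : (Gate.had r b).apply P T ψ = fun x =>
      ((if (x r).getLsbD b then -ψ x else ψ x) + ψ (flipBit r b x)) / (√2 : ℝ) := by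
  simp [Gate.apply, hb, flipBit]

theorem Gate.apply_add (P : Fin m → Fin σ) (T : GDString σ n) (g : Gate n M) (ψ φ : QState n M w) :
    g.apply P T (ψ + φ) = g.apply P T ψ + g.apply P T φ := by
  funext x
  cases g <;> simp only [Gate.apply, Pi.add_apply] <;> split_ifs <;> ring

theorem Gate.apply_smul (P : Fin m → Fin σ) (T : GDString σ n) (g : Gate n M) (c : ℂ)
    (ψ : QState n M w) : g.apply P T (c • ψ) = c • g.apply P T ψ := by
  funext x
  cases g <;> simp only [Gate.apply, Pi.smul_apply, smul_eq_mul] <;> split_ifs <;> ring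

theorem sqrt_two_mul_self : ((√2 : ℝ) : ℂ) * ((√2 : ℝ) : ℂ) = 2 := by
  rw [← Complex.ofReal_mul, Real.mul_self_sqrt (by norm_num)]
  norm_num

theorem Gate.apply_apply (P : Fin m → Fin σ) (T : GDString σ n) (g : Gate n M)
    (ψ : QState n M w) : g.apply P T (g.apply P T ψ) = ψ := by
  by_cases hg : g.IsClassical
  · simp [Gate.apply_of_isClassical P T hg, Gate.exec_exec]
  · cases g with
    | had r b =>
      by_cases hb : b < w
      · funext x
        simp only [Gate.apply_had P T hb, flipBit_flipBit, getLsbD_flipBit hb, decide_true,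
          Bool.xor_true]
        have h2 := sqrt_two_mul_self
        have h3 : ((√2 : ℝ) : ℂ) ≠ 0 := by
          intro h
          rw [h] at h2
          norm_num at h2
        cases (x r).getLsbD b <;> simp only [Bool.not_true, Bool.not_false, if_true,
          Bool.false_eq_true, if_false] <;> field_simp <;> linear_combination (-ψ x) * h2
      · funext x
        simp [Gate.apply, hb]
    | pauliZ r b =>
      funext x
      simp only [Gate.apply]
      split_ifs <;> simp
    | _ => exact (hg trivial).elim

theorem Gate.sum_norm_sq_apply (P : Fin m → Fin σ) (T : GDString σ n) (g : Gate n M)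
    (ψ : QState n M w) : ∑ x, ‖g.apply P T ψ x‖ ^ 2 = ∑ x, ‖ψ x‖ ^ 2 := by
  by_cases hg : g.IsClassical
  · rw [Gate.apply_of_isClassical P T hg]
    exact Equiv.sum_comp (Function.Involutive.toPerm (g.exec P T) (Gate.exec_exec P T g))
      (fun x => ‖ψ x‖ ^ 2)
  · cases g with
    | had r b =>
      by_cases hb : b < w
      · -- the amplitudes of `x` and of its partner `flipBit r b x` satisfy the parallelogram law
        rw [Gate.apply_had P T hb]
        set F : Basis n M w → ℝ := fun x =>
          ‖((if (x r).getLsbD b then -ψ x else ψ x) + ψ (flipBit r b x)) / ((√2 : ℝ) : ℂ)‖ ^ 2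
          with hF
        have hflip : ∀ G : Basis n M w → ℝ, ∑ x, G (flipBit r b x) = ∑ x, G x := fun G =>
          Equiv.sum_comp (Function.Involutive.toPerm (flipBit r b) (flipBit_flipBit r b)) G
        have hpair : ∀ x, F x + F (flipBit r b x) = ‖ψ x‖ ^ 2 + ‖ψ (flipBit r b x)‖ ^ 2 := by
          intro x
          have hs : ‖((√2 : ℝ) : ℂ)‖ ^ 2 = 2 := by
            rw [Complex.norm_real, Real.norm_eq_abs, sq_abs, Real.sq_sqrt (by norm_num)]
          have hp := parallelogram_law_with_norm ℂ (ψ x) (ψ (flipBit r b x))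
          simp only [hF, norm_div, div_pow, hs, flipBit_flipBit, getLsbD_flipBit hb, decide_true,
            Bool.xor_true]
          cases (x r).getLsbD b
          · simp only [Bool.not_false, if_true, Bool.false_eq_true, if_false]
            rw [neg_add_eq_sub]
            nlinarith
          · simp only [Bool.not_true, if_true, Bool.false_eq_true, if_false]
            rw [neg_add_eq_sub, norm_sub_rev, add_comm (ψ (flipBit r b x))]
            nlinarith
        have h1 : ∑ x, (F x + F (flipBit r b x)) =
            ∑ x, (‖ψ x‖ ^ 2 + ‖ψ (flipBit r b x)‖ ^ 2) := Finset.sum_congr rfl fun x _ => hpair x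
        rw [Finset.sum_add_distrib, Finset.sum_add_distrib, hflip F,
          hflip fun x => ‖ψ x‖ ^ 2] at h1
        change ∑ x, F x = _
        linarith
      · simp [Gate.apply, hb]
    | pauliZ r b =>
      refine Finset.sum_congr rfl fun x _ => ?_
      simp only [Gate.apply]
      split_ifs <;> simp
    | _ => exact (hg trivial).elim

/-- An elementary operation as a linear isometry. -/
def Gate.isometry (P : Fin m → Fin σ) (T : GDString σ n) (g : Gate n M) :
    StateSpace n M w →ₗᵢ[ℂ] StateSpace n M w where
  toFun ψ := WithLp.toLp 2 (g.apply P T ψ.ofLp)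
  map_add' ψ φ := by
    rw [WithLp.ofLp_add, Gate.apply_add, WithLp.toLp_add]
  map_smul' c ψ := by
    rw [WithLp.ofLp_smul, Gate.apply_smul, WithLp.toLp_smul, RingHom.id_apply]
  norm_map' ψ := by
    change ‖WithLp.toLp 2 (g.apply P T ψ.ofLp)‖ = ‖ψ‖
    rw [← sq_eq_sq₀ (norm_nonneg _) (norm_nonneg _), EuclideanSpace.norm_sq_eq,
      EuclideanSpace.norm_sq_eq]
    exact Gate.sum_norm_sq_apply P T g _

theorem Gate.ofLp_isometry (P : Fin m → Fin σ) (T : GDString σ n) (g : Gate n M)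
    (ψ : StateSpace n M w) : (g.isometry P T ψ).ofLp = g.apply P T ψ.ofLp := rfl

/-- A circuit as a linear isometry. -/
def Circuit.isometry (P : Fin m → Fin σ) (T : GDString σ n) :
    Circuit n M → (StateSpace n M w →ₗᵢ[ℂ] StateSpace n M w)
  | [] => LinearIsometry.id
  | g :: C => (Circuit.isometry P T C).comp (g.isometry P T)

variable (P : Fin m → Fin σ) (T : GDString σ n)

theorem Circuit.isometry_nil (ψ : StateSpace n M w) :
    Circuit.isometry P T ([] : Circuit n M) ψ = ψ := rfl

theorem Circuit.isometry_cons (g : Gate n M) (C : Circuit n M) (ψ : StateSpace n M w) :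
    Circuit.isometry P T (g :: C) ψ = Circuit.isometry P T C (g.isometry P T ψ) := rfl

theorem Circuit.isometry_singleton (g : Gate n M) (ψ : StateSpace n M w) :
    Circuit.isometry P T [g] ψ = g.isometry P T ψ := rfl

theorem Circuit.isometry_append (C C' : Circuit n M) (ψ : StateSpace n M w) :
    Circuit.isometry P T (C ++ C') ψ = Circuit.isometry P T C' (Circuit.isometry P T C ψ) := by
  induction C generalizing ψ with
  | nil => rfl
  | cons g C ih => rw [List.cons_append, Circuit.isometry_cons, ih, Circuit.isometry_cons]

theorem Circuit.run_eq_isometry (C : Circuit n M) (ψ : StateSpace n M w) :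
    C.run P T ψ.ofLp = (Circuit.isometry P T C ψ).ofLp := by
  induction C generalizing ψ with
  | nil => rfl
  | cons g C ih =>
    rw [Circuit.isometry_cons, ← ih]
    rfl

theorem Circuit.isometry_reverse (C : Circuit n M) (ψ : StateSpace n M w) :
    Circuit.isometry P T C.reverse (Circuit.isometry P T C ψ) = ψ := by
  induction C generalizing ψ with
  | nil => rfl
  | cons g C ih =>
    rw [List.reverse_cons, Circuit.isometry_append, Circuit.isometry_cons P T g C, ih,
      Circuit.isometry_singleton]
    exact congrArg (WithLp.toLp 2) (Gate.apply_apply P T g ψ.ofLp)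

/-! ### Supports -/

/-- The operation changes no register outside `D`. -/
def Gate.WritesIn (D : Set (Reg n M)) : Gate n M → Prop
  | .had r _ => r ∈ D
  | .pauliZ _ _ => True
  | .load _ d => d ∈ D
  | .op _ _ _ d => d ∈ D
  | .readP _ d => d ∈ D
  | .readT _ _ _ d => d ∈ D

/-- The circuit changes no register outside `D`. -/
def Circuit.WritesIn (D : Set (Reg n M)) (C : Circuit n M) : Prop := ∀ g ∈ C, g.WritesIn D

theorem Circuit.WritesIn.mono {D D' : Set (Reg n M)} (h : D ⊆ D') {C : Circuit n M}
    (hC : Circuit.WritesIn D C) : Circuit.WritesIn D' C := by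
  intro g hg
  have := hC g hg
  cases g <;> first | exact h this | trivial

theorem Circuit.writesIn_append {D : Set (Reg n M)} {C C' : Circuit n M} :
    Circuit.WritesIn D (C ++ C') ↔ Circuit.WritesIn D C ∧ Circuit.WritesIn D C' := by
  simp only [Circuit.WritesIn, List.mem_append, or_imp, forall_and]

theorem Circuit.writesIn_reverse {D : Set (Reg n M)} {C : Circuit n M} :
    Circuit.WritesIn D C.reverse ↔ Circuit.WritesIn D C := by
  simp only [Circuit.WritesIn, List.mem_reverse]

/-- The basis states that agree with `z` outside `D`. -/
def block (D : Set (Reg n M)) (z : Basis n M w) : Set (Basis n M w) := {x | ∀ r ∉ D, x r = z r}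

theorem update_mem_block_iff {D : Set (Reg n M)} {r : Reg n M} (hr : r ∈ D) (v : BitVec w)
    (z x : Basis n M w) : Function.update x r v ∈ block D z ↔ x ∈ block D z := by
  refine forall₂_congr fun r' hr' => ?_
  rw [Function.update_of_ne]
  rintro rfl
  exact hr' hr

theorem Gate.isometry_mem_supportedOn {D : Set (Reg n M)} {g : Gate n M} (hg : g.WritesIn D)
    (z : Basis n M w) {ψ : StateSpace n M w} (hψ : ψ ∈ supportedOn (block D z)) :
    g.isometry P T ψ ∈ supportedOn (block D z) := by
  intro x hx
  rw [Gate.ofLp_isometry]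
  cases g with
  | had r b =>
    have h1 : flipBit r b x ∉ block D z := by rwa [flipBit, update_mem_block_iff hg]
    by_cases hb : b < w
    · simp [Gate.apply_had P T hb, hψ x hx, hψ _ h1]
    · simp [Gate.apply, hb, hψ x hx]
  | pauliZ r b => simp [Gate.apply, hψ x hx]
  | _ =>
    simp only [Gate.apply]
    refine hψ _ ?_
    rwa [addTo, update_mem_block_iff hg]

theorem Circuit.isometry_mem_supportedOn {D : Set (Reg n M)} {C : Circuit n M}
    (hC : Circuit.WritesIn D C) (z : Basis n M w) {ψ : StateSpace n M w}
    (hψ : ψ ∈ supportedOn (block D z)) :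
    Circuit.isometry P T C ψ ∈ supportedOn (block D z) := by
  induction C generalizing ψ with
  | nil => exact hψ
  | cons g C ih =>
    exact ih (fun g' hg' => hC g' (List.mem_cons_of_mem _ hg'))
      (Gate.isometry_mem_supportedOn P T (hC g List.mem_cons_self) z hψ)

theorem Circuit.isometry_ket_mem {D : Set (Reg n M)} {C : Circuit n M}
    (hC : Circuit.WritesIn D C) (z : Basis n M w) :
    Circuit.isometry P T C (ket z) ∈ supportedOn (block D z) :=
  Circuit.isometry_mem_supportedOn P T hC z (ket_mem_supportedOn fun _ _ => rfl)

/-! ### Approximate classical behaviour -/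

theorem Gate.isometry_ket_of_isClassical {g : Gate n M} (hg : g.IsClassical) (z : Basis n M w) :
    g.isometry P T (ket z) = ket (g.exec P T z) := by
  ext x
  rw [Gate.ofLp_isometry, Gate.apply_of_isClassical P T hg]
  change (ket z).ofLp (g.exec P T x) = _
  rw [ket_apply, ket_apply]
  refine if_congr ⟨?_, ?_⟩ rfl rfl
  · rintro rfl
    rw [Gate.exec_exec]
  · rintro rfl
    rw [Gate.exec_exec]

theorem Gate.isometry_pauliZ_ket (r : Reg n M) (b : ℕ) (z : Basis n M w) :
    (Gate.pauliZ r b).isometry P T (ket z) =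
      (if (z r).getLsbD b then (-1 : ℂ) else 1) • ket z := by
  ext x
  simp only [Gate.ofLp_isometry, Gate.apply, PiLp.smul_apply, ket_apply, smul_eq_mul]
  by_cases h : x = z
  · subst h
    split_ifs <;> simp
  · simp [h]

/-- The effect of a circuit of classical operations on basis states. -/
def Circuit.exec (P : Fin m → Fin σ) (T : GDString σ n) (C : Circuit n M) (z : Basis n M w) :
    Basis n M w :=
  C.foldl (fun y g => g.exec P T y) z

/-- `C` maps the basis state `z` to the basis state `z'` up to an error of norm `ε`. -/
def Reaches (P : Fin m → Fin σ) (T : GDString σ n) (C : Circuit n M) (z z' : Basis n M w)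
    (ε : ℝ) : Prop :=
  ‖Circuit.isometry P T C (ket z) - ket z'‖ ≤ ε

variable {P T}

theorem Reaches.nonneg {C : Circuit n M} {z z' : Basis n M w} {ε : ℝ}
    (h : Reaches P T C z z' ε) : 0 ≤ ε := (norm_nonneg _).trans h

theorem Reaches.mono {C : Circuit n M} {z z' : Basis n M w} {ε δ : ℝ}
    (h : Reaches P T C z z' ε) (hδ : ε ≤ δ) : Reaches P T C z z' δ := le_trans h hδ

theorem Reaches.append {C C' : Circuit n M} {z z' z'' : Basis n M w} {ε δ : ℝ}
    (h : Reaches P T C z z' ε) (h' : Reaches P T C' z' z'' δ) :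
    Reaches P T (C ++ C') z z'' (ε + δ) := by
  unfold Reaches at *
  rw [Circuit.isometry_append, ← sub_add_sub_cancel _ (Circuit.isometry P T C' (ket z')),
    ← map_sub]
  refine (norm_add_le _ _).trans (add_le_add ?_ h')
  rwa [LinearIsometry.norm_map]

theorem Reaches.reverse {C : Circuit n M} {z z' : Basis n M w} {ε : ℝ}
    (h : Reaches P T C z z' ε) : Reaches P T C.reverse z' z ε := by
  unfold Reaches at *
  rw [← Circuit.isometry_reverse P T C (ket z), ← map_sub, LinearIsometry.norm_map, norm_sub_rev]
  exact h

theorem reaches_exec {C : Circuit n M} (hC : ∀ g ∈ C, g.IsClassical) (z : Basis n M w) :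
    Reaches P T C z (Circuit.exec P T C z) 0 := by
  have h : Circuit.isometry P T C (ket z) = ket (Circuit.exec P T C z) := by
    induction C generalizing z with
    | nil => rfl
    | cons g C ih =>
      rw [Circuit.isometry_cons,
        Gate.isometry_ket_of_isClassical P T (hC g List.mem_cons_self),
        ih (fun g' hg' => hC g' (List.mem_cons_of_mem _ hg'))]
      rfl
  rw [Reaches, h, sub_self, norm_zero]

end Unitary

/-! ### Hadamard transform and diffusion -/

section Hadamard

variable {σ n m M w : ℕ} (P : Fin m → Fin σ) (T : GDString σ n)

theorem ofNat_xor_twoPow {q s : ℕ} (hs : s < 2 ^ q) :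
    BitVec.ofNat w s ^^^ BitVec.twoPow w q = BitVec.ofNat w (2 ^ q + s) := by
  have h1 : BitVec.twoPow w q = BitVec.ofNat w (2 ^ q) := by
    apply BitVec.eq_of_toNat_eq
    rw [BitVec.toNat_twoPow, BitVec.toNat_ofNat]
  rw [h1, ← BitVec.ofNat_xor]
  congr 1
  rw [Nat.xor_comm]
  apply Nat.eq_of_testBit_eq
  intro i
  rw [Nat.testBit_xor, Nat.testBit_two_pow]
  by_cases hi : q = i
  · subst hi
    rw [Nat.testBit_two_pow_add_eq, Nat.testBit_lt_two_pow hs]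
    simp
  · rcases lt_or_gt_of_ne hi with h | h
    · rw [Nat.testBit_lt_two_pow (hs.trans (Nat.pow_lt_pow_right one_lt_two h)),
        Nat.testBit_lt_two_pow (x := 2 ^ q + s)]
      · simp [hi]
      · calc 2 ^ q + s < 2 ^ (q + 1) := by rw [pow_succ]; omega
          _ ≤ 2 ^ i := Nat.pow_le_pow_right two_pos h
    · rw [Nat.testBit_two_pow_add_gt h]
      simp [hi]

theorem ofNat_inj_of_lt {q s t : ℕ} (hq : q ≤ w) (hs : s < 2 ^ q) (ht : t < 2 ^ q)
    (h : BitVec.ofNat w s = BitVec.ofNat w t) : s = t := by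
  have hw : 2 ^ q ≤ 2 ^ w := Nat.pow_le_pow_right two_pos hq
  have := congrArg BitVec.toNat h
  rwa [BitVec.toNat_ofNat, BitVec.toNat_ofNat, Nat.mod_eq_of_lt (hs.trans_le hw),
    Nat.mod_eq_of_lt (ht.trans_le hw)] at this

theorem Gate.isometry_had_ket {r : Reg n M} {b : ℕ} (hb : b < w) {z : Basis n M w}
    (hz : (z r).getLsbD b = false) :
    (Gate.had r b).isometry P T (ket z) =
      ((1 / √2 : ℝ) : ℂ) • (ket z + ket (flipBit r b z)) := by
  ext x
  have h1 : flipBit r b x = z ↔ x = flipBit r b z := by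
    constructor
    · rintro rfl
      rw [flipBit_flipBit]
    · rintro rfl
      rw [flipBit_flipBit]
  rw [Gate.ofLp_isometry, Gate.apply_had P T hb]
  simp only [PiLp.smul_apply, PiLp.add_apply, ket_apply, h1, smul_eq_mul]
  by_cases hx : x = z
  · subst hx
    simp only [hz, Bool.false_eq_true, if_false, if_true]
    push_cast
    ring
  · simp only [hx, if_false]
    push_cast
    split_ifs <;> ring

/-- The superposition of the values `s < 2 ^ q` of register `r` with amplitudes `f s`. -/
def superpose (q : ℕ) (r : Reg n M) (z : Basis n M w) (f : ℕ → ℂ) : StateSpace n M w :=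
  ∑ s ∈ range (2 ^ q), f s • ket (Function.update z r (BitVec.ofNat w s))

theorem hadamards_succ (q : ℕ) (r : Reg n M) :
    (hadamards (q + 1) r : Circuit n M) = hadamards q r ++ [Gate.had r q] := by
  simp [hadamards, List.range_succ]

theorem hadamards_writesIn (q : ℕ) (r : Reg n M) :
    Circuit.WritesIn {r} (hadamards q r : Circuit n M) := by
  intro g hg
  simp only [hadamards, List.mem_map] at hg
  obtain ⟨b, -, rfl⟩ := hg
  exact Set.mem_singleton r

theorem isometry_hadamards_ket {q : ℕ} (hq : q ≤ w) {r : Reg n M} {z : Basis n M w}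
    (hz : z r = 0#w) :
    Circuit.isometry P T (hadamards q r) (ket z) =
      superpose q r z fun _ => ((1 / √2 : ℝ) : ℂ) ^ q := by
  induction q with
  | zero =>
    have : Function.update z r 0#w = z := by rw [← hz, Function.update_eq_self]
    simp [hadamards, Circuit.isometry_nil, superpose, this]
  | succ q ih =>
    have hqw : q < w := hq
    rw [hadamards_succ, Circuit.isometry_append, ih hqw.le, Circuit.isometry_singleton]
    unfold superpose
    rw [map_sum, pow_succ 2 q, mul_two, Finset.sum_range_add, ← Finset.sum_add_distrib]
    refine Finset.sum_congr rfl fun s hs => ?_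
    have hs' : s < 2 ^ q := Finset.mem_range.1 hs
    have hbit : (Function.update z r (BitVec.ofNat w s) r).getLsbD q = false := by
      rw [Function.update_self, BitVec.getLsbD_ofNat, Nat.testBit_lt_two_pow hs',
        Bool.and_false]
    rw [map_smul, Gate.isometry_had_ket P T hqw hbit, smul_smul, ← pow_succ, smul_add]
    congr 3
    rw [flipBit, Function.update_self, ofNat_xor_twoPow hs', Function.update_idem]

theorem isometry_had_comm {r : Reg n M} {b c : ℕ} (hbc : b ≠ c) (ψ : StateSpace n M w) :
    (Gate.had r b).isometry P T ((Gate.had r c).isometry P T ψ) =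
      (Gate.had r c).isometry P T ((Gate.had r b).isometry P T ψ) := by
  ext x
  simp only [Gate.ofLp_isometry]
  by_cases hb : b < w
  · by_cases hc : c < w
    · have hcomm : flipBit r b (flipBit r c x) = flipBit r c (flipBit r b x) := by
        simp only [flipBit, Function.update_self, Function.update_idem]
        rw [BitVec.xor_assoc, BitVec.xor_comm (BitVec.twoPow w c), ← BitVec.xor_assoc]
      simp only [Gate.apply_had P T hb, Gate.apply_had P T hc, getLsbD_flipBit hb,
        getLsbD_flipBit hc, hbc, hbc.symm, decide_false, Bool.xor_false, hcomm]
      split_ifs <;> ring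
    · simp [Gate.apply, hc]
  · simp [Gate.apply, hb]

theorem isometry_hadamards_hadamards (q : ℕ) (r : Reg n M) (ψ : StateSpace n M w) :
    Circuit.isometry P T (hadamards q r) (Circuit.isometry P T (hadamards q r) ψ) = ψ := by
  induction q generalizing ψ with
  | zero => rfl
  | succ q ih =>
    have hcomm : ∀ p ≤ q, ∀ φ : StateSpace n M w,
        Circuit.isometry P T (hadamards p r) ((Gate.had r q).isometry P T φ) =
          (Gate.had r q).isometry P T (Circuit.isometry P T (hadamards p r) φ) := by
      intro p hp
      induction p with
      | zero => intro φ; rfl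
      | succ p ih =>
        intro φ
        rw [hadamards_succ, Circuit.isometry_append, ih (Nat.le_of_succ_le hp),
          Circuit.isometry_append, Circuit.isometry_singleton, Circuit.isometry_singleton,
          isometry_had_comm P T (Nat.ne_of_lt hp)]
    simp only [hadamards_succ, Circuit.isometry_append, Circuit.isometry_singleton]
    rw [hcomm q le_rfl, ih]
    exact congrArg (WithLp.toLp 2) (Gate.apply_apply P T (Gate.had r q) ψ.ofLp)

theorem inner_superpose_uniform (q : ℕ) (r : Reg n M) (z : Basis n M w)
    (ψ : StateSpace n M w) :
    inner ℂ (superpose q r z fun _ => ((1 / √2 : ℝ) : ℂ) ^ q) ψ =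
      ((1 / √2 : ℝ) : ℂ) ^ q *
        ∑ s ∈ range (2 ^ q), ψ.ofLp (Function.update z r (BitVec.ofNat w s)) := by
  unfold superpose
  rw [sum_inner, Finset.mul_sum]
  refine Finset.sum_congr rfl fun s _ => ?_
  rw [inner_smul_left, inner_ket, map_pow, Complex.conj_ofReal]

theorem superpose_apply {q : ℕ} (hq : q ≤ w) (r : Reg n M) (z : Basis n M w) (f : ℕ → ℂ)
    {s : ℕ} (hs : s < 2 ^ q) :
    (superpose q r z f).ofLp (Function.update z r (BitVec.ofNat w s)) = f s := by
  unfold superpose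
  rw [WithLp.ofLp_sum, Finset.sum_apply, Finset.sum_eq_single s]
  · simp [ket_apply]
  · intro t ht hts
    rw [PiLp.smul_apply, ket_apply, if_neg, smul_zero]
    intro h
    have := congrFun h r
    rw [Function.update_self, Function.update_self] at this
    exact hts (ofNat_inj_of_lt hq hs (Finset.mem_range.1 ht) this).symm
  · intro h
    exact (h (Finset.mem_range.2 hs)).elim

theorem superpose_mem (q : ℕ) (r : Reg n M) (z : Basis n M w) (f : ℕ → ℂ) :
    superpose q r z f ∈ supportedOn (block {r} z) := by
  refine Submodule.sum_mem _ fun s _ => Submodule.smul_mem _ _ (ket_mem_supportedOn ?_)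
  rw [update_mem_block_iff (Set.mem_singleton r)]
  exact fun _ _ => rfl

theorem inv_sqrt_two_pow_mul (q : ℕ) :
    ((1 / √2 : ℝ) : ℂ) ^ q * ((1 / √2 : ℝ) : ℂ) ^ q = 1 / (2 : ℂ) ^ q := by
  rw [← mul_pow, ← Complex.ofReal_mul, div_mul_div_comm, Real.mul_self_sqrt (by norm_num)]
  push_cast
  rw [one_mul, div_pow, one_pow]

/-- The operations that reflect about the uniform superposition act on amplitudes by
`f ↦ f - 2 · mean f`. -/
theorem isometry_diffusion (l : Level) {q : ℕ} (hq : q ≤ w) (hw : 0 < w) {r : Reg n M}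
    {z : Basis n M w} (hr : r ≠ .isZero l) (hr' : r ≠ .tmp .zero)
    (hz : z (.isZero l) = 0#w) (hz' : z (.tmp .zero) = 0#w) (f : ℕ → ℂ) :
    Circuit.isometry P T
      (hadamards q r ++ [.op .eq r (.tmp .zero) (.isZero l), .pauliZ (.isZero l) 0,
        .op .eq r (.tmp .zero) (.isZero l)] ++ hadamards q r) (superpose q r z f) =
      superpose q r z fun s => f s - 2 / 2 ^ q * ∑ t ∈ range (2 ^ q), f t := by
  set H := Circuit.isometry (w := w) P T (hadamards q r : Circuit n M) with hH
  set ψ := superpose q r z f with hψ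
  set z₀ := Function.update z r 0#w with hz₀
  set c : ℂ := ((1 / √2 : ℝ) : ℂ) ^ q with hc
  have hHz₀ : H (ket z₀) = superpose q r z fun _ => c := by
    rw [hH, isometry_hadamards_ket P T hq (by rw [hz₀, Function.update_self])]
    simp only [superpose, hz₀, Function.update_idem]
    rfl
  have hmem : H ψ ∈ supportedOn (block {r} z) :=
    Circuit.isometry_mem_supportedOn P T (hadamards_writesIn q r) z (superpose_mem q r z f)
  have hamp : (H ψ).ofLp z₀ = c * ∑ t ∈ range (2 ^ q), f t := by
    rw [← inner_ket, ← LinearIsometry.inner_map_map H, hH, isometry_hadamards_hadamards, ← hH,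
      hHz₀, inner_superpose_uniform]
    congr 1
    exact Finset.sum_congr rfl fun s hs => superpose_apply hq r z f (Finset.mem_range.1 hs)
  have hrefl : Circuit.isometry P T [Gate.op .eq r (.tmp .zero) (.isZero l),
      .pauliZ (.isZero l) 0, .op .eq r (.tmp .zero) (.isZero l)] (H ψ) =
      H ψ - (2 * (H ψ).ofLp z₀) • ket z₀ := by
    ext x
    simp only [Circuit.isometry_cons, Circuit.isometry_nil, Gate.ofLp_isometry, Gate.apply,
      addTo_addTo, PiLp.sub_apply, PiLp.smul_apply, smul_eq_mul, ket_apply]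
    by_cases hx : x ∈ block {r} z
    · have hx1 : x (.isZero l) = 0#w := by rw [hx _ (by simpa using hr.symm), hz]
      have hx2 : x (.tmp .zero) = 0#w := by rw [hx _ (by simpa using hr'.symm), hz']
      have hne : Reg.tmp Scratch.zero ≠ (Reg.isZero l : Reg n M) := by simp
      have key : x = z₀ ↔ x r = 0#w := by
        constructor
        · rintro rfl
          rw [hz₀, Function.update_self]
        · intro h
          funext r'
          by_cases hr' : r' = r
          · subst hr'
            rw [hz₀, Function.update_self, h]
          · rw [hz₀, Function.update_of_ne hr', hx r' hr']
      have hlhs : (addTo (Reg.isZero l) (fun y : Basis n M w =>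
          WordOp.eval .eq (y r) (y (.tmp .zero))) x (Reg.isZero l)).getLsbD 0 =
            decide (x r = 0#w) := by
        simp only [addTo, Function.update_self, hx1, WordOp.eval, Function.update_of_ne hr,
          Function.update_of_ne hne, hx2]
        by_cases h : x r = 0#w <;> simp [h, hw]
      rw [hlhs]
      by_cases h : x r = 0#w
      · rw [← key] at h
        have h' := key.1 h
        rw [if_pos (by simpa using h'), if_pos h, h]
        ring
      · rw [if_neg (by simpa using h), if_neg (fun h' => h (key.1 h'))]
        ring
    · have hxz : x ≠ z₀ := by
        rintro rfl
        exact hx (by rw [hz₀, update_mem_block_iff (Set.mem_singleton r)]; exact fun _ _ => rfl)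
      rw [hmem x hx, if_neg hxz]
      simp
  rw [Circuit.isometry_append, Circuit.isometry_append, hrefl, map_sub, map_smul, ← hH, hHz₀,
    hH, isometry_hadamards_hadamards, ← hH, hamp, hψ]
  unfold superpose
  rw [Finset.smul_sum, ← Finset.sum_sub_distrib]
  refine Finset.sum_congr rfl fun s _ => ?_
  rw [smul_smul, ← sub_smul]
  congr 2
  have := inv_sqrt_two_pow_mul q
  rw [← hc] at this
  clear_value c
  linear_combination (2 * ∑ t ∈ range (2 ^ q), f t) * this

/-- Conjugation by a circuit `O` that approximately computes `y s ↦ z s`: if the operation `g` maps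
`z s` to `c s • z' s` and `O` also computes `y' s ↦ z' s`, then `O`, `g` and the inverse of `O` together
map the superposition of the `y s` to that of the `c s • y' s`. The register `r` distinguishes the
branches of the superposition. -/
theorem norm_isometry_conj_sub_le {κ : Type*} (I : Finset κ) (f c : κ → ℂ)
    {O : Circuit n M} {g : Gate n M} {D : Set (Reg n M)} (hO : Circuit.WritesIn D O)
    {r : Reg n M} (hr : r ∉ D) (y z y' z' : κ → Basis n M w)
    (hkey : ∀ s ∈ I, ∀ t ∈ I, s ≠ t → y s r ≠ y t r)
    (hz : ∀ s ∈ I, z s r = y s r) (hy' : ∀ s ∈ I, y' s r = y s r)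
    (hz' : ∀ s ∈ I, z' s r = y s r) {ε : ℝ} (hε : 0 ≤ ε)
    (h : ∀ s ∈ I, Reaches P T O (y s) (z s) ε) (h' : ∀ s ∈ I, Reaches P T O (y' s) (z' s) ε)
    (hg : ∀ s ∈ I, g.isometry P T (ket (z s)) = c s • ket (z' s)) (hc : ∀ s ∈ I, ‖c s‖ = 1)
    (hf : ∑ s ∈ I, ‖f s‖ ^ 2 ≤ 1) :
    ‖Circuit.isometry P T (O ++ [g] ++ O.reverse) (∑ s ∈ I, f s • ket (y s)) -
      ∑ s ∈ I, (f s * c s) • ket (y' s)‖ ≤ 2 * ε := by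
  set A : κ → Set (Basis n M w) := fun s => {x | x r = y s r} with hA
  have hdisj : ∀ s ∈ I, ∀ t ∈ I, s ≠ t → Disjoint (A s) (A t) := fun s hs t ht hst =>
    Set.disjoint_left.2 fun x hx hx' => hkey s hs t ht hst (hx.symm.trans hx')
  have hmem : ∀ s, ∀ x : Basis n M w, x r = y s r →
      Circuit.isometry P T O (ket x) ∈ supportedOn (A s) := fun s x hx =>
    supportedOn_mono (fun x' hx' => (hx' r hr).trans hx) (Circuit.isometry_ket_mem P T hO x)
  have e1 : ‖Circuit.isometry P T O (∑ s ∈ I, f s • ket (y s)) -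
      ∑ s ∈ I, f s • ket (z s)‖ ≤ ε := by
    simp_rw [map_sum, map_smul]
    rw [← mul_one ε]
    exact norm_sum_smul_sub_le I f _ _ A hdisj (fun s _ => hmem s _ rfl)
      (fun s hs => ket_mem_supportedOn (hz s hs)) hε zero_le_one h (by simpa using hf)
  have e2 : ‖Circuit.isometry P T O (∑ s ∈ I, (f s * c s) • ket (y' s)) -
      ∑ s ∈ I, (f s * c s) • ket (z' s)‖ ≤ ε := by
    simp_rw [map_sum, map_smul]
    rw [← mul_one ε]
    refine norm_sum_smul_sub_le I _ _ _ A hdisj (fun s hs => hmem s _ (hy' s hs))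
      (fun s hs => ket_mem_supportedOn (hz' s hs)) hε zero_le_one h' ?_
    rw [one_pow]
    refine le_trans (Finset.sum_le_sum fun s hs => ?_) hf
    rw [norm_mul, hc s hs, mul_one]
  have e3 : g.isometry P T (∑ s ∈ I, f s • ket (z s)) = ∑ s ∈ I, (f s * c s) • ket (z' s) := by
    rw [map_sum]
    exact Finset.sum_congr rfl fun s hs => by rw [map_smul, hg s hs, smul_smul]
  rw [Circuit.isometry_append, Circuit.isometry_append, Circuit.isometry_singleton,
    ← Circuit.isometry_reverse P T O (∑ s ∈ I, (f s * c s) • ket (y' s)), ← map_sub,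
    LinearIsometry.norm_map, ← sub_add_sub_cancel _ (∑ s ∈ I, (f s * c s) • ket (z' s))]
  refine (norm_add_le _ _).trans ?_
  rw [two_mul, norm_sub_rev (∑ s ∈ I, (f s * c s) • ket (z' s))]
  refine add_le_add ?_ e2
  rw [← e3, ← map_sub, LinearIsometry.norm_map]
  exact e1

end Hadamard

/-! ### Amplitudes of Grover's algorithm -/

section Amplitudes

open Classical in
/-- The truth value of `p` as a word. -/
def bit {w : ℕ} (p : Prop) : BitVec w := if p then 1#w else 0#w

variable (q : ℕ) (pred : ℕ → Prop) [DecidablePred pred]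

/-- The effect of a Grover iteration on the amplitudes: the signs of the solutions are flipped, and
then twice the mean is subtracted. -/
def groverMap (f : ℕ → ℝ) (s : ℕ) : ℝ :=
  (if pred s then -f s else f s) - 2 / 2 ^ q * ∑ t ∈ range (2 ^ q), if pred t then -f t else f t

/-- The amplitudes after `k` Grover iterations that start from the uniform superposition. -/
def groverAmp : ℕ → ℕ → ℝ
  | 0 => fun _ => (1 / √2) ^ q
  | k + 1 => groverMap q pred (groverAmp k)

theorem sum_groverMap_sq (f : ℕ → ℝ) :
    ∑ s ∈ range (2 ^ q), groverMap q pred f s ^ 2 = ∑ s ∈ range (2 ^ q), f s ^ 2 := by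
  set g : ℕ → ℝ := fun s => if pred s then -f s else f s with hg
  have h1 : ∀ s, f s ^ 2 = g s ^ 2 := fun s => by
    simp only [hg]
    split_ifs <;> ring
  simp_rw [h1]
  have h2 : ∀ s, groverMap q pred f s ^ 2 = g s ^ 2 -
      (4 / 2 ^ q * ∑ t ∈ range (2 ^ q), g t) * g s + (2 / 2 ^ q * ∑ t ∈ range (2 ^ q), g t) ^ 2 := by
    intro s
    simp only [groverMap, hg]
    ring
  simp_rw [h2]
  rw [Finset.sum_add_distrib, Finset.sum_sub_distrib, ← Finset.mul_sum, Finset.sum_const,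
    Finset.card_range, nsmul_eq_mul]
  push_cast
  field_simp
  ring

theorem sum_groverAmp_sq (k : ℕ) :
    ∑ s ∈ range (2 ^ q), groverAmp q pred k s ^ 2 = 1 := by
  induction k with
  | zero =>
    simp only [groverAmp, Finset.sum_const, Finset.card_range, nsmul_eq_mul]
    rw [← pow_mul, mul_comm q 2, pow_mul, div_pow, Real.sq_sqrt (by norm_num)]
    push_cast
    rw [← mul_pow]
    norm_num
  | succ k ih => rw [groverAmp, sum_groverMap_sq, ih]

/-- The probability that the measurement after `k` Grover iterations yields a solution. -/
def successProb (k : ℕ) : ℝ := ∑ s ∈ (range (2 ^ q)).filter pred, groverAmp q pred k s ^ 2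

theorem successProb_nonneg (k : ℕ) : 0 ≤ successProb q pred k :=
  Finset.sum_nonneg fun _ _ => sq_nonneg _

theorem sum_filter_not_groverAmp_sq (k : ℕ) :
    ∑ s ∈ (range (2 ^ q)).filter (fun s => ¬ pred s), groverAmp q pred k s ^ 2 =
      1 - successProb q pred k := by
  rw [← sum_groverAmp_sq q pred k, successProb,
    ← Finset.sum_filter_add_sum_filter_not (range (2 ^ q)) pred]
  ring

theorem successProb_le_one (k : ℕ) : successProb q pred k ≤ 1 := by
  have h := sum_filter_not_groverAmp_sq q pred k
  have h' : 0 ≤ ∑ s ∈ (range (2 ^ q)).filter (fun s => ¬ pred s), groverAmp q pred k s ^ 2 :=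
    Finset.sum_nonneg fun _ _ => sq_nonneg _
  linarith

/-- With `sin² θ` the fraction of solutions, the state after `k` iterations is at angle
`(2k + 1)θ` from the span of the non-solutions, up to the sign `(-1)^k`. -/
theorem groverAmp_eq {θ : ℝ} (hθ : Real.sin θ ^ 2 * 2 ^ q = #((range (2 ^ q)).filter pred))
    (k s : ℕ) (hs : s < 2 ^ q) :
    (pred s → groverAmp q pred k s * √2 ^ q * Real.sin θ =
      (-1) ^ k * Real.sin ((2 * k + 1) * θ)) ∧
    (¬ pred s → groverAmp q pred k s * √2 ^ q * Real.cos θ =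
      (-1) ^ k * Real.cos ((2 * k + 1) * θ)) := by
  have h2 : √2 ^ q * √2 ^ q = (2 : ℝ) ^ q := by
    rw [← mul_pow, Real.mul_self_sqrt (by norm_num)]
  have h2' : (0 : ℝ) < √2 ^ q := by positivity
  have hcard : (#((range (2 ^ q)).filter pred) : ℝ) + #((range (2 ^ q)).filter fun s => ¬ pred s) =
      2 ^ q := by
    rw [← Nat.cast_add, Finset.card_filter_add_card_filter_not]
    simp
  have hcos : Real.cos θ ^ 2 * 2 ^ q = #((range (2 ^ q)).filter fun s => ¬ pred s) := by
    have := Real.sin_sq_add_cos_sq θ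
    linear_combination (2 ^ q : ℝ) * this - hθ - hcard
  induction k generalizing s with
  | zero =>
    simp only [groverAmp, ← mul_pow, Nat.cast_zero, mul_zero, zero_add, one_mul, pow_zero]
    have : (1 / √2 * √2 : ℝ) = 1 := by field_simp
    rw [this]
    simp
  | succ k ih =>
    set f := groverAmp q pred k with hf
    set φ := (2 * (k : ℝ) + 1) * θ with hφ
    -- the sum of the amplitudes after the sign flip
    have hsum : (∑ t ∈ range (2 ^ q), if pred t then -f t else f t) =
        √2 ^ q * ((-1) ^ k * Real.cos (θ + φ)) := by
      rw [Finset.sum_ite, Finset.sum_neg_distrib]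
      have e1 : ∑ t ∈ (range (2 ^ q)).filter pred, f t =
          √2 ^ q * ((-1) ^ k * (Real.sin φ * Real.sin θ)) := by
        by_cases h0 : Real.sin θ = 0
        · rw [h0] at hθ
          have : (range (2 ^ q)).filter pred = ∅ := by
            rw [← Finset.card_eq_zero]
            exact_mod_cast (by simpa using hθ.symm : (#((range (2 ^ q)).filter pred) : ℝ) = 0)
          rw [this, h0]
          simp
        · have : ∀ t ∈ (range (2 ^ q)).filter pred,
              f t = (-1) ^ k * Real.sin φ / (√2 ^ q * Real.sin θ) := by
            intro t ht
            rw [Finset.mem_filter, Finset.mem_range] at ht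
            rw [eq_div_iff (by positivity), ← (ih t ht.1).1 ht.2]
            ring
          rw [Finset.sum_congr rfl this, Finset.sum_const, nsmul_eq_mul, ← hθ, ← h2]
          field_simp
      have e2 : ∑ t ∈ (range (2 ^ q)).filter (fun t => ¬ pred t), f t =
          √2 ^ q * ((-1) ^ k * (Real.cos φ * Real.cos θ)) := by
        by_cases h0 : Real.cos θ = 0
        · rw [h0] at hcos
          have : (range (2 ^ q)).filter (fun t => ¬ pred t) = ∅ := by
            rw [← Finset.card_eq_zero]
            exact_mod_cast (by simpa using hcos.symm :
              (#((range (2 ^ q)).filter fun t => ¬ pred t) : ℝ) = 0)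
          rw [this, h0]
          simp
        · have : ∀ t ∈ (range (2 ^ q)).filter (fun t => ¬ pred t),
              f t = (-1) ^ k * Real.cos φ / (√2 ^ q * Real.cos θ) := by
            intro t ht
            rw [Finset.mem_filter, Finset.mem_range] at ht
            rw [eq_div_iff (by positivity), ← (ih t ht.1).2 ht.2]
            ring
          rw [Finset.sum_congr rfl this, Finset.sum_const, nsmul_eq_mul, ← hcos, ← h2]
          field_simp
      rw [e1, e2, Real.cos_add]
      ring
    have hnext : (2 * ((k + 1 : ℕ) : ℝ) + 1) * θ = θ + (θ + φ) := by
      rw [hφ]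
      push_cast
      ring
    have hback : Real.sin φ = Real.sin (θ + φ) * Real.cos θ - Real.cos (θ + φ) * Real.sin θ := by
      rw [← Real.sin_sub, add_sub_cancel_left]
    have hback' : Real.cos φ = Real.cos (θ + φ) * Real.cos θ + Real.sin (θ + φ) * Real.sin θ := by
      rw [← Real.cos_sub, add_sub_cancel_left]
    rw [hnext, Real.sin_add θ (θ + φ), Real.cos_add θ (θ + φ)]
    have hmean : 2 / 2 ^ q * (√2 ^ q * ((-1) ^ k * Real.cos (θ + φ))) * √2 ^ q =
        2 * (-1) ^ k * Real.cos (θ + φ) := by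
      rw [← h2]
      field_simp
    constructor
    · intro hp
      have := (ih s hs).1 hp
      rw [groverAmp, groverMap, if_pos hp, ← hf, hsum, pow_succ]
      rw [hback] at this
      linear_combination -this - Real.sin θ * hmean
    · intro hp
      have := (ih s hs).2 hp
      rw [groverAmp, groverMap, if_neg hp, ← hf, hsum, pow_succ]
      rw [hback'] at this
      linear_combination this - Real.cos θ * hmean

theorem successProb_eq {θ : ℝ} (hθ : Real.sin θ ^ 2 * 2 ^ q = #((range (2 ^ q)).filter pred))
    (h0 : Real.sin θ ≠ 0) (k : ℕ) :
    successProb q pred k = Real.sin ((2 * k + 1) * θ) ^ 2 := by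
  have h2 : √2 ^ q * √2 ^ q = (2 : ℝ) ^ q := by
    rw [← mul_pow, Real.mul_self_sqrt (by norm_num)]
  have : ∀ s ∈ (range (2 ^ q)).filter pred, groverAmp q pred k s ^ 2 =
      Real.sin ((2 * k + 1) * θ) ^ 2 / (2 ^ q * Real.sin θ ^ 2) := by
    intro s hs
    rw [Finset.mem_filter, Finset.mem_range] at hs
    rw [eq_div_iff (by positivity)]
    have h := (groverAmp_eq q pred hθ k s hs.1).1 hs.2
    have hs : ((-1 : ℝ) ^ k) ^ 2 = 1 := by rw [← pow_mul, mul_comm, pow_mul]; simp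
    calc groverAmp q pred k s ^ 2 * (2 ^ q * Real.sin θ ^ 2)
        = (groverAmp q pred k s * √2 ^ q * Real.sin θ) ^ 2 := by rw [← h2]; ring
      _ = _ := by rw [h, mul_pow, hs, one_mul]
  rw [successProb, Finset.sum_congr rfl this, Finset.sum_const, nsmul_eq_mul, ← hθ]
  field_simp

/-- The numbers of iterations `0, 1, 2, 4, …, 2 ^ (q / 2)` multiply the angle by `1, 3, 5, 9, …`, so
one of the multiples of `θ` lands in `[π / 6, π / 2]`. -/
theorem exists_sin_sq_ge {θ : ℝ} (h0 : 0 < θ) (h1 : θ ≤ Real.pi / 2)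
    (hθ : 1 ≤ Real.sin θ ^ 2 * 2 ^ q) :
    ∃ u ≤ q / 2 + 1, 1 / 4 ≤ Real.sin ((2 * ((2 ^ u / 2 : ℕ) : ℝ) + 1) * θ) ^ 2 := by
  have hpi := Real.pi_pos
  have hpi' := Real.pi_gt_three
  have hpi4 := Real.pi_le_four
  have key : ∀ x : ℝ, Real.pi / 6 ≤ x → x ≤ Real.pi / 2 → 1 / 4 ≤ Real.sin x ^ 2 := by
    intro x hx hx'
    have : 1 / 2 ≤ Real.sin x := by
      rw [← Real.sin_pi_div_six]
      exact Real.sin_le_sin_of_le_of_le_pi_div_two (by linarith) hx' hx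
    nlinarith
  -- the last multiple exceeds `π / 6`
  have hlast : Real.pi / 6 ≤ (2 * ((2 ^ (q / 2 + 1) / 2 : ℕ) : ℝ) + 1) * θ := by
    have e : 2 ^ (q / 2 + 1) / 2 = 2 ^ (q / 2) := by rw [pow_succ]; omega
    rw [e]
    push_cast
    have hsin : Real.sin θ ≤ θ := Real.sin_le h0.le
    have hsin0 : 0 < Real.sin θ := Real.sin_pos_of_pos_of_lt_pi h0 (by linarith)
    have hq : (2 : ℝ) ^ q ≤ 2 * (2 ^ (q / 2)) ^ 2 := by
      rw [← pow_mul, ← pow_succ']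
      exact pow_le_pow_right₀ (by norm_num) (by omega)
    have h3 : 1 ≤ θ ^ 2 * (2 * (2 ^ (q / 2)) ^ 2) :=
      hθ.trans (mul_le_mul (by gcongr) hq (by positivity) (by positivity))
    have h4 : 0 ≤ θ * 2 ^ (q / 2) := by positivity
    have h5 : 1 / 2 ≤ θ * 2 ^ (q / 2) := by nlinarith
    nlinarith
  classical
  -- At the first multiple beyond `π / 6` the one before is below `π / 6`, and the factors grow at most
  -- threefold, so it is at most `π / 2`.
  have hex : ∃ u, Real.pi / 6 ≤ (2 * ((2 ^ u / 2 : ℕ) : ℝ) + 1) * θ := ⟨_, hlast⟩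
  refine ⟨Nat.find hex, Nat.find_min' hex hlast, key _ (Nat.find_spec hex) ?_⟩
  rcases hu : Nat.find hex with _ | u
  · norm_num
    linarith
  · have hmin := Nat.find_min hex (m := u) (by omega)
    rw [not_le] at hmin
    have e : 2 ^ (u + 1) / 2 = 2 ^ u := by rw [pow_succ]; omega
    rw [e]
    rcases u with _ | u
    · norm_num at hmin ⊢
      linarith
    · have e' : 2 ^ (u + 1) / 2 = 2 ^ u := by rw [pow_succ]; omega
      rw [e'] at hmin
      push_cast at hmin ⊢
      rw [pow_succ]
      nlinarith

/-- One of the runs of a cycle succeeds with probability at least `1 / 4`, if there is a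
solution. -/
theorem exists_successProb_ge (h : ∃ s < 2 ^ q, pred s) :
    ∃ u ≤ q / 2 + 1, 1 / 4 ≤ successProb q pred (2 ^ u / 2) := by
  obtain ⟨s, hs, hp⟩ := h
  set N := #((range (2 ^ q)).filter pred) with hN
  have hN1 : 1 ≤ N := Finset.card_pos.2 ⟨s, by simp [hs, hp]⟩
  have hN2 : N ≤ 2 ^ q := by simpa using Finset.card_filter_le (range (2 ^ q)) pred
  have hN1' : (1 : ℝ) ≤ N := by exact_mod_cast hN1
  have hN2' : (N : ℝ) ≤ 2 ^ q := by exact_mod_cast hN2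
  have hx0 : 0 < √((N : ℝ) / 2 ^ q) := Real.sqrt_pos.2 (by positivity)
  have hx1 : √((N : ℝ) / 2 ^ q) ≤ 1 := Real.sqrt_le_one.2 ((div_le_one (by positivity)).2 hN2')
  set θ := Real.arcsin (√((N : ℝ) / 2 ^ q)) with hθ
  have hsin : Real.sin θ = √((N : ℝ) / 2 ^ q) := Real.sin_arcsin (by linarith) hx1
  have hsq : Real.sin θ ^ 2 * 2 ^ q = N := by
    rw [hsin, Real.sq_sqrt (by positivity)]
    field_simp
  obtain ⟨u, hu, h⟩ := exists_sin_sq_ge q (Real.arcsin_pos.2 hx0) (Real.arcsin_le_pi_div_two _)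
    (by rw [hsq]; exact hN1')
  exact ⟨u, hu, by rwa [successProb_eq q pred hsq (by rw [hsin]; exact hx0.ne')]⟩

/-- All runs of `K` cycles fail with probability at most `(3 / 4) ^ K`, if there is a solution. -/
theorem prod_one_sub_successProb_le (h : ∃ s < 2 ^ q, pred s) {L : ℕ} (hL : q / 2 + 1 ≤ L)
    (K : ℕ) :
    ∏ t ∈ range (K * (L + 1)), (1 - successProb q pred (iterations L q t)) ≤ (3 / 4) ^ K := by
  have h0 : ∀ k, 0 ≤ 1 - successProb q pred k := fun k =>
    sub_nonneg.2 (successProb_le_one q pred k)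
  obtain ⟨u, hu, hp⟩ := exists_successProb_ge q pred h
  induction K with
  | zero => simp
  | succ K ih =>
    rw [Nat.succ_mul, Finset.prod_range_add, pow_succ]
    refine mul_le_mul ih ?_ (Finset.prod_nonneg fun _ _ => h0 _) (by positivity)
    have hu' : u ∈ range (L + 1) := Finset.mem_range.2 (by omega)
    rw [← Finset.mul_prod_erase _ _ hu']
    have e : iterations L q (K * (L + 1) + u) = 2 ^ u / 2 := by
      rw [iterations, Nat.add_comm, Nat.add_mul_mod_self_right,
        Nat.mod_eq_of_lt (Finset.mem_range.1 hu'), min_eq_left hu]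
    rw [e]
    calc (1 - successProb q pred (2 ^ u / 2)) * _ ≤ 3 / 4 * 1 := by
          refine mul_le_mul (by linarith) (Finset.prod_le_one (fun _ _ => h0 _) fun _ _ => ?_)
            (Finset.prod_nonneg fun _ _ => h0 _) (by norm_num)
          linarith [successProb_nonneg q pred (iterations L q (K * (L + 1) + ‹ℕ›))]
      _ = 3 / 4 := mul_one _

end Amplitudes

/-! ### Grover search with an unknown number of solutions and an imperfect oracle -/

section Search

variable {σ n m M w : ℕ} {P : Fin m → Fin σ} {T : GDString σ n}

theorem getLsbD_bit (hw : 0 < w) (p : Prop) [Decidable p] :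
    (bit p : BitVec w).getLsbD 0 = decide p := by
  unfold bit
  by_cases h : p <;> simp [h, hw]

theorem bit_or (p p' : Prop) :
    (bit p : BitVec w) ||| bit p' = bit (p ∨ p') := by
  unfold bit
  by_cases h : p <;> by_cases h' : p' <;> simp [h, h']

theorem sum_norm_ofReal_sq {κ : Type*} (I : Finset κ) (f : κ → ℝ) :
    ∑ s ∈ I, ‖(f s : ℂ)‖ ^ 2 = ∑ s ∈ I, f s ^ 2 := by
  simp only [Complex.norm_real, Real.norm_eq_abs, sq_abs]

/-- A Grover iteration with an oracle of error `ε` acts on amplitudes by `groverMap`, with error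
`2ε`. -/
theorem norm_isometry_groverStep_sub_le (l : Level) {q : ℕ} (hq : q ≤ w) (hw : 0 < w)
    {r b : Reg n M} {O : Circuit n M} {D : Set (Reg n M)} (hO : Circuit.WritesIn D O) (hrD : r ∉ D)
    (hr : r ≠ .isZero l) (hr' : r ≠ .tmp .zero) {y : Basis n M w} (hy : y (.isZero l) = 0#w)
    (hy' : y (.tmp .zero) = 0#w) (z : ℕ → Basis n M w)
    (hz : ∀ s < 2 ^ q, z s r = BitVec.ofNat w s) (pred : ℕ → Prop) [DecidablePred pred]
    (hb : ∀ s < 2 ^ q, z s b = bit (pred s)) {ε : ℝ}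
    (h : ∀ s < 2 ^ q, Reaches P T O (Function.update y r (BitVec.ofNat w s)) (z s) ε)
    (f : ℕ → ℝ) (hf : ∑ s ∈ range (2 ^ q), f s ^ 2 ≤ 1) :
    ‖Circuit.isometry P T (groverStep l q r b O) (superpose q r y fun s => (f s : ℂ)) -
      superpose q r y fun s => (groverMap q pred f s : ℂ)‖ ≤ 2 * ε := by
  have e : groverStep l q r b O = (O ++ [.pauliZ b 0] ++ O.reverse) ++
      (hadamards q r ++ [.op .eq r (.tmp .zero) (.isZero l), .pauliZ (.isZero l) 0,
        .op .eq r (.tmp .zero) (.isZero l)] ++ hadamards q r) := by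
    simp only [groverStep, List.append_assoc]
  set c : ℕ → ℂ := fun s => if pred s then -1 else 1 with hc
  have hmap : (superpose q r y fun s => (groverMap q pred f s : ℂ)) =
      superpose q r y fun s => (f s * c s) - 2 / 2 ^ q * ∑ t ∈ range (2 ^ q), f t * c t := by
    congr 1
    funext s
    have hs : ∀ s, ((if pred s then -f s else f s : ℝ) : ℂ) = f s * c s := by
      intro s
      simp only [hc]
      split_ifs <;> simp
    simp only [groverMap]
    push_cast [hs]
    rfl
  rw [e, Circuit.isometry_append, hmap, ← isometry_diffusion P T l hq hw hr hr' hy hy', ← map_sub,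
    LinearIsometry.norm_map]
  unfold superpose
  refine norm_isometry_conj_sub_le P T (range (2 ^ q)) _ c hO hrD _ z _ z ?_ ?_ (fun _ _ => rfl) ?_
    (h 0 (by positivity)).nonneg ?_ ?_ ?_ ?_ ?_
  · intro s hs t ht hst
    rw [Function.update_self, Function.update_self]
    exact fun h => hst (ofNat_inj_of_lt hq (mem_range.1 hs) (mem_range.1 ht) h)
  · intro s hs
    rw [Function.update_self, hz s (mem_range.1 hs)]
  · intro s hs
    rw [Function.update_self, hz s (mem_range.1 hs)]
  · exact fun s hs => h s (mem_range.1 hs)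
  · exact fun s hs => h s (mem_range.1 hs)
  · intro s hs
    rw [Gate.isometry_pauliZ_ket, hb s (mem_range.1 hs), getLsbD_bit hw]
    simp [hc]
  · intro s _
    simp only [hc]
    split_ifs <;> simp
  · rwa [sum_norm_ofReal_sq]

theorem norm_isometry_groverSteps_sub_le (l : Level) {q : ℕ} (hq : q ≤ w) (hw : 0 < w)
    {r b : Reg n M} {O : Circuit n M} {D : Set (Reg n M)} (hO : Circuit.WritesIn D O) (hrD : r ∉ D)
    (hr : r ≠ .isZero l) (hr' : r ≠ .tmp .zero) {y : Basis n M w} (hy : y (.isZero l) = 0#w)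
    (hy' : y (.tmp .zero) = 0#w) (z : ℕ → Basis n M w)
    (hz : ∀ s < 2 ^ q, z s r = BitVec.ofNat w s) (pred : ℕ → Prop) [DecidablePred pred]
    (hb : ∀ s < 2 ^ q, z s b = bit (pred s)) {ε : ℝ}
    (h : ∀ s < 2 ^ q, Reaches P T O (Function.update y r (BitVec.ofNat w s)) (z s) ε) (k : ℕ) :
    ‖Circuit.isometry P T (List.replicate k (groverStep l q r b O)).flatten
        (superpose q r y fun s => (groverAmp q pred 0 s : ℂ)) -
      superpose q r y fun s => (groverAmp q pred k s : ℂ)‖ ≤ k * (2 * ε) := by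
  induction k with
  | zero => simp [Circuit.isometry_nil]
  | succ k ih =>
    rw [List.replicate_succ', List.flatten_append, List.flatten_singleton,
      Circuit.isometry_append]
    have := norm_isometry_groverStep_sub_le l hq hw hO hrD hr hr' hy hy' z hz pred hb h
      (groverAmp q pred k) (sum_groverAmp_sq q pred k).le
    rw [← sub_add_sub_cancel _ (Circuit.isometry P T (groverStep l q r b O)
      (superpose q r y fun s => (groverAmp q pred k s : ℂ))), ← map_sub]
    refine (norm_add_le _ _).trans ?_
    rw [LinearIsometry.norm_map]
    push_cast
    rw [add_mul, one_mul]
    exact add_le_add ih this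

open Classical in
/-- A run of a Grover search ranges over `s < 2 ^ q` with the amplitudes of Grover's algorithm, and
updates the accumulated disjunction. -/
theorem norm_isometry_groverRun_sub_le (L : ℕ) (l : Level) {q : ℕ} (hq : q ≤ w) (hw : 0 < w)
    {b : Reg n M} {O : Reg n M → Circuit n M} {D : Set (Reg n M)} (t : Fin M)
    (hO : Circuit.WritesIn D (O (.cand l t))) (hrD : .cand l t ∉ D) (haD : .acc l t.castSucc ∉ D)
    (haD' : .acc l t.succ ∉ D) (hbD : b ∈ D) {y : Basis n M w} (hyr : y (.cand l t) = 0#w)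
    (hy : y (.isZero l) = 0#w) (hy' : y (.tmp .zero) = 0#w)
    (hya : y (.acc l t.castSucc) = 0#w ∨ y (.acc l t.castSucc) = 1#w)
    (hya' : y (.acc l t.succ) = 0#w) (G : ℕ → Reg n M → BitVec w) (pred : ℕ → Prop)
    (hG : ∀ s < 2 ^ q, G s b = bit (pred s)) {ε : ℝ}
    (h : ∀ s < 2 ^ q, ∀ v : BitVec w,
      Reaches P T (O (.cand l t))
        (Function.update (Function.update y (.cand l t) (BitVec.ofNat w s)) (.acc l t.succ) v)
        (D.piecewise (G s) (Function.update (Function.update y (.cand l t) (BitVec.ofNat w s))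
          (.acc l t.succ) v)) ε) :
    ‖Circuit.isometry P T (groverRun L l q b O t) (ket y) -
      ∑ s ∈ range (2 ^ q), (groverAmp q pred (iterations L q t) s : ℂ) •
        ket (Function.update (Function.update y (.cand l t) (BitVec.ofNat w s)) (.acc l t.succ)
          (bit (y (.acc l t.castSucc) ≠ 0#w ∨ pred s)))‖ ≤ 2 * (iterations L q t + 1) * ε := by
  set k := iterations L q t with hk
  set r : Reg n M := .cand l t with hr
  set a : Reg n M := .acc l t.castSucc with ha
  set a' : Reg n M := .acc l t.succ with ha'
  have har : a' ≠ r := by simp [ha', hr]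
  have haa : a ≠ a' := by
    simp only [ha, ha', ne_eq, Reg.acc.injEq, true_and]
    exact (Fin.castSucc_lt_succ (i := t)).ne
  have haa' : a ≠ r := by simp [ha, hr]
  have hba : b ≠ a' := fun h => haD' (h ▸ hbD)
  set y' : ℕ → Basis n M w := fun s => Function.update y r (BitVec.ofNat w s) with hy'def
  have hupd : ∀ s, Function.update (y' s) a' (y a') = y' s := by
    intro s
    conv_lhs => rw [show y a' = y' s a' from (Function.update_of_ne har _ _).symm]
    rw [Function.update_eq_self]
  set z : ℕ → Basis n M w := fun s => D.piecewise (G s) (y' s) with hzdef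
  have hz : ∀ s < 2 ^ q, Reaches P T (O r) (y' s) (z s) ε := by
    intro s hs
    have := h s hs (y a')
    rwa [show Function.update (Function.update y r (BitVec.ofNat w s)) a' (y a') = y' s from
      hupd s] at this
  have hzr : ∀ s < 2 ^ q, z s r = BitVec.ofNat w s := by
    intro s _
    simp only [hzdef, Set.piecewise_eq_of_notMem _ _ _ hrD, hy'def, Function.update_self]
  have hzb : ∀ s < 2 ^ q, z s b = bit (pred s) := by
    intro s hs
    simp only [hzdef, Set.piecewise_eq_of_mem _ _ _ hbD, hG s hs]
  have e : groverRun L l q b O t = hadamards q r ++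
      (List.replicate k (groverStep l q r b (O r))).flatten ++
      (O r ++ [.op .or a b a'] ++ (O r).reverse) := by
    simp only [groverRun, List.append_assoc, hr, ha, ha', hk]
  have h0 : Circuit.isometry P T (hadamards q r) (ket y) =
      superpose q r y fun s => (groverAmp q pred 0 s : ℂ) := by
    rw [isometry_hadamards_ket P T hq hyr]
    simp [groverAmp]
  have h1 := norm_isometry_groverSteps_sub_le (P := P) (T := T) l hq hw hO hrD (by simp [hr])
    (by simp [hr]) hy hy' z hzr pred hzb hz k
  have h2 := norm_isometry_conj_sub_le P T (range (2 ^ q))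
    (fun s => (groverAmp q pred k s : ℂ)) (fun _ => 1) (g := .op .or a b a') hO hrD y' z
    (fun s => Function.update (y' s) a' (bit (y a ≠ 0#w ∨ pred s)))
    (fun s => D.piecewise (G s) (Function.update (y' s) a' (bit (y a ≠ 0#w ∨ pred s))))
    (by
      intro s hs t ht hst
      simp only [hy'def, Function.update_self]
      exact fun h => hst (ofNat_inj_of_lt hq (mem_range.1 hs) (mem_range.1 ht) h))
    (fun s hs => by rw [hzr s (mem_range.1 hs)]; simp [hy'def])
    (fun s _ => Function.update_of_ne har.symm _ _)
    (fun s _ => by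
      rw [Set.piecewise_eq_of_notMem _ _ _ hrD, Function.update_of_ne har.symm])
    (hz 0 (by positivity)).nonneg (fun s hs => hz s (mem_range.1 hs))
    (fun s hs => h s (mem_range.1 hs) _)
    (by
      intro s hs
      rw [Gate.isometry_ket_of_isClassical P T (by trivial), one_smul]
      congr 1
      funext r'
      by_cases h1 : r' = a'
      · subst h1
        simp only [Gate.exec, addTo, Function.update_self, Function.update_of_ne haa,
          Function.update_of_ne hba, WordOp.eval, hzb s (mem_range.1 hs),
          Set.piecewise_eq_of_notMem _ _ _ haD']
        simp only [hzdef, Set.piecewise_eq_of_notMem _ _ _ haD',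
          Set.piecewise_eq_of_notMem _ _ _ haD, hy'def, Function.update_of_ne har,
          Function.update_of_ne haa', hya', BitVec.zero_xor]
        have : y a = bit (y a ≠ 0#w) := by
          rcases hya with h | h
          · simp [h, bit]
          · have : (1#w : BitVec w) ≠ 0#w := by
              intro h
              have := congrArg (fun v => BitVec.getLsbD v 0) h
              simp [hw] at this
            simp [h, bit, this]
        conv_lhs => rw [this]
        rw [bit_or]
      · simp only [Gate.exec, addTo, Function.update_of_ne h1]
        by_cases h2 : r' ∈ D
        · simp only [hzdef, Set.piecewise_eq_of_mem _ _ _ h2]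
        · simp only [hzdef, Set.piecewise_eq_of_notMem _ _ _ h2, Function.update_of_ne h1])
    (by simp) (by rw [sum_norm_ofReal_sq, sum_groverAmp_sq])
  simp only [mul_one] at h2
  rw [e, Circuit.isometry_append P T (hadamards q r ++ _),
    Circuit.isometry_append P T (hadamards q r), h0,
    ← sub_add_sub_cancel _ (Circuit.isometry P T (O r ++ [.op .or a b a'] ++ (O r).reverse)
      (superpose q r y fun s => (groverAmp q pred k s : ℂ))), ← map_sub]
  refine (norm_add_le _ _).trans ?_
  rw [LinearIsometry.norm_map]
  calc _ ≤ k * (2 * ε) + 2 * ε := add_le_add h1 h2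
    _ = _ := by ring

/-- Replaces each basis state `y` in a superposition by `φ y`. -/
def relabel (φ : Basis n M w → Basis n M w) : StateSpace n M w →ₗ[ℂ] StateSpace n M w where
  toFun ψ := ∑ y, ψ.ofLp y • ket (φ y)
  map_add' ψ χ := by simp [add_smul, Finset.sum_add_distrib]
  map_smul' c ψ := by simp [mul_smul, Finset.smul_sum]

theorem relabel_apply (φ : Basis n M w → Basis n M w) (ψ : StateSpace n M w) :
    relabel φ ψ = ∑ y, ψ.ofLp y • ket (φ y) := rfl

theorem relabel_ket (φ : Basis n M w → Basis n M w) (z : Basis n M w) :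
    relabel φ (ket z) = ket (φ z) := by
  rw [relabel_apply, Finset.sum_eq_single z]
  · simp [ket_apply]
  · intro y _ hy
    simp [ket_apply, hy]
  · simp

open Classical in
/-- The probability of an event in a superposition of distinct basis states. -/
theorem sum_norm_sq_superposition {κ : Type*} (I : Finset κ) (f : κ → ℂ) (k : κ → Basis n M w)
    (hk : ∀ i ∈ I, ∀ j ∈ I, k i = k j → i = j) (E : Basis n M w → Prop)
    [DecidablePred E] :
    ∑ z ∈ univ.filter E, ‖(∑ i ∈ I, f i • ket (k i)).ofLp z‖ ^ 2 =
      ∑ i ∈ I.filter fun i => E (k i), ‖f i‖ ^ 2 := by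
  have hval : ∀ i ∈ I, (∑ j ∈ I, f j • ket (k j)).ofLp (k i) = f i := by
    intro i hi
    rw [WithLp.ofLp_sum, Finset.sum_apply, Finset.sum_eq_single i]
    · simp [ket_apply]
    · intro j hj hji
      rw [PiLp.smul_apply, ket_apply, if_neg, smul_zero]
      exact fun h => hji (hk i hi j hj h).symm
    · exact fun h => (h hi).elim
  have hzero : ∀ z, z ∉ I.image k → (∑ j ∈ I, f j • ket (k j)).ofLp z = 0 := by
    intro z hz
    rw [WithLp.ofLp_sum, Finset.sum_apply]
    refine Finset.sum_eq_zero fun j hj => ?_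
    rw [PiLp.smul_apply, ket_apply, if_neg, smul_zero]
    rintro rfl
    exact hz (Finset.mem_image_of_mem k hj)
  have hsub : (I.filter fun i => E (k i)).image k ⊆ univ.filter E := by
    intro z hz
    obtain ⟨i, hi, rfl⟩ := Finset.mem_image.1 hz
    simpa using (Finset.mem_filter.1 hi).2
  rw [← Finset.sum_subset hsub, Finset.sum_image]
  · exact Finset.sum_congr rfl fun i hi => by rw [hval i (Finset.mem_filter.1 hi).1]
  · intro i hi j hj h
    exact hk i (Finset.mem_filter.1 hi).1 j (Finset.mem_filter.1 hj).1 h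
  · intro z hz hz'
    rw [hzero, norm_zero, sq, zero_mul]
    intro h
    obtain ⟨i, hi, rfl⟩ := Finset.mem_image.1 h
    exact hz' (Finset.mem_image_of_mem k
      (Finset.mem_filter.2 ⟨hi, (Finset.mem_filter.1 hz).2⟩))

/-- The basis states that occur before run `t` of a Grover search that starts from `x`. -/
def searchStates (l : Level) (x : Basis n M w) (t : Fin (M + 1)) : Set (Basis n M w) :=
  {y | (∀ r, (∀ u, r ≠ .cand l u) → (∀ u, r ≠ .acc l u) → y r = x r) ∧
    (∀ u : Fin M, t ≤ u.castSucc → y (.cand l u) = 0#w) ∧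
    (∀ u, t < u → y (.acc l u) = 0#w) ∧ (y (.acc l t) = 0#w ∨ y (.acc l t) = 1#w)}

theorem iterations_le (L q t : ℕ) : iterations L q t ≤ 2 ^ (q / 2) := by
  calc 2 ^ min (t % (L + 1)) (q / 2 + 1) / 2 ≤ 2 ^ (q / 2 + 1) / 2 :=
        Nat.div_le_div_right (Nat.pow_le_pow_right two_pos (min_le_right _ _))
    _ = 2 ^ (q / 2) := by rw [pow_succ]; omega

theorem groverRun_writesIn (L : ℕ) (l : Level) (q : ℕ) {b : Reg n M} {O : Reg n M → Circuit n M}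
    {D : Set (Reg n M)} (t : Fin M) (hO : Circuit.WritesIn D (O (.cand l t)))
    (h1 : .cand l t ∈ D) (h2 : .isZero l ∈ D) (h3 : .acc l t.succ ∈ D) :
    Circuit.WritesIn D (groverRun L l q b O t) := by
  have hH : Circuit.WritesIn D (hadamards q (.cand l t) : Circuit n M) :=
    (hadamards_writesIn q _).mono (Set.singleton_subset_iff.2 h1)
  have hstep : Circuit.WritesIn D (groverStep l q (.cand l t) b (O (.cand l t))) := by
    unfold groverStep
    simp only [Circuit.writesIn_append, Circuit.writesIn_reverse]
    refine ⟨⟨⟨⟨⟨hO, ?_⟩, hO⟩, hH⟩, ?_⟩, hH⟩ <;> intro g hg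
    · rw [List.mem_singleton.1 hg]
      trivial
    · simp only [List.mem_cons, List.not_mem_nil, or_false] at hg
      rcases hg with rfl | rfl | rfl
      · exact h2
      · trivial
      · exact h2
  unfold groverRun
  simp only [Circuit.writesIn_append, Circuit.writesIn_reverse]
  refine ⟨⟨⟨⟨hH, ?_⟩, hO⟩, ?_⟩, hO⟩ <;> intro g hg
  · obtain ⟨C, hC, hgC⟩ := List.mem_flatten.1 hg
    rw [(List.mem_replicate.1 hC).2] at hgC
    exact hstep g hgC
  · rw [List.mem_singleton.1 hg]
    exact h3

theorem groverSearch_writesIn (L : ℕ) (l : Level) (q : ℕ) {b out : Reg n M}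
    {O : Reg n M → Circuit n M} {D : Set (Reg n M)}
    (hO : ∀ t, Circuit.WritesIn D (O (.cand l t)))
    (h1 : ∀ t, .cand l t ∈ D) (h2 : .isZero l ∈ D) (h3 : ∀ t, .acc l t ∈ D) (h4 : out ∈ D) :
    Circuit.WritesIn D (groverSearch L l q b out O) := by
  have h : Circuit.WritesIn D ((List.finRange M).flatMap (groverRun L l q b O)) := by
    intro g hg
    obtain ⟨t, -, ht⟩ := List.mem_flatMap.1 hg
    exact groverRun_writesIn L l q t (hO t) (h1 t) h2 (h3 _) g ht
  unfold groverSearch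
  simp only [Circuit.writesIn_append, Circuit.writesIn_reverse]
  refine ⟨⟨h, ?_⟩, h⟩
  intro g hg
  rw [List.mem_singleton.1 hg]
  exact h4

/-- The basis state into which a run takes `y` if its candidate is `s`. -/
def afterRun (l : Level) (t : Fin M) (pred : ℕ → Prop) (y : Basis n M w) (s : ℕ) : Basis n M w :=
  Function.update (Function.update y (.cand l t) (BitVec.ofNat w s)) (.acc l t.succ)
    (bit (y (.acc l t.castSucc) ≠ 0#w ∨ pred s))

theorem afterRun_acc (l : Level) (t : Fin M) (pred : ℕ → Prop) (y : Basis n M w) (s : ℕ) :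
    afterRun l t pred y s (.acc l t.succ) = bit (y (.acc l t.castSucc) ≠ 0#w ∨ pred s) := by
  simp only [afterRun, Function.update_self]

theorem afterRun_cand (l : Level) (t : Fin M) (pred : ℕ → Prop) (y : Basis n M w) (s : ℕ) :
    afterRun l t pred y s (.cand l t) = BitVec.ofNat w s := by
  simp [afterRun]

theorem afterRun_of_ne (l : Level) (t : Fin M) (pred : ℕ → Prop) (y : Basis n M w) (s : ℕ)
    {r : Reg n M} (h1 : r ≠ .cand l t) (h2 : r ≠ .acc l t.succ) :
    afterRun l t pred y s r = y r := by
  simp [afterRun, h1, h2]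

theorem afterRun_mem {l : Level} {t : Fin M} {pred : ℕ → Prop} {x y : Basis n M w}
    (hy : y ∈ searchStates l x t.castSucc) (s : ℕ) :
    afterRun l t pred y s ∈ searchStates l x t.succ := by
  classical
  obtain ⟨h1, h2, h3, h4⟩ := hy
  refine ⟨fun r hr hr' => ?_, fun u hu => ?_, fun u hu => ?_, ?_⟩
  · rw [afterRun_of_ne _ _ _ _ _ (hr t) (hr' _), h1 r hr hr']
  · have hut : t < u := Fin.succ_le_castSucc_iff.1 hu
    rw [afterRun_of_ne _ _ _ _ _ (by simpa using hut.ne') (by simp),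
      h2 u (Fin.castSucc_le_castSucc_iff.2 hut.le)]
  · rw [afterRun_of_ne _ _ _ _ _ (by simp) (by simpa using hu.ne'),
      h3 u (lt_trans (Fin.castSucc_lt_succ (i := t)) hu)]
  · rw [afterRun_acc]
    unfold bit
    split_ifs <;> simp

theorem eq_of_mem_searchStates {l : Level} {t : Fin M} {x y y' : Basis n M w}
    (hy : y ∈ searchStates l x t.castSucc) (hy' : y' ∈ searchStates l x t.castSucc)
    (h : ∀ r, (∃ u, r = .cand l u) ∨ (∃ u, r = .acc l u) → r ≠ .cand l t → r ≠ .acc l t.succ →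
      y r = y' r) : y = y' := by
  funext r
  by_cases h1 : r = .cand l t
  · rw [h1, hy.2.1 t le_rfl, hy'.2.1 t le_rfl]
  by_cases h2 : r = .acc l t.succ
  · rw [h2, hy.2.2.1 _ Fin.castSucc_lt_succ, hy'.2.2.1 _ Fin.castSucc_lt_succ]
  by_cases h3 : (∃ u, r = .cand l u) ∨ (∃ u, r = .acc l u)
  · exact h r h3 h1 h2
  · rw [not_or, not_exists, not_exists] at h3
    rw [hy.1 r h3.1 h3.2, hy'.1 r h3.1 h3.2]

open Classical in
/-- The state after the first `t` runs of a Grover search whose oracle has error `ε`: up to an error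
that grows linearly with `t`, it is a superposition `Ψ` of basis states that occur in the search, in
which no solution has been found with probability at most the product of the failure probabilities
of the runs. The runs do not touch `out`, so `Ψ` serves for every content `v` of it: the runs are
applied before `out` is written, and undone after. -/
theorem exists_search_state (L : ℕ) (l : Level) {q : ℕ} (hq : q ≤ w) (hw : 0 < w)
    {b out : Reg n M} {O : Reg n M → Circuit n M} {D : Set (Reg n M)}
    (hO : ∀ t, Circuit.WritesIn D (O (.cand l t))) (hcD : ∀ t, .cand l t ∉ D)
    (haD : ∀ t, .acc l t ∉ D) (hbD : b ∈ D)
    (hout : ∀ t, out ≠ .cand l t) (hout' : ∀ t, out ≠ .acc l t) (hout1 : out ≠ .isZero l)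
    (hout2 : out ≠ .tmp .zero) {x : Basis n M w}
    (hxc : ∀ t, x (.cand l t) = 0#w) (hxa : ∀ t, x (.acc l t) = 0#w) (hxz : x (.isZero l) = 0#w)
    (hxz' : x (.tmp .zero) = 0#w) (G : ℕ → Reg n M → BitVec w) (pred : ℕ → Prop)
    (hG : ∀ s < 2 ^ q, G s b = bit (pred s)) {ε : ℝ} (hε : 0 ≤ ε)
    (h : ∀ t, ∀ s < 2 ^ q, ∀ z : Basis n M w, z (.cand l t) = BitVec.ofNat w s →
      (∀ r, (∀ u, r ≠ .cand l u) → (∀ u, r ≠ .acc l u) → r ≠ out → z r = x r) →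
      Reaches P T (O (.cand l t)) z (D.piecewise (G s) z) ε) (t : Fin (M + 1)) :
    ∃ Ψ : StateSpace n M w, Ψ ∈ supportedOn (searchStates l x t) ∧
      ∑ y, ‖Ψ.ofLp y‖ ^ 2 ≤ 1 ∧
      ((∀ s < 2 ^ q, ¬ pred s) → Ψ ∈ supportedOn {y | y (.acc l t) = 0#w}) ∧
      ∑ y ∈ univ.filter (fun y => y (.acc l t) = 0#w), ‖Ψ.ofLp y‖ ^ 2 ≤
        ∏ u ∈ range t, (1 - successProb q pred (iterations L q u)) ∧
      ∀ v : BitVec w, ‖Circuit.isometry P T (((List.finRange M).take t).flatMap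
          (groverRun L l q b O)) (ket (Function.update x out v)) -
        relabel (fun y => Function.update y out v) Ψ‖ ≤ t * (2 * (2 ^ (q / 2) + 1) * ε) := by
  have h10 : (1#w : BitVec w) ≠ 0#w := by
    intro h
    have := congrArg (fun v => BitVec.getLsbD v 0) h
    simp [hw] at this
  induction t using Fin.induction with
  | zero =>
    refine ⟨ket x, ket_mem_supportedOn ?_, ?_, fun _ => ket_mem_supportedOn (hxa 0), ?_, ?_⟩
    · exact ⟨fun _ _ _ => rfl, fun u _ => hxc u, fun u _ => hxa u, Or.inl (hxa 0)⟩
    · rw [← EuclideanSpace.norm_sq_eq, norm_ket, one_pow]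
    · rw [Fin.val_zero, Finset.range_zero, Finset.prod_empty]
      calc _ ≤ ∑ y, ‖(ket x).ofLp y‖ ^ 2 :=
            Finset.sum_le_sum_of_subset_of_nonneg (Finset.subset_univ _)
              fun _ _ _ => sq_nonneg _
        _ = 1 := by rw [← EuclideanSpace.norm_sq_eq, norm_ket, one_pow]
    · intro v
      simp [relabel_ket, Circuit.isometry_nil]
  | succ t ih =>
    obtain ⟨Ψ, hΨ, hΨ1, hΨ2, hΨ3, hΨ4⟩ := ih
    set k := iterations L q t with hk
    set β := groverAmp q pred k with hβ
    set Y : Finset (Basis n M w) := univ.filter fun y => y ∈ searchStates l x t.castSucc with hY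
    have hYmem : ∀ {y}, y ∈ Y ↔ y ∈ searchStates l x t.castSucc := by simp [hY]
    set I := Y ×ˢ range (2 ^ q) with hI
    set f : Basis n M w × ℕ → ℂ := fun i => Ψ.ofLp i.1 * β i.2 with hf
    set Ψ' : StateSpace n M w := ∑ i ∈ I, f i • ket (afterRun l t pred i.1 i.2) with hΨ'
    have hinj : ∀ i ∈ I, ∀ j ∈ I, afterRun l t pred i.1 i.2 = afterRun l t pred j.1 j.2 →
        i = j := by
      rintro ⟨y, s⟩ hi ⟨y', s'⟩ hj hij
      simp only [hI, Finset.mem_product, hYmem, mem_range] at hi hj hij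
      have h1 : s = s' := by
        have := congrFun hij (.cand l t)
        rw [afterRun_cand, afterRun_cand] at this
        exact ofNat_inj_of_lt hq hi.2 hj.2 this
      have h2 : y = y' := eq_of_mem_searchStates hi.1 hj.1 fun r _ hr hr' => by
        have := congrFun hij r
        rwa [afterRun_of_ne _ _ _ _ _ hr hr', afterRun_of_ne _ _ _ _ _ hr hr'] at this
      rw [h1, h2]
    have hmass := sum_norm_sq_superposition I f (fun i => afterRun l t pred i.1 i.2) hinj
    have hfsq : ∀ i, ‖f i‖ ^ 2 = ‖Ψ.ofLp i.1‖ ^ 2 * β i.2 ^ 2 := by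
      intro i
      rw [hf, norm_mul, mul_pow, Complex.norm_real, Real.norm_eq_abs, sq_abs]
    have hYsum : ∑ y ∈ Y, ‖Ψ.ofLp y‖ ^ 2 ≤ 1 :=
      (Finset.sum_le_sum_of_subset_of_nonneg (Finset.subset_univ _)
        fun _ _ _ => sq_nonneg _).trans hΨ1
    refine ⟨Ψ', ?_, ?_, ?_, ?_, ?_⟩
    · refine Submodule.sum_mem _ fun i hi => Submodule.smul_mem _ _ (ket_mem_supportedOn ?_)
      exact afterRun_mem (hYmem.1 (Finset.mem_product.1 hi).1) i.2
    · have := hmass fun _ => True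
      rw [Finset.filter_true, Finset.filter_true, ← hΨ'] at this
      rw [this, Finset.sum_congr rfl fun i _ => hfsq i, hI, Finset.sum_product]
      simp_rw [← Finset.mul_sum, hβ, sum_groverAmp_sq, mul_one]
      exact hYsum
    · intro hnone
      refine Submodule.sum_mem _ fun i hi => ?_
      by_cases h0 : i.1 (.acc l t.castSucc) = 0#w
      · refine Submodule.smul_mem _ _ (ket_mem_supportedOn ?_)
        rw [Set.mem_ofPred_eq, afterRun_acc, bit, if_neg]
        rw [not_or, not_not]
        exact ⟨h0, hnone _ (mem_range.1 (Finset.mem_product.1 hi).2)⟩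
      · have : f i = 0 := by
          simp only [hf]
          rw [hΨ2 hnone i.1 h0, zero_mul]
        rw [this, zero_smul]
        exact Submodule.zero_mem _
    · have := hmass fun y => y (.acc l t.succ) = 0#w
      rw [← hΨ'] at this
      rw [this, Fin.val_succ, Finset.prod_range_succ]
      have hset : I.filter (fun i => afterRun l t pred i.1 i.2 (.acc l t.succ) = 0#w) =
          (Y.filter fun y => y (.acc l t.castSucc) = 0#w) ×ˢ
            ((range (2 ^ q)).filter fun s => ¬ pred s) := by
        ext ⟨y, s⟩
        simp only [hI, Finset.mem_filter, Finset.mem_product, afterRun_acc, bit]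
        by_cases h1 : y (.acc l t.castSucc) = 0#w <;> by_cases h2 : pred s <;>
          simp [h1, h2, h10]
      rw [hset, Finset.sum_congr rfl fun i _ => hfsq i, Finset.sum_product]
      simp_rw [← Finset.mul_sum, hβ, sum_filter_not_groverAmp_sq]
      rw [← Finset.sum_mul]
      refine mul_le_mul_of_nonneg_right (le_trans ?_ hΨ3)
        (sub_nonneg.2 (successProb_le_one q pred k))
      exact Finset.sum_le_sum_of_subset_of_nonneg
        (Finset.filter_subset_filter _ (Finset.subset_univ _)) fun _ _ _ => sq_nonneg _
    · intro v
      have htake : (List.finRange M).take t.succ = (List.finRange M).take t.castSucc ++ [t] := by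
        rw [Fin.val_succ, Fin.val_castSucc, List.take_add_one]
        simp
      set φ : Basis n M w → Basis n M w := fun y => Function.update y out v with hφ
      rw [htake, List.flatMap_append, Circuit.isometry_append, List.flatMap_singleton]
      set R := Circuit.isometry (w := w) P T (groverRun L l q b O t) with hR
      have hcomm : ∀ y s, φ (afterRun l t pred y s) = afterRun l t pred (φ y) s := by
        intro y s
        simp only [hφ, afterRun]
        rw [Function.update_of_ne (a := Reg.acc l t.castSucc) (hout' t.castSucc).symm,
          Function.update_comm (hout' t.succ).symm, Function.update_comm (hout t).symm]
      -- the ideal effect of the run on `Ψ`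
      have hrel : relabel φ Ψ' = ∑ y ∈ Y, Ψ.ofLp y •
          ∑ s ∈ range (2 ^ q), (β s : ℂ) • ket (afterRun l t pred (φ y) s) := by
        rw [hΨ', map_sum, hI, Finset.sum_product]
        refine Finset.sum_congr rfl fun y _ => ?_
        rw [Finset.smul_sum]
        refine Finset.sum_congr rfl fun s _ => ?_
        rw [map_smul, relabel_ket, hcomm, smul_smul]
      have hrel' : relabel φ Ψ = ∑ y ∈ Y, Ψ.ofLp y • ket (φ y) := by
        rw [relabel_apply]
        refine (Finset.sum_subset (Finset.subset_univ _) fun y _ hy => ?_).symm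
        rw [hΨ y (fun h => hy (hYmem.2 h)), zero_smul]
      set D' : Set (Reg n M) := D ∪ {.cand l t, .isZero l, .acc l t.succ} with hD'
      have hRw : Circuit.WritesIn D' (groverRun L l q b O t) :=
        groverRun_writesIn L l q t ((hO t).mono Set.subset_union_left) (by simp [hD'])
          (by simp [hD']) (by simp [hD'])
      have hstep : ‖R (relabel φ Ψ) - relabel φ Ψ'‖ ≤ 2 * (2 ^ (q / 2) + 1) * ε := by
        rw [hrel, hrel', map_sum]
        simp_rw [map_smul]
        rw [← mul_one (2 * (2 ^ (q / 2) + 1) * ε)]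
        refine norm_sum_smul_sub_le Y _ _ _ (fun y => block D' (φ y)) ?_ ?_ ?_ (by positivity)
          zero_le_one ?_ (by simpa using hYsum)
        · intro y hy y' hy' hne
          refine Set.disjoint_left.2 fun z hz hz' => hne ?_
          refine eq_of_mem_searchStates (hYmem.1 hy) (hYmem.1 hy') fun r hr h1 h2 => ?_
          have hrD : r ∉ D' := by
            simp only [hD', Set.mem_union, Set.mem_insert_iff, Set.mem_singleton_iff, h1, h2]
            rcases hr with ⟨u, rfl⟩ | ⟨u, rfl⟩
            · simp [hcD u]
            · simp [haD u]
          have hro : r ≠ out := by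
            rcases hr with ⟨u, rfl⟩ | ⟨u, rfl⟩
            · exact (hout u).symm
            · exact (hout' u).symm
          have := (hz r hrD).symm.trans (hz' r hrD)
          simpa only [hφ, Function.update_of_ne hro] using this
        · exact fun y _ => Circuit.isometry_ket_mem P T hRw (φ y)
        · refine fun y _ => Submodule.sum_mem _ fun s _ => Submodule.smul_mem _ _
            (ket_mem_supportedOn fun r hr => afterRun_of_ne _ _ _ _ _ ?_ ?_)
          · rintro rfl
            exact hr (by simp [hD'])
          · rintro rfl
            exact hr (by simp [hD'])
        · intro y hy
          have hy := hYmem.1 hy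
          have hφr : ∀ {r}, out ≠ r → φ y r = y r := fun hr => Function.update_of_ne hr.symm _ _
          have hrun := norm_isometry_groverRun_sub_le (P := P) (T := T) (O := O) L l hq hw t (hO t)
            (hcD t) (haD _) (haD _) hbD (y := φ y) (by rw [hφr (hout t), hy.2.1 t le_rfl])
            (by rw [hφr hout1, hy.1 _ (by simp) (by simp), hxz])
            (by rw [hφr hout2, hy.1 _ (by simp) (by simp), hxz'])
            (by rw [hφr (hout' _)]; exact hy.2.2.2)
            (by rw [hφr (hout' _), hy.2.2.1 _ Fin.castSucc_lt_succ]) G pred hG (ε := ε) (by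
              intro s hs u
              refine h t s hs _ (by simp) fun r hr hr' hr'' => ?_
              rw [Function.update_of_ne (hr' _), Function.update_of_ne (hr _), hφr hr''.symm,
                hy.1 r hr hr'])
          refine hrun.trans ?_
          have : (iterations L q t : ℝ) ≤ 2 ^ (q / 2) := by exact_mod_cast iterations_le L q t
          gcongr
      rw [← sub_add_sub_cancel _ (R (relabel φ Ψ)), ← map_sub, Fin.val_succ]
      refine (norm_add_le _ _).trans ?_
      rw [LinearIsometry.norm_map]
      push_cast
      rw [add_mul, one_mul]
      exact add_le_add (hΨ4 v) hstep

open Classical in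
/-- A Grover search with `K` cycles of runs, whose oracle has error `ε`, adds to `out` whether there
is a solution. -/
theorem reaches_groverSearch {L K : ℕ} (hM : M = K * (L + 1)) (l : Level) {q : ℕ} (hq : q ≤ w)
    (hqL : q / 2 + 1 ≤ L) (hw : 0 < w)
    {b out : Reg n M} {O : Reg n M → Circuit n M} {D : Set (Reg n M)}
    (hO : ∀ t, Circuit.WritesIn D (O (.cand l t))) (hcD : ∀ t, .cand l t ∉ D)
    (haD : ∀ t, .acc l t ∉ D) (hbD : b ∈ D)
    (hout : ∀ t, out ≠ .cand l t) (hout' : ∀ t, out ≠ .acc l t) (hout1 : out ≠ .isZero l)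
    (hout2 : out ≠ .tmp .zero) {x : Basis n M w}
    (hxc : ∀ t, x (.cand l t) = 0#w) (hxa : ∀ t, x (.acc l t) = 0#w) (hxz : x (.isZero l) = 0#w)
    (hxz' : x (.tmp .zero) = 0#w) (G : ℕ → Reg n M → BitVec w) (pred : ℕ → Prop)
    (hG : ∀ s < 2 ^ q, G s b = bit (pred s)) {ε : ℝ} (hε : 0 ≤ ε)
    (h : ∀ t, ∀ s < 2 ^ q, ∀ z : Basis n M w, z (.cand l t) = BitVec.ofNat w s →
      (∀ r, (∀ u, r ≠ .cand l u) → (∀ u, r ≠ .acc l u) → r ≠ out → z r = x r) →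
      Reaches P T (O (.cand l t)) z (D.piecewise (G s) z) ε) :
    Reaches P T (groverSearch L l q b out O) x
      (Function.update x out (x out ^^^ bit (∃ s < 2 ^ q, pred s)))
      (2 * √((3 / 4) ^ K) + 4 * M * (2 ^ (q / 2) + 1) * ε) := by
  obtain ⟨Ψ, hΨ, hΨ1, hΨ2, hΨ3, hΨ4⟩ := exists_search_state (P := P) (T := T) L l hq hw hO hcD haD
    hbD hout hout' hout1 hout2 hxc hxa hxz hxz' G pred hG hε h (Fin.last M)
  set found : Prop := ∃ s < 2 ^ q, pred s with hfound
  set R := (List.finRange M).flatMap (groverRun L l q b O) with hR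
  have htake : (List.finRange M).take (Fin.last M : ℕ) = List.finRange M := by
    rw [Fin.val_last, List.take_of_length_le (by simp)]
  rw [htake, ← hR, Fin.val_last] at hΨ4
  set a : Reg n M := .acc l (Fin.last M) with ha
  set g : Gate n M := .op .or a (.tmp .zero) out with hg
  set v₁ := x out ^^^ bit found with hv₁
  set x₁ := Function.update x out v₁ with hx₁
  set φ₀ : Basis n M w → Basis n M w := fun y => Function.update y out (x out) with hφ₀
  set φ₁ : Basis n M w → Basis n M w := fun y => Function.update y out v₁ with hφ₁
  set Y : Finset (Basis n M w) := univ.filter fun y =>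
    y ∈ searchStates l x (Fin.last M) ∧ y a ≠ bit found with hY
  -- the final disjunction can be wrong only if a solution exists and no run has found one
  have hbad : ∑ y ∈ Y, ‖Ψ.ofLp y‖ ^ 2 ≤ √((3 / 4) ^ K) ^ 2 := by
    rw [Real.sq_sqrt (by positivity)]
    by_cases hf : found
    · rw [Fin.val_last] at hΨ3
      calc ∑ y ∈ Y, ‖Ψ.ofLp y‖ ^ 2 ≤
          ∑ y ∈ univ.filter (fun y : Basis n M w => y a = 0#w), ‖Ψ.ofLp y‖ ^ 2 := by
            refine Finset.sum_le_sum_of_subset_of_nonneg (fun y hy => ?_) fun _ _ _ => sq_nonneg _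
            obtain ⟨hy1, hy2⟩ := (Finset.mem_filter.1 hy).2
            rw [bit, if_pos hf] at hy2
            exact Finset.mem_filter.2 ⟨Finset.mem_univ _, hy1.2.2.2.resolve_right hy2⟩
        _ ≤ ∏ u ∈ range M, (1 - successProb q pred (iterations L q u)) := hΨ3
        _ ≤ (3 / 4) ^ K := by
            rw [hM]
            exact prod_one_sub_successProb_le q pred hf hqL K
    · have hnone : ∀ s < 2 ^ q, ¬ pred s := fun s hs hp => hf ⟨s, hs, hp⟩
      rw [Finset.sum_eq_zero]
      · positivity
      · intro y hy
        have := (Finset.mem_filter.1 hy).2.2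
        rw [bit, if_neg hf] at this
        rw [hΨ2 hnone y this, norm_zero, sq, zero_mul]
  -- Copying the final disjunction maps basis states to basis states, so `g` turns `Ψ` with the old
  -- content of `out` into `Ψ` with the correct new content, except on the branches in `Y`.
  have hcopy : ∀ y ∈ searchStates l x (Fin.last M),
      g.isometry P T (ket (φ₀ y)) = ket (Function.update y out (x out ^^^ y a)) := by
    intro y hy
    rw [Gate.isometry_ket_of_isClassical P T (by trivial)]
    congr 1
    funext r
    have hz : y (.tmp .zero) = 0#w := by rw [hy.1 _ (by simp) (by simp), hxz']
    by_cases hr : r = out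
    · subst hr
      simp only [hg, Gate.exec, addTo, Function.update_self, WordOp.eval, hφ₀, ha,
        Function.update_of_ne (hout' (Fin.last M)).symm, Function.update_of_ne hout2.symm, hz,
        BitVec.or_zero]
    · simp only [hg, Gate.exec, addTo, Function.update_of_ne hr, hφ₀]
  have hdiff : ‖g.isometry P T (relabel φ₀ Ψ) - relabel φ₁ Ψ‖ ≤ 2 * √((3 / 4) ^ K) := by
    have e : g.isometry P T (relabel φ₀ Ψ) - relabel φ₁ Ψ =
        ∑ y ∈ Y, Ψ.ofLp y • g.isometry P T (ket (φ₀ y)) - ∑ y ∈ Y, Ψ.ofLp y • ket (φ₁ y) := by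
      rw [relabel_apply, relabel_apply, map_sum, ← Finset.sum_sub_distrib,
        ← Finset.sum_sub_distrib]
      simp_rw [map_smul, ← smul_sub]
      refine (Finset.sum_subset (Finset.subset_univ _) fun y _ hy => ?_).symm
      by_cases hy1 : y ∈ searchStates l x (Fin.last M)
      · have hy2 : y a = bit found := by
          by_contra hne
          exact hy (Finset.mem_filter.2 ⟨Finset.mem_univ _, hy1, hne⟩)
        rw [hcopy y hy1, hy2, sub_self, smul_zero]
      · rw [hΨ y hy1, zero_smul]
    rw [e]
    have hmem : ∀ y v, ket (Function.update y out v) ∈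
        supportedOn (n := n) (M := M) (w := w) (block {out} y) := fun y v =>
      ket_mem_supportedOn ((update_mem_block_iff (Set.mem_singleton out) v y y).2 fun _ _ => rfl)
    refine norm_sum_smul_sub_le Y _ _ _ (fun y => block {out} y) ?_ ?_ (fun y _ => hmem y _)
      (by norm_num) (by positivity) ?_ hbad
    · intro y hy y' hy' hne
      refine Set.disjoint_left.2 fun z hz hz' => hne ?_
      funext r
      by_cases hr : r = out
      · rw [hr, (Finset.mem_filter.1 hy).2.1.1 out hout hout',
          (Finset.mem_filter.1 hy').2.1.1 out hout hout']
      · rw [← hz r hr, ← hz' r hr]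
    · intro y hy
      rw [hcopy y (Finset.mem_filter.1 hy).2.1]
      exact hmem y _
    · intro y _
      refine (norm_sub_le _ _).trans ?_
      rw [LinearIsometry.norm_map, norm_ket, norm_ket]
      norm_num
  have e : groverSearch L l q b out O = (R ++ [g]) ++ R.reverse := rfl
  -- The inverse of the runs takes `Ψ` with content `v₁` of `out` back to the clean state `x₁`.
  have h0 := hΨ4 (x out)
  have h1 := hΨ4 v₁
  rw [Function.update_eq_self] at h0
  unfold Reaches
  rw [e, Circuit.isometry_append, ← Circuit.isometry_reverse P T R (ket x₁), ← map_sub,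
    LinearIsometry.norm_map, Circuit.isometry_append, Circuit.isometry_singleton,
    ← sub_add_sub_cancel _ (g.isometry P T (relabel φ₀ Ψ)), ← map_sub]
  refine (norm_add_le _ _).trans ?_
  rw [LinearIsometry.norm_map, ← sub_add_sub_cancel (g.isometry P T (relabel φ₀ Ψ)) (relabel φ₁ Ψ)]
  have h2 := norm_add_le (g.isometry P T (relabel φ₀ Ψ) - relabel φ₁ Ψ)
    (relabel φ₁ Ψ - Circuit.isometry P T R (ket x₁))
  rw [norm_sub_rev (relabel φ₁ Ψ)] at h2
  calc _ ≤ M * (2 * (2 ^ (q / 2) + 1) * ε) +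
      (2 * √((3 / 4) ^ K) + M * (2 * (2 ^ (q / 2) + 1) * ε)) :=
        add_le_add h0 (h2.trans (add_le_add hdiff h1))
    _ = 2 * √((3 / 4) ^ K) + 4 * M * (2 ^ (q / 2) + 1) * ε := by ring

end Search

/-! ### The searches in a segment -/

section Segment

variable {σ n m M w : ℕ} {P : Fin m → Fin σ} {T : GDString σ n}

theorem bit_and (p p' : Prop) : (bit p : BitVec w) &&& bit p' = bit (p ∧ p') := by
  unfold bit
  by_cases h : p <;> by_cases h' : p' <;> simp [h, h']

theorem bit_andNot (p p' : Prop) : (bit p : BitVec w) &&& ~~~(bit p') = bit (p ∧ ¬ p') := by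
  unfold bit
  by_cases h : p <;> by_cases h' : p' <;> simp [h, h']

theorem eval_add (a b : BitVec w) : WordOp.eval .add a b = a + b := rfl

theorem eval_sub (a b : BitVec w) : WordOp.eval .sub a b = a - b := rfl

theorem eval_mod (a b : BitVec w) : WordOp.eval .mod a b = a % b := rfl

theorem eval_and (a b : BitVec w) : WordOp.eval .and a b = a &&& b := rfl

theorem eval_andNot (a b : BitVec w) : WordOp.eval .andNot a b = a &&& ~~~b := rfl

theorem eval_or (a b : BitVec w) : WordOp.eval .or a b = a ||| b := rfl

theorem eval_lt (a b : BitVec w) : WordOp.eval .lt a b = bit (a.toNat < b.toNat) := by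
  simp only [WordOp.eval, bit]
  congr

theorem eval_ne (a b : BitVec w) : WordOp.eval .ne a b = bit (a ≠ b) := by
  unfold WordOp.eval bit
  by_cases h : a = b <;> simp [h]

theorem eval_eq (a b : BitVec w) : WordOp.eval .eq a b = bit (a = b) := by
  simp only [WordOp.eval, bit]
  congr

/-- The registers that the oracle for a mismatch changes. -/
def charScratch : Set (Reg n M) :=
  {.tmp .addrP, .tmp .addrT, .tmp .charP, .tmp .charT, .tmp .differ, .tmp .inside, .tmp .mismatch}

/-- The registers that the oracle for an occurrence in a string changes. -/
def stringScratch : Set (Reg n M) :=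
  {r | r ∈ (charScratch : Set (Reg n M)) ∨ r = .tmp .inSegment ∨ r = .tmp .anyMismatch ∨
    r = .tmp .hit ∨ (∃ u, r = .cand .chars u) ∨ (∃ u, r = .acc .chars u) ∨ r = .isZero .chars}

/-- The word `c` is a position below `len` at which the pattern from `p` on differs from the string
`s` of segment `i` from `q` on. -/
def IsMismatch (P : Fin m → Fin σ) (T : GDString σ n) (i : Fin n) (p q len s c : BitVec w) : Prop :=
  patternCell P w (p + c).toNat ≠ textCell T w i s.toNat (q + c).toNat ∧ c.toNat < len.toNat

/-- The words that the oracle for a mismatch writes. -/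
def charValues (P : Fin m → Fin σ) (T : GDString σ n) (i : Fin n) (p q len s c : BitVec w) :
    Reg n M → BitVec w
  | .tmp .addrP => p + c
  | .tmp .addrT => q + c
  | .tmp .charP => patternCell P w (p + c).toNat
  | .tmp .charT => textCell T w i s.toNat (q + c).toNat
  | .tmp .differ =>
      bit (patternCell P w (p + c).toNat ≠ textCell T w i s.toNat (q + c).toNat)
  | .tmp .inside => bit (c.toNat < len.toNat)
  | .tmp .mismatch => bit (IsMismatch P T i p q len s c)
  | _ => 0#w

open Classical in
theorem reaches_mismatchOracle (i : Fin n) {p q len s c : Reg n M} (hp : p ∉ charScratch)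
    (hq : q ∉ charScratch) (hlen : len ∉ charScratch) (hs : s ∉ charScratch)
    (hc : c ∉ charScratch) {z : Basis n M w} (hz : ∀ r ∈ charScratch, z r = 0#w) :
    Reaches P T (mismatchOracle i p q len s c) z
      (charScratch.piecewise (charValues P T i (z p) (z q) (z len) (z s) (z c)) z) 0 := by
  have h := reaches_exec (P := P) (T := T) (C := mismatchOracle i p q len s c)
    (by simp [mismatchOracle, Gate.IsClassical]) z
  convert h using 1
  simp only [charScratch, Set.mem_insert_iff, Set.mem_singleton_iff, not_or, forall_eq_or_imp,
    forall_eq] at hp hq hlen hs hc hz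
  funext r
  by_cases hr : r ∈ charScratch
  · rw [Set.piecewise_eq_of_mem _ _ _ hr]
    simp only [charScratch, Set.mem_insert_iff, Set.mem_singleton_iff] at hr
    rcases hr with rfl | rfl | rfl | rfl | rfl | rfl | rfl <;>
    simp [mismatchOracle, Circuit.exec, Gate.exec, addTo, hp, hq, hlen, hs, hc, hz,
      charValues, eval_add, eval_ne, eval_lt, eval_and, IsMismatch, ← bit_and]
  · rw [Set.piecewise_eq_of_notMem _ _ _ hr]
    simp only [charScratch, Set.mem_insert_iff, Set.mem_singleton_iff, not_or] at hr
    simp [mismatchOracle, Circuit.exec, Gate.exec, addTo, Function.update_apply, hr]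

theorem mismatchOracle_writesIn (i : Fin n) (p q len s c : Reg n M) :
    Circuit.WritesIn charScratch (mismatchOracle i p q len s c) := by
  simp [Circuit.WritesIn, mismatchOracle, Gate.WritesIn, charScratch]

theorem reaches_op (f : WordOp) {a b d : Reg n M} (ha : a ≠ d) (hb : b ≠ d) (z : Basis n M w) :
    Reaches P T [.op f a b d] z (Function.update z d (z d ^^^ f.eval (z a) (z b))) 0 := by
  have h := reaches_exec (P := P) (T := T) (C := [Gate.op f a b d])
    (by simp [Gate.IsClassical]) z
  simpa [Circuit.exec, Gate.exec, addTo, ha, hb] using h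

theorem charScratch_subset : (charScratch : Set (Reg n M)) ⊆ stringScratch := fun _ h => Or.inl h

/-- A bound on the error of a Grover search with an exact oracle and `K` cycles of runs. -/
def searchError (K : ℕ) : ℝ := 2 * √((3 / 4) ^ K)

theorem searchError_nonneg (K : ℕ) : 0 ≤ searchError K := by
  unfold searchError
  positivity

/-- The string `s` of segment `i` agrees from `q` on with the pattern from `p` on, for `len`
characters; the positions range over `c < 2 ^ q₃`. -/
def IsHit (P : Fin m → Fin σ) (T : GDString σ n) (i : Fin n) (q₃ : ℕ) (p q len s : BitVec w) :
    Prop :=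
  ¬ ∃ c < 2 ^ q₃, IsMismatch P T i p q len s (BitVec.ofNat w c)

/-- The words that the oracle for an occurrence in a string writes. -/
def stringValues (P : Fin m → Fin σ) (T : GDString σ n) (i : Fin n) (q₃ : ℕ)
    (card p q len s : BitVec w) : Reg n M → BitVec w
  | .tmp .inSegment => bit (s.toNat < card.toNat)
  | .tmp .anyMismatch => bit (¬ IsHit P T i q₃ p q len s)
  | .tmp .hit => bit (s.toNat < card.toNat ∧ IsHit P T i q₃ p q len s)
  | _ => 0#w

theorem notMem_stringScratch {r : Reg n M} (hr : r ∉ stringScratch) :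
    r ∉ charScratch ∧ r ≠ .tmp .inSegment ∧ r ≠ .tmp .anyMismatch ∧ r ≠ .tmp .hit ∧
      (∀ u, r ≠ .cand .chars u) ∧ (∀ u, r ≠ .acc .chars u) ∧ r ≠ .isZero .chars := by
  simpa only [stringScratch, Set.mem_ofPred_eq, not_or, not_exists] using hr

open Classical in
theorem reaches_stringOracle {L K : ℕ} (hM : M = K * (L + 1)) (hw : 0 < w) (i : Fin n) {ki : ℕ}
    (hk : Nat.clog 2 ki ≤ w) (hkL : Nat.clog 2 ki / 2 + 1 ≤ L) {p q len s : Reg n M}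
    (hp : p ∉ stringScratch) (hq : q ∉ stringScratch) (hlen : len ∉ stringScratch)
    (hs : s ∉ stringScratch) {z : Basis n M w} (hz : ∀ r ∈ stringScratch, z r = 0#w)
    (hz' : z (.tmp .zero) = 0#w) :
    Reaches P T (stringOracle L i ki p q len s) z
      (stringScratch.piecewise (stringValues P T i (Nat.clog 2 ki) (z (.tmp .card)) (z p) (z q)
        (z len) (z s)) z) (searchError K) := by
  have hp' := notMem_stringScratch hp
  have hq' := notMem_stringScratch hq
  have hlen' := notMem_stringScratch hlen
  have hs' := notMem_stringScratch hs
  set z₁ := Function.update z (.tmp .inSegment) (bit ((z s).toNat < (z (.tmp .card)).toNat))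
    with hz₁
  have hz₁z : ∀ {r}, r ≠ .tmp .inSegment → z₁ r = z r := fun hr => Function.update_of_ne hr _ _
  have h1 : Reaches P T [.op .lt s (.tmp .card) (.tmp .inSegment)] z z₁ 0 := by
    have h := reaches_op (P := P) (T := T) .lt hs'.2.1
      (show Reg.tmp Scratch.card ≠ Reg.tmp Scratch.inSegment by simp) z
    rwa [eval_lt, hz _ (by simp [stringScratch]), BitVec.zero_xor] at h
  have hcs : ∀ r ∈ (charScratch : Set (Reg n M)), z₁ r = 0#w := fun r hr => by
    rw [hz₁z, hz r (charScratch_subset hr)]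
    rintro rfl
    simp [charScratch] at hr
  have hcand : ∀ u, (Reg.cand .chars u : Reg n M) ∉ charScratch := by simp [charScratch]
  have hacc : ∀ u, (Reg.acc .chars u : Reg n M) ∉ charScratch := by simp [charScratch]
  have h2 := reaches_groverSearch (P := P) (T := T) hM .chars hk hkL hw
    (b := .tmp .mismatch) (out := .tmp .anyMismatch) (O := mismatchOracle i p q len s)
    (D := charScratch) (fun t => mismatchOracle_writesIn i p q len s _) hcand hacc
    (by simp [charScratch]) (by simp) (by simp) (by simp) (by simp) (x := z₁)
    (fun u => by rw [hz₁z (by simp), hz _ (by simp [stringScratch])])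
    (fun u => by rw [hz₁z (by simp), hz _ (by simp [stringScratch])])
    (by rw [hz₁z (by simp), hz _ (by simp [stringScratch])])
    (by rw [hz₁z (by simp), hz'])
    (fun c => charValues P T i (z p) (z q) (z len) (z s) (BitVec.ofNat w c))
    (fun c => IsMismatch P T i (z p) (z q) (z len) (z s) (BitVec.ofNat w c))
    (fun c _ => by rw [charValues]) le_rfl (by
      intro t c _ y hyc hy
      have hy' : ∀ {r : Reg n M}, r ∉ stringScratch → y r = z r := fun hr => by
        have := notMem_stringScratch hr
        rw [hy _ this.2.2.2.2.1 this.2.2.2.2.2.1 this.2.2.1, hz₁z this.2.1]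
      have h := reaches_mismatchOracle (P := P) (T := T) i hp'.1 hq'.1 hlen'.1 hs'.1
        (hcand t) (z := y) (fun r hr => by
          rw [hy r, hcs r hr]
          · rintro u rfl
            exact hcand u hr
          · rintro u rfl
            exact hacc u hr
          · rintro rfl
            simp [charScratch] at hr)
      rwa [hyc, hy' hp, hy' hq, hy' hlen, hy' hs] at h)
  rw [hz₁z (by simp), hz _ (by simp [stringScratch]), BitVec.zero_xor, mul_zero, add_zero] at h2
  set z₂ := Function.update z₁ (.tmp .anyMismatch) (bit (∃ c < 2 ^ Nat.clog 2 ki,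
    IsMismatch P T i (z p) (z q) (z len) (z s) (BitVec.ofNat w c))) with hz₂
  have h3 := reaches_op (P := P) (T := T) .andNot
    (show Reg.tmp Scratch.inSegment ≠ Reg.tmp Scratch.hit by simp)
    (show Reg.tmp Scratch.anyMismatch ≠ Reg.tmp Scratch.hit by simp) z₂
  have h := (h1.append h2).append h3
  rw [zero_add, add_zero] at h
  unfold stringOracle searchError
  convert h using 1
  funext r
  by_cases hr : r ∈ stringScratch
  · rw [Set.piecewise_eq_of_mem _ _ _ hr]
    have hzr := hz r hr
    have hhit : z (.tmp .hit) = 0#w := hz _ (by simp [stringScratch])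
    by_cases e1 : r = .tmp .hit
    · subst e1
      simp [hz₂, hz₁, stringValues, hhit, eval_andNot, bit_andNot, IsHit]
    rw [Function.update_of_ne e1]
    by_cases e2 : r = .tmp .anyMismatch
    · subst e2
      simp [hz₂, stringValues, IsHit]
    rw [hz₂, Function.update_of_ne e2]
    by_cases e3 : r = .tmp .inSegment
    · subst e3
      simp [hz₁, stringValues]
    rw [hz₁, Function.update_of_ne e3, hzr]
    unfold stringValues
    split <;> first | rfl | contradiction
  · have hr' := notMem_stringScratch hr
    rw [Set.piecewise_eq_of_notMem _ _ _ hr, Function.update_of_ne hr'.2.2.2.1, hz₂,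
      Function.update_of_ne hr'.2.2.1, hz₁z hr'.2.1]

theorem stringOracle_writesIn (L : ℕ) (i : Fin n) (ki : ℕ) (p q len s : Reg n M) :
    Circuit.WritesIn stringScratch (stringOracle L i ki p q len s) := by
  unfold stringOracle
  simp only [Circuit.writesIn_append]
  refine ⟨⟨?_, ?_⟩, ?_⟩
  · simp [Circuit.WritesIn, Gate.WritesIn, stringScratch]
  · exact groverSearch_writesIn _ _ _
      (fun t => (mismatchOracle_writesIn i p q len s _).mono charScratch_subset)
      (by simp [stringScratch]) (by simp [stringScratch]) (by simp [stringScratch])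
      (by simp [stringScratch])
  · simp [Circuit.WritesIn, Gate.WritesIn, stringScratch]

/-- The registers that a search in a segment leaves clean. -/
def searchScratch : Set (Reg n M) :=
  {r | r ∈ (stringScratch : Set (Reg n M)) ∨ (∃ u, r = .cand .strings u) ∨
    (∃ u, r = .acc .strings u) ∨ r = .isZero .strings}

theorem notMem_searchScratch {r : Reg n M} (hr : r ∉ searchScratch) :
    r ∉ stringScratch ∧ (∀ u, r ≠ .cand .strings u) ∧ (∀ u, r ≠ .acc .strings u) ∧
      r ≠ .isZero .strings := by
  simpa only [searchScratch, Set.mem_ofPred_eq, not_or, not_exists] using hr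

/-- A bound on the error of the search in a segment with `2 ^ q₂` indices of strings. -/
def segmentError (K M q₂ : ℕ) : ℝ :=
  searchError K + 4 * M * (2 ^ (q₂ / 2) + 1) * searchError K

theorem reaches_segmentSearch {L K : ℕ} (hM : M = K * (L + 1)) (hw : 0 < w) (i : Fin n)
    {ki ci : ℕ} (hk : Nat.clog 2 ki ≤ w) (hkL : Nat.clog 2 ki / 2 + 1 ≤ L)
    (hc : Nat.clog 2 ci ≤ w) (hcL : Nat.clog 2 ci / 2 + 1 ≤ L) {p q len out : Reg n M}
    (hp : p ∉ searchScratch) (hq : q ∉ searchScratch) (hlen : len ∉ searchScratch)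
    (hout : out ∉ searchScratch) (hop : p ≠ out) (hoq : q ≠ out) (hol : len ≠ out)
    (hoc : .tmp .card ≠ out) (hoz : .tmp .zero ≠ out) {x : Basis n M w}
    (hx : ∀ r ∈ searchScratch, x r = 0#w) (hx' : x (.tmp .zero) = 0#w) :
    Reaches P T (segmentSearch L i ki ci p q len out) x
      (Function.update x out (x out ^^^ bit (∃ s < 2 ^ Nat.clog 2 ci,
        (BitVec.ofNat w s).toNat < (x (.tmp .card)).toNat ∧
          IsHit P T i (Nat.clog 2 ki) (x p) (x q) (x len) (BitVec.ofNat w s))))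
      (segmentError K M (Nat.clog 2 ci)) := by
  have hp' := notMem_searchScratch hp
  have hq' := notMem_searchScratch hq
  have hlen' := notMem_searchScratch hlen
  have hout' := notMem_searchScratch hout
  have hcand : ∀ u, (Reg.cand .strings u : Reg n M) ∉ stringScratch := by
    simp [stringScratch, charScratch]
  have hacc : ∀ u, (Reg.acc .strings u : Reg n M) ∉ stringScratch := by
    simp [stringScratch, charScratch]
  refine reaches_groverSearch (P := P) (T := T) hM .strings hc hcL hw
    (b := .tmp .hit) (O := stringOracle L i ki p q len)
    (D := stringScratch) (fun t => stringOracle_writesIn L i ki p q len _) hcand hacc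
    (by simp [stringScratch]) hout'.2.1 hout'.2.2.1 hout'.2.2.2 hoz.symm
    (fun u => hx _ (by simp [searchScratch])) (fun u => hx _ (by simp [searchScratch]))
    (hx _ (by simp [searchScratch])) hx'
    (fun s => stringValues P T i (Nat.clog 2 ki) (x (.tmp .card)) (x p) (x q) (x len)
      (BitVec.ofNat w s)) _ (fun s _ => by rw [stringValues]) (searchError_nonneg K) ?_
  intro t s _ z hzs hz
  have h := reaches_stringOracle (P := P) (T := T) hM hw i hk hkL hp'.1 hq'.1 hlen'.1
    (hcand t) (z := z) (fun r hr => by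
      rw [hz r, hx r (Or.inl hr)]
      · rintro u rfl
        exact hcand u hr
      · rintro u rfl
        exact hacc u hr
      · rintro rfl
        exact hout'.1 hr) (by rw [hz _ (by simp) (by simp) hoz, hx'])
  rwa [hzs, hz _ (by simp) (by simp) hoc, hz p hp'.2.1 hp'.2.2.1 hop,
    hz q hq'.2.1 hq'.2.2.1 hoq, hz len hlen'.2.1 hlen'.2.2.1 hol] at h

theorem segmentSearch_writesIn (L : ℕ) (i : Fin n) (ki ci : ℕ) (p q len out : Reg n M) :
    Circuit.WritesIn (searchScratch ∪ {out}) (segmentSearch L i ki ci p q len out) := by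
  refine groverSearch_writesIn _ _ _ (fun t => (stringOracle_writesIn L i ki p q len _).mono
    fun r hr => Or.inl (Or.inl hr)) ?_ ?_ ?_ ?_ <;> simp [searchScratch]

end Segment

/-! ### The classical control flow of the for-loop -/

section ForLoop

variable {σ n m M w : ℕ} {P : Fin m → Fin σ} {T : GDString σ n}

/-- The operation neither reads nor writes register `r`. -/
def Gate.Avoids (r : Reg n M) : Gate n M → Prop
  | .had r' _ => r ≠ r'
  | .pauliZ r' _ => r ≠ r'
  | .load _ d => r ≠ d
  | .op _ a b d => r ≠ a ∧ r ≠ b ∧ r ≠ d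
  | .readP a d => r ≠ a ∧ r ≠ d
  | .readT _ s c d => r ≠ s ∧ r ≠ c ∧ r ≠ d

theorem Gate.exec_update {r : Reg n M} {g : Gate n M} (hg : g.Avoids r) (z : Basis n M w)
    (v : BitVec w) : g.exec P T (Function.update z r v) = Function.update (g.exec P T z) r v := by
  cases g <;> simp only [Gate.Avoids] at hg <;> simp only [Gate.exec, id] <;> funext r' <;>
    by_cases h : r' = r <;> simp_all [addTo, Function.update_apply, eq_comm]

theorem Circuit.exec_update {r : Reg n M} {C : Circuit n M} (hC : ∀ g ∈ C, g.Avoids r)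
    (z : Basis n M w) (v : BitVec w) :
    Circuit.exec P T C (Function.update z r v) = Function.update (Circuit.exec P T C z) r v := by
  induction C generalizing z with
  | nil => rfl
  | cons g C ih =>
    have := Gate.exec_update (P := P) (T := T) (hC g List.mem_cons_self) z v
    simp only [Circuit.exec, List.foldl_cons] at ih ⊢
    rw [this, ih fun g' hg' => hC g' (List.mem_cons_of_mem _ hg')]

theorem reaches_of_exec_eq {C : Circuit n M} (hC : ∀ g ∈ C, g.IsClassical) {z z' : Basis n M w}
    (h : Circuit.exec P T C z = z') : Reaches P T C z z' 0 := h ▸ reaches_exec hC z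

/-- The outcome of the search in segment `i` for `P[p .. p + len - 1]` from position `q` on. -/
def Occurs (P : Fin m → Fin σ) (T : GDString σ n) (i : Fin n) (p q len : BitVec w) : Prop :=
  ∃ s < 2 ^ Nat.clog 2 (T.card i),
    (BitVec.ofNat w s).toNat < (BitVec.ofNat w (T.card i)).toNat ∧
      IsHit P T i (Nat.clog 2 (T.width i)) p q len (BitVec.ofNat w s)

/-- The first part of an iteration, which computes the arguments of the three searches. -/
def prepCircuit (m : ℕ) (c : Fin n → ℕ) (i : Fin n) : Circuit n M :=
  [.load m (.tmp .patLen),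
   .load (c i) (.tmp .card),
   .op .add (.pos i.castSucc) (.width i) (.tmp .sum),
   .op .lt (.tmp .sum) (.tmp .patLen) (.tmp .isLess),
   .op .sub (.tmp .patLen) (.pos i.castSucc) (.tmp .rem),
   .op .sub (.tmp .sum) (.tmp .patLen) (.tmp .over)]

/-- The part of an iteration that combines the outcomes of the three searches. -/
def updateCircuit (i : Fin n) : Circuit n M :=
  [.op .and (.act i.castSucc) (.ext i) (.tmp .extended),
   .op .and (.tmp .isLess) (.tmp .extended) (.tmp .stays),
   .op .andNot (.pre i) (.tmp .isLess) (.tmp .starts),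
   .op .and (.suf i) (.act i.castSucc) (.tmp .ended),
   .op .andNot (.tmp .ended) (.tmp .isLess) (.tmp .full)]

theorem loopBody_eq (L m : ℕ) (k c : Fin n → ℕ) (i : Fin n) :
    (loopBody L m k c i : Circuit n M) = [.load (k i) (.width i)] ++ (prepCircuit m c i ++
      (segmentSearch L i (k i) (c i) (.pos i.castSucc) (.tmp .zero) (.width i) (.ext i) ++
      (segmentSearch L i (k i) (c i) (.pos i.castSucc) (.tmp .zero) (.tmp .rem) (.suf i) ++
      (segmentSearch L i (k i) (c i) (.tmp .zero) (.tmp .rem) (.tmp .over) (.pre i) ++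
      (updateCircuit i ++ ([.op .or (.tmp .stays) (.tmp .starts) (.act i.succ),
        .op .or (.mat i.castSucc) (.tmp .full) (.mat i.succ),
        .op .mod (.tmp .sum) (.tmp .patLen) (.pos i.succ)] ++
      ((updateCircuit i).reverse ++ (prepCircuit m c i).reverse))))))) := by
  simp only [loopBody, prepCircuit, updateCircuit, List.append_assoc]

/-- The effect of an iteration in which the position is `j`, the three tests have the outcomes
`e`, `s` and `p`, and the active and match bits are `A` and `F` before the iteration. -/
def afterBody (m k : ℕ) (i : Fin n) (j : BitVec w) (e s p A F : Prop) (z : Basis n M w) :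
    Basis n M w :=
  let less : Prop := (j + BitVec.ofNat w k).toNat < (BitVec.ofNat w m).toNat
  Function.update (Function.update (Function.update (Function.update (Function.update
    (Function.update (Function.update z (.width i) (BitVec.ofNat w k)) (.ext i) (bit e))
    (.suf i) (bit s)) (.pre i) (bit p))
    (.act i.succ) (bit ((less ∧ A ∧ e) ∨ (p ∧ ¬ less))))
    (.mat i.succ) (bit (F ∨ ((s ∧ A) ∧ ¬ less))))
    (.pos i.succ) ((j + BitVec.ofNat w k) % BitVec.ofNat w m)

theorem Circuit.exec_prepCircuit (c : Fin n → ℕ) (i : Fin n) {z : Basis n M w}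
    (htmp : ∀ t, z (.tmp t) = 0#w) (r : Reg n M) :
    Circuit.exec P T (prepCircuit m c i) z r =
      match r with
      | .tmp .patLen => BitVec.ofNat w m
      | .tmp .card => BitVec.ofNat w (c i)
      | .tmp .sum => z (.pos i.castSucc) + z (.width i)
      | .tmp .isLess => bit ((z (.pos i.castSucc) + z (.width i)).toNat < (BitVec.ofNat w m).toNat)
      | .tmp .rem => BitVec.ofNat w m - z (.pos i.castSucc)
      | .tmp .over => z (.pos i.castSucc) + z (.width i) - BitVec.ofNat w m
      | r => z r := by
  have h : Circuit.exec P T (prepCircuit m c i) z = Function.update (Function.update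
      (Function.update (Function.update (Function.update (Function.update z
      (.tmp .patLen) (BitVec.ofNat w m)) (.tmp .card) (BitVec.ofNat w (c i)))
      (.tmp .sum) (z (.pos i.castSucc) + z (.width i)))
      (.tmp .isLess)
        (bit ((z (.pos i.castSucc) + z (.width i)).toNat < (BitVec.ofNat w m).toNat)))
      (.tmp .rem) (BitVec.ofNat w m - z (.pos i.castSucc)))
      (.tmp .over) (z (.pos i.castSucc) + z (.width i) - BitVec.ofNat w m) := by
    simp [prepCircuit, Circuit.exec, Gate.exec, addTo, htmp, eval_add, eval_sub, eval_lt]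
  rw [h]
  split <;> simp_all

theorem Circuit.exec_updateCircuit (i : Fin n) {z : Basis n M w} {e s p A less : Prop}
    (he : z (.ext i) = bit e) (hs : z (.suf i) = bit s) (hp : z (.pre i) = bit p)
    (hA : z (.act i.castSucc) = bit A) (hless : z (.tmp .isLess) = bit less)
    (h1 : z (.tmp .extended) = 0#w) (h2 : z (.tmp .stays) = 0#w) (h3 : z (.tmp .starts) = 0#w)
    (h4 : z (.tmp .ended) = 0#w) (h5 : z (.tmp .full) = 0#w) :
    Circuit.exec P T (updateCircuit i) z = Function.update (Function.update
      (Function.update (Function.update (Function.update z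
      (.tmp .extended) (bit (A ∧ e))) (.tmp .stays) (bit (less ∧ A ∧ e)))
      (.tmp .starts) (bit (p ∧ ¬ less))) (.tmp .ended) (bit (s ∧ A)))
      (.tmp .full) (bit ((s ∧ A) ∧ ¬ less)) := by
  simp [updateCircuit, Circuit.exec, Gate.exec, addTo, he, hs, hp, hA, hless, h1, h2, h3, h4, h5,
    eval_and, eval_andNot, bit_and, bit_andNot]

/-- An iteration consists of three searches, each with error at most `segmentError`, between exact
classical parts; the temporary registers are computed, used and uncomputed. -/
theorem reaches_loopBody {L K : ℕ} (hM : M = K * (L + 1)) (hw : 0 < w) (i : Fin n)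
    (hk : Nat.clog 2 (T.width i) ≤ w) (hkL : Nat.clog 2 (T.width i) / 2 + 1 ≤ L)
    (hc : Nat.clog 2 (T.card i) ≤ w) (hcL : Nat.clog 2 (T.card i) / 2 + 1 ≤ L)
    {z : Basis n M w} {A F : Prop} (htmp : ∀ t, z (.tmp t) = 0#w)
    (hz : ∀ r ∈ searchScratch, z r = 0#w) (hwidth : z (.width i) = 0#w)
    (hext : z (.ext i) = 0#w) (hsuf : z (.suf i) = 0#w) (hpre : z (.pre i) = 0#w)
    (hact' : z (.act i.succ) = 0#w) (hmat' : z (.mat i.succ) = 0#w) (hpos' : z (.pos i.succ) = 0#w)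
    (hact : z (.act i.castSucc) = bit A) (hmat : z (.mat i.castSucc) = bit F) :
    Reaches P T (loopBody L m T.width T.card i) z
      (afterBody m (T.width i) i (z (.pos i.castSucc))
        (Occurs P T i (z (.pos i.castSucc)) 0#w (BitVec.ofNat w (T.width i)))
        (Occurs P T i (z (.pos i.castSucc)) 0#w (BitVec.ofNat w m - z (.pos i.castSucc)))
        (Occurs P T i 0#w (BitVec.ofNat w m - z (.pos i.castSucc))
          (z (.pos i.castSucc) + BitVec.ofNat w (T.width i) - BitVec.ofNat w m)) A F z)
      (3 * segmentError K M (Nat.clog 2 (T.card i))) := by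
  set j := z (.pos i.castSucc) with hj
  set k : BitVec w := BitVec.ofNat w (T.width i) with hkdef
  set mm : BitVec w := BitVec.ofNat w m with hmm
  set e := Occurs P T i j 0#w k with he
  set s := Occurs P T i j 0#w (mm - j) with hs
  set p := Occurs P T i 0#w (mm - j) (j + k - mm) with hp
  set less : Prop := (j + k).toNat < mm.toNat with hless
  have hne : i.succ ≠ i.castSucc := Fin.castSucc_lt_succ.ne'
  -- the states between the parts of the loop body
  set z₀ := Function.update z (.width i) k with hz₀
  set zp := Circuit.exec P T (prepCircuit m T.card i) z₀ with hzp
  have hz₀tmp : ∀ t, z₀ (.tmp t) = 0#w := fun t => by simp [hz₀, htmp]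
  have hzp' := Circuit.exec_prepCircuit (P := P) (T := T) T.card i hz₀tmp
  rw [← hzp] at hzp'
  have hz₀p : z₀ (.pos i.castSucc) = j := by simp [hz₀, hj]
  have hz₀w : z₀ (.width i) = k := by simp [hz₀]
  rw [hz₀p, hz₀w] at hzp'
  have hscr : ∀ r ∈ searchScratch, zp r = 0#w := by
    intro r hr
    rw [hzp']
    have h1 : ∀ r, r ∈ searchScratch → z₀ r = 0#w := fun r hr => by
      rw [hz₀, Function.update_of_ne, hz r hr]
      rintro rfl
      simp [searchScratch, stringScratch, charScratch] at hr
    split <;> first | exact h1 _ hr | simp [searchScratch, stringScratch, charScratch] at hr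
  set z₁ := Function.update zp (.ext i) (bit e) with hz₁
  set z₂ := Function.update z₁ (.suf i) (bit s) with hz₂
  set z₃ := Function.update z₂ (.pre i) (bit p) with hz₃
  have hnot : ∀ r ∈ (searchScratch : Set (Reg n M)), r ≠ .ext i ∧ r ≠ .suf i ∧ r ≠ .pre i := by
    intro r hr
    refine ⟨?_, ?_, ?_⟩ <;> rintro rfl <;>
      simp [searchScratch, stringScratch, charScratch] at hr
  have r0 : Reaches P T [.load (T.width i) (.width i)] z z₀ 0 :=
    reaches_of_exec_eq (by simp [Gate.IsClassical]) (by
      simp [Circuit.exec, Gate.exec, addTo, hwidth, hz₀, hkdef])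
  have hprepc : ∀ g ∈ (prepCircuit m T.card i : Circuit n M), g.IsClassical := by
    simp [prepCircuit, Gate.IsClassical]
  have hupdc : ∀ g ∈ (updateCircuit i : Circuit n M), g.IsClassical := by
    simp [updateCircuit, Gate.IsClassical]
  have r1 : Reaches P T (prepCircuit m T.card i) z₀ zp 0 := reaches_exec hprepc z₀
  have r2 := reaches_segmentSearch (P := P) (T := T) hM hw i hk hkL hc hcL
    (p := .pos i.castSucc) (q := .tmp .zero) (len := .width i) (out := .ext i)
    (by simp [searchScratch, stringScratch, charScratch])
    (by simp [searchScratch, stringScratch, charScratch])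
    (by simp [searchScratch, stringScratch, charScratch])
    (by simp [searchScratch, stringScratch, charScratch])
    (by simp) (by simp) (by simp) (by simp) (by simp) (x := zp) hscr
    (by rw [hzp']; exact hz₀tmp _)
  have r2' : Function.update zp (Reg.ext i) (zp (.ext i) ^^^ bit (∃ s < 2 ^ Nat.clog 2 (T.card i),
        (BitVec.ofNat w s).toNat < (zp (.tmp .card)).toNat ∧
          IsHit P T i (Nat.clog 2 (T.width i)) (zp (.pos i.castSucc)) (zp (.tmp .zero))
            (zp (.width i)) (BitVec.ofNat w s))) = z₁ := by
    have e1 : zp (.ext i) = 0#w := by rw [hzp']; simp [hz₀, hext]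
    have e2 : zp (.tmp .card) = BitVec.ofNat w (T.card i) := by rw [hzp']
    have e3 : zp (.pos i.castSucc) = j := by rw [hzp']; exact hz₀p
    have e4 : zp (.tmp .zero) = 0#w := by rw [hzp']; exact hz₀tmp _
    have e5 : zp (.width i) = k := by rw [hzp']; exact hz₀w
    rw [e1, e2, e3, e4, e5, BitVec.zero_xor, hz₁, he, Occurs]
  rw [r2'] at r2
  have r3 := reaches_segmentSearch (P := P) (T := T) hM hw i hk hkL hc hcL
    (p := .pos i.castSucc) (q := .tmp .zero) (len := .tmp .rem) (out := .suf i)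
    (by simp [searchScratch, stringScratch, charScratch])
    (by simp [searchScratch, stringScratch, charScratch])
    (by simp [searchScratch, stringScratch, charScratch])
    (by simp [searchScratch, stringScratch, charScratch])
    (by simp) (by simp) (by simp) (by simp) (by simp) (x := z₁)
    (fun r hr => by rw [hz₁, Function.update_of_ne (hnot r hr).1, hscr r hr])
    (by rw [hz₁, Function.update_of_ne (by simp), hzp']; exact hz₀tmp _)
  have r3' : Function.update z₁ (Reg.suf i) (z₁ (.suf i) ^^^ bit (∃ s < 2 ^ Nat.clog 2 (T.card i),
        (BitVec.ofNat w s).toNat < (z₁ (.tmp .card)).toNat ∧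
          IsHit P T i (Nat.clog 2 (T.width i)) (z₁ (.pos i.castSucc)) (z₁ (.tmp .zero))
            (z₁ (.tmp .rem)) (BitVec.ofNat w s))) = z₂ := by
    have e0 : ∀ {r}, r ≠ .ext i → z₁ r = zp r := fun h => Function.update_of_ne h _ _
    have e1 : z₁ (.suf i) = 0#w := by rw [e0 (by simp), hzp']; simp [hz₀, hsuf]
    have e2 : z₁ (.tmp .card) = BitVec.ofNat w (T.card i) := by rw [e0 (by simp), hzp']
    have e3 : z₁ (.pos i.castSucc) = j := by rw [e0 (by simp), hzp']; exact hz₀p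
    have e4 : z₁ (.tmp .zero) = 0#w := by rw [e0 (by simp), hzp']; exact hz₀tmp _
    have e5 : z₁ (.tmp .rem) = mm - j := by rw [e0 (by simp), hzp']
    rw [e1, e2, e3, e4, e5, BitVec.zero_xor, hz₂, hs, Occurs]
  rw [r3'] at r3
  have r4 := reaches_segmentSearch (P := P) (T := T) hM hw i hk hkL hc hcL
    (p := .tmp .zero) (q := .tmp .rem) (len := .tmp .over) (out := .pre i)
    (by simp [searchScratch, stringScratch, charScratch])
    (by simp [searchScratch, stringScratch, charScratch])
    (by simp [searchScratch, stringScratch, charScratch])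
    (by simp [searchScratch, stringScratch, charScratch])
    (by simp) (by simp) (by simp) (by simp) (by simp) (x := z₂)
    (fun r hr => by rw [hz₂, Function.update_of_ne (hnot r hr).2.1, hz₁,
      Function.update_of_ne (hnot r hr).1, hscr r hr])
    (by rw [hz₂, Function.update_of_ne (by simp), hz₁, Function.update_of_ne (by simp), hzp']
        exact hz₀tmp _)
  have r4' : Function.update z₂ (Reg.pre i) (z₂ (.pre i) ^^^ bit (∃ s < 2 ^ Nat.clog 2 (T.card i),
        (BitVec.ofNat w s).toNat < (z₂ (.tmp .card)).toNat ∧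
          IsHit P T i (Nat.clog 2 (T.width i)) (z₂ (.tmp .zero)) (z₂ (.tmp .rem))
            (z₂ (.tmp .over)) (BitVec.ofNat w s))) = z₃ := by
    have e0 : ∀ {r}, r ≠ .suf i → r ≠ .ext i → z₂ r = zp r := fun h h' => by
      rw [hz₂, Function.update_of_ne h, hz₁, Function.update_of_ne h']
    have e1 : z₂ (.pre i) = 0#w := by rw [e0 (by simp) (by simp), hzp']; simp [hz₀, hpre]
    have e2 : z₂ (.tmp .card) = BitVec.ofNat w (T.card i) := by
      rw [e0 (by simp) (by simp), hzp']
    have e3 : z₂ (.tmp .rem) = mm - j := by rw [e0 (by simp) (by simp), hzp']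
    have e4 : z₂ (.tmp .zero) = 0#w := by rw [e0 (by simp) (by simp), hzp']; exact hz₀tmp _
    have e5 : z₂ (.tmp .over) = j + k - mm := by rw [e0 (by simp) (by simp), hzp']
    rw [e1, e2, e3, e4, e5, BitVec.zero_xor, hz₃, hp, Occurs]
  rw [r4'] at r4
  have hz₃r : ∀ {r}, r ≠ .pre i → r ≠ .suf i → r ≠ .ext i → z₃ r = zp r := fun h h' h'' => by
    rw [hz₃, Function.update_of_ne h, hz₂, Function.update_of_ne h', hz₁,
      Function.update_of_ne h'']
  set zu := Circuit.exec P T (updateCircuit i) z₃ with hzu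
  have hzu' : zu = _ := Circuit.exec_updateCircuit (P := P) (T := T) i (z := z₃) (e := e) (s := s)
    (p := p) (A := A) (less := less) (by simp [hz₃, hz₂, hz₁]) (by simp [hz₃, hz₂])
    (by simp [hz₃])
    (by rw [hz₃r (by simp) (by simp) (by simp), hzp']; simp [hz₀, hact])
    (by rw [hz₃r (by simp) (by simp) (by simp), hzp'])
    (by rw [hz₃r (by simp) (by simp) (by simp), hzp']; exact hz₀tmp _)
    (by rw [hz₃r (by simp) (by simp) (by simp), hzp']; exact hz₀tmp _)
    (by rw [hz₃r (by simp) (by simp) (by simp), hzp']; exact hz₀tmp _)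
    (by rw [hz₃r (by simp) (by simp) (by simp), hzp']; exact hz₀tmp _)
    (by rw [hz₃r (by simp) (by simp) (by simp), hzp']; exact hz₀tmp _)
  have r5 : Reaches P T (updateCircuit i) z₃ zu 0 := reaches_exec hupdc z₃
  -- writing the results
  set res : Basis n M w → Basis n M w := fun y => Function.update (Function.update
    (Function.update y (.act i.succ) (bit ((less ∧ A ∧ e) ∨ (p ∧ ¬ less))))
    (.mat i.succ) (bit (F ∨ ((s ∧ A) ∧ ¬ less)))) (.pos i.succ) ((j + k) % mm) with hres
  have r6 : Reaches P T [.op .or (.tmp .stays) (.tmp .starts) (.act i.succ),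
      .op .or (.mat i.castSucc) (.tmp .full) (.mat i.succ),
      .op .mod (.tmp .sum) (.tmp .patLen) (.pos i.succ)] zu (res zu) 0 := by
    refine reaches_of_exec_eq (by simp [Gate.IsClassical]) ?_
    have e1 : z₃ (.act i.succ) = 0#w := by
      rw [hz₃r (by simp) (by simp) (by simp), hzp']; simp [hz₀, hact']
    have e2 : z₃ (.mat i.succ) = 0#w := by
      rw [hz₃r (by simp) (by simp) (by simp), hzp']; simp [hz₀, hmat']
    have e3 : z₃ (.pos i.succ) = 0#w := by
      rw [hz₃r (by simp) (by simp) (by simp), hzp']; simp [hz₀, hpos']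
    have e4 : z₃ (.mat i.castSucc) = bit F := by
      rw [hz₃r (by simp) (by simp) (by simp), hzp']; simp [hz₀, hmat]
    have e5 : z₃ (.tmp .sum) = j + k := by
      rw [hz₃r (by simp) (by simp) (by simp), hzp']
    have e6 : z₃ (.tmp .patLen) = mm := by
      rw [hz₃r (by simp) (by simp) (by simp), hzp']
    rw [hzu', hres]
    simp [Circuit.exec, Gate.exec, addTo, e1, e2, e3, e4, e5, e6, eval_or, eval_mod, bit_or,
      hne.symm]
  have hcomm_upd : Circuit.exec P T (updateCircuit i) (res z₃) = res zu := by
    simp only [hres]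
    rw [Circuit.exec_update, Circuit.exec_update, Circuit.exec_update, ← hzu] <;>
      simp [updateCircuit, Gate.Avoids, hne]
  have r7 : Reaches P T (updateCircuit i).reverse (res zu) (res z₃) 0 :=
    (reaches_of_exec_eq hupdc hcomm_upd).reverse
  set tests : Basis n M w → Basis n M w := fun y => Function.update (Function.update
    (Function.update y (.ext i) (bit e)) (.suf i) (bit s)) (.pre i) (bit p) with htests
  have hcomm_prep : Circuit.exec P T (prepCircuit m T.card i) (res (tests z₀)) =
      res (tests zp) := by
    simp only [hres, htests]
    rw [Circuit.exec_update, Circuit.exec_update, Circuit.exec_update, Circuit.exec_update,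
      Circuit.exec_update, Circuit.exec_update, ← hzp] <;>
      simp [prepCircuit, Gate.Avoids, hne]
  have r8 : Reaches P T (prepCircuit m T.card i).reverse (res z₃) (res (tests z₀)) 0 :=
    (reaches_of_exec_eq hprepc hcomm_prep).reverse
  rw [loopBody_eq]
  exact (r0.append (r1.append (r2.append (r3.append (r4.append (r5.append (r6.append
    (r7.append r8)))))))).mono (by linarith)

end ForLoop

/-! ### Columns and matches of a GD string -/

namespace GDString

variable {σ n m : ℕ} (T : GDString σ n)

/-- The number of columns of the first `t` segments. -/
def columns (t : ℕ) : ℕ := ∑ x ∈ univ.filter (fun x : Fin n => x.val < t), T.width x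

theorem columns_zero : T.columns 0 = 0 := by simp [columns]

theorem columns_succ (i : Fin n) : T.columns (i + 1) = T.columns i + T.width i := by
  unfold columns
  have : univ.filter (fun x : Fin n => x.val < i + 1) =
      insert i (univ.filter fun x : Fin n => x.val < i) := by
    ext x
    simp only [mem_filter, mem_univ, true_and, mem_insert, Fin.ext_iff]
    omega
  rw [this, Finset.sum_insert (by simp), add_comm]

theorem columns_mono {s t : ℕ} (h : s ≤ t) : T.columns s ≤ T.columns t :=
  Finset.sum_le_sum_of_subset fun x hx => by
    simp only [mem_filter, mem_univ, true_and] at hx ⊢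
    omega

theorem columns_self : T.columns n = T.totalWidth := by
  unfold columns totalWidth
  congr 1
  ext x
  simp

theorem offset_eq (i : Fin n) : T.offset i = T.columns i := rfl

/-- Column intervals of different segments are disjoint and ordered. -/
theorem offset_add_width_le {i j : Fin n} (h : i < j) : T.offset i + T.width i ≤ T.offset j := by
  rw [offset_eq, offset_eq, ← columns_succ]
  exact T.columns_mono h

theorem offset_add_width_le_columns {i : Fin n} {t : ℕ} (h : i.val < t) :
    T.offset i + T.width i ≤ T.columns t := by
  rw [offset_eq, ← columns_succ]
  exact T.columns_mono h

theorem columns_le_offset {i : Fin n} {t : ℕ} (h : t ≤ i.val) : T.columns t ≤ T.offset i :=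
  T.columns_mono h

theorem exists_segment {t p : ℕ} (ht : t ≤ n) (hp : p < T.columns t) :
    ∃ x : Fin n, ∃ v, x.val < t ∧ v < T.width x ∧ p = T.offset x + v := by
  induction t with
  | zero => simp [columns_zero] at hp
  | succ t ih =>
    have hs := T.columns_succ ⟨t, ht⟩
    by_cases h : p < T.columns t
    · obtain ⟨x, v, h1, h2⟩ := ih (by omega) h
      exact ⟨x, v, by omega, h2⟩
    · refine ⟨⟨t, ht⟩, p - T.columns t, by simp, ?_, ?_⟩
      · simp only at hs
        omega
      · rw [offset_eq]
        simp only
        omega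

/-- Some string of segment `i` agrees with the first `len` characters of the pattern where both
overlap, if the pattern is placed after `start` columns. -/
def Agrees (P : Fin m → Fin σ) (start len : ℕ) (i : Fin n) : Prop :=
  ∃ s, ∀ (v : Fin (T.width i)) (u : Fin m), u.val < len → start + u = T.offset i + v →
    T.str i s v = P u

/-- Some string of segment `i` agrees from position `q` on with the pattern from `p` on, for `len`
characters. -/
def SegmentMatch (P : Fin m → Fin σ) (i : Fin n) (p q len : ℕ) : Prop :=
  ∃ s, ∀ c < len, ∀ (v : Fin (T.width i)) (u : Fin m), u.val = p + c → v.val = q + c →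
    T.str i s v = P u

/-- The number of characters of the pattern that thread `h` has consumed before segment `t`. As the
columns are counted from 1, it starts at `(1 - h) mod m`, here written without subtraction of a larger
number as `m + 1 - h`. -/
def position (m h t : ℕ) : ℕ := (m + 1 - h + T.columns t) % m

/-- The current prefix of thread `h` agrees with the segments before `t`, and does not start before
the first column. -/
def Active (P : Fin m → Fin σ) (h t : ℕ) : Prop :=
  T.position m h t ≤ T.columns t ∧ ∀ i : Fin n, i.val < t →
    T.Agrees P (T.columns t - T.position m h t) (T.position m h t) i

/-- Thread `h` has found a match that ends before segment `t`: the match covers the columns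
`p + 1, …, p + m`, where `p + 1 = h + m * r` in the numbering from 1. -/
def Matched (P : Fin m → Fin σ) (h t : ℕ) : Prop :=
  ∃ p r, p + 1 = h + m * r ∧ p + m ≤ T.columns t ∧ ∀ i : Fin n, i.val < t → T.Agrees P p m i

variable {T} {P : Fin m → Fin σ}

theorem agrees_of_disjoint {start len : ℕ} {i : Fin n}
    (h : T.offset i + T.width i ≤ start ∨ start + len ≤ T.offset i) : T.Agrees P start len i := by
  refine ⟨⟨0, T.card_pos i⟩, fun v u hu huv => ?_⟩
  have := v.isLt
  omega

theorem agrees_congr {start len len' : ℕ} {i : Fin n}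
    (h : T.offset i + T.width i ≤ start + len) (h' : len ≤ len') :
    T.Agrees P start len' i ↔ T.Agrees P start len i := by
  refine exists_congr fun s => forall₂_congr fun v u => ?_
  have := v.isLt
  constructor
  · exact fun H hu huv => H (by omega) huv
  · exact fun H hu huv => H (by omega) huv

theorem position_lt (hm : 0 < m) (h t : ℕ) : T.position m h t < m := Nat.mod_lt _ hm

theorem position_succ (h : ℕ) (i : Fin n) :
    T.position m h (i + 1) = (T.position m h i + T.width i) % m := by
  unfold position
  rw [columns_succ, Nat.mod_add_mod, add_assoc]

/-- As long as the pattern is not exceeded, the prefix remains active iff the segment extends it. -/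
theorem active_succ_of_lt (h : ℕ) (i : Fin n) (hlt : T.position m h i + T.width i < m) :
    T.Active P h (i + 1) ↔
      T.Active P h i ∧ T.SegmentMatch P i (T.position m h i) 0 (T.width i) := by
  unfold Active
  rw [position_succ, Nat.mod_eq_of_lt hlt, columns_succ]
  set j := T.position m h i
  set k := T.width i with hk
  have hoff : T.offset i = T.columns i := T.offset_eq i
  have e : T.columns i + k - (j + k) = T.columns i - j := by omega
  rw [e, Nat.add_le_add_iff_right, and_assoc]
  refine and_congr_right fun hj => ?_
  have hseg : T.Agrees P (T.columns i - j) (j + k) i ↔ T.SegmentMatch P i j 0 k := by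
    refine exists_congr fun s => ?_
    constructor
    · intro H c hc v u hu hv
      exact H v u (by omega) (by omega)
    · intro H v u hu huv
      exact H v v.isLt v u (by omega) (by omega)
  constructor
  · intro H
    refine ⟨fun x hx => ?_, hseg.1 (H i (by omega))⟩
    rw [← agrees_congr (len' := j + k)
      (by have := T.offset_add_width_le_columns hx; omega) (by omega)]
    exact H x (by omega)
  · rintro ⟨H, H'⟩ x hx
    by_cases hxi : x.val < i
    · rw [agrees_congr (len := j) (by have := T.offset_add_width_le_columns hxi; omega)
        (by omega)]
      exact H x hxi
    · obtain rfl : x = i := Fin.ext (by omega)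
      exact hseg.2 H'

/-- If the pattern is exceeded, a new prefix is active iff it is a suffix of a string of the
segment. -/
theorem active_succ_of_le (hm : 0 < m) (h : ℕ) (i : Fin n) (hi : T.width i < m)
    (hle : m ≤ T.position m h i + T.width i) :
    T.Active P h (i + 1) ↔ T.SegmentMatch P i 0 (m - T.position m h i)
      (T.position m h i + T.width i - m) := by
  have hjm : T.position m h i < m := position_lt hm h i
  unfold Active
  have hmod : (T.position m h i + T.width i) % m = T.position m h i + T.width i - m := by
    rw [Nat.mod_eq_sub_mod hle, Nat.mod_eq_of_lt (by omega)]
  rw [position_succ, hmod, columns_succ]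
  set j := T.position m h i
  set k := T.width i with hk
  have hoff : T.offset i = T.columns i := T.offset_eq i
  have e : T.columns i + k - (j + k - m) = T.columns i + (m - j) := by omega
  rw [e, and_iff_right (by omega)]
  have hseg : T.Agrees P (T.columns i + (m - j)) (j + k - m) i ↔
      T.SegmentMatch P i 0 (m - j) (j + k - m) := by
    refine exists_congr fun s => ?_
    constructor
    · intro H c hc v u hu hv
      exact H v u (by omega) (by omega)
    · intro H v u hu huv
      exact H u hu v u (by omega) (by omega)
  rw [← hseg]
  constructor
  · exact fun H => H i (by omega)
  · intro H x hx
    by_cases hxi : x.val < i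
    · exact agrees_of_disjoint (Or.inl (by have := T.offset_add_width_le_columns hxi; omega))
    · obtain rfl : x = i := Fin.ext (by omega)
      exact H

/-- A new match ends in segment `i` iff the active prefix is completed there. -/
theorem matched_succ (h : ℕ) (hm : h < m) (i : Fin n) (hi : T.width i < m) :
    T.Matched P h (i + 1) ↔ T.Matched P h i ∨
      (T.SegmentMatch P i (T.position m h i) 0 (m - T.position m h i) ∧ T.Active P h i) ∧
        ¬ T.position m h i + T.width i < m := by
  have hjm : T.position m h i < m := position_lt (by omega) h i
  have hdiv := Nat.mod_add_div (m + 1 - h + T.columns i) m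
  have hoff : T.offset i = T.columns i := T.offset_eq i
  have hjdef : T.position m h i = (m + 1 - h + T.columns i) % m := rfl
  rw [← hjdef] at hdiv
  set d := (m + 1 - h + T.columns i) / m
  have hseg : ∀ p, p + T.position m h i = T.columns i → (T.Agrees P p m i ↔
      T.SegmentMatch P i (T.position m h i) 0 (m - T.position m h i)) := by
    intro p hp
    refine exists_congr fun s => ?_
    constructor
    · intro H c hc v u hu hv
      exact H v u (by omega) (by omega)
    · intro H v u hu huv
      exact H v (by have := u.isLt; omega) v u (by omega) (by omega)
  unfold Matched Active
  rw [columns_succ]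
  set j := T.position m h i
  set k := T.width i with hk
  constructor
  · rintro ⟨p, r, hpr, hp, H⟩
    by_cases hpi : p + m ≤ T.columns i
    · exact Or.inl ⟨p, r, hpr, hpi, fun x hx => H x (by omega)⟩
    · right
      -- The start `p` of the new match and the start `T.columns i - j` of the current prefix are
      -- congruent modulo `m` and less than `m` apart.
      have hpj : p + j = T.columns i := by
        have h1 : (p : ℤ) + j - T.columns i = m * (1 + r - d) := by
          zify [show h ≤ m + 1 by omega] at hdiv hpr
          linarith
        have h2 : (1 + r - d : ℤ) = 0 := by
          by_contra hne
          have h3 : (m : ℤ) ≤ |(m : ℤ) * (1 + r - d)| := by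
            rw [abs_mul, Nat.abs_cast]
            have := Int.one_le_abs hne
            nlinarith
          rw [← h1] at h3
          have h4 : |(p : ℤ) + j - T.columns i| < m := abs_lt.2 ⟨by omega, by omega⟩
          omega
        rw [h2, mul_zero] at h1
        omega
      refine ⟨⟨(hseg p hpj).1 (H i (by omega)), by omega, fun x hx => ?_⟩, by omega⟩
      rw [← agrees_congr (len' := m)
        (by have := T.offset_add_width_le_columns hx; omega) hjm.le,
        show T.columns i - j = p by omega]
      exact H x (by omega)
  · rintro (⟨p, r, hpr, hp, H⟩ | ⟨⟨H1, hj, H2⟩, hle⟩)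
    · refine ⟨p, r, hpr, by omega, fun x hx => ?_⟩
      by_cases hxi : x.val < i
      · exact H x hxi
      · exact agrees_of_disjoint
          (Or.inr (hp.trans (T.columns_le_offset (by omega))))
    · -- The prefix starts at grid point `r = d - 1`; `d = 0` would place it before the first column.
      have hd : d ≠ 0 := by
        intro hd
        rw [hd, mul_zero] at hdiv
        omega
      obtain ⟨r, hr⟩ := Nat.exists_eq_succ_of_ne_zero hd
      rw [hr, Nat.succ_eq_add_one, mul_add, mul_one] at hdiv
      refine ⟨T.columns i - j, r, by omega, by omega, fun x hx => ?_⟩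
      by_cases hxi : x.val < i
      · rw [agrees_congr (len := j) (by have := T.offset_add_width_le_columns hxi; omega) hjm.le]
        exact H2 x hxi
      · obtain rfl : x = i := Fin.ext (by omega)
        exact (hseg _ (by omega)).2 H1

theorem active_zero (h : ℕ) : T.Active P h 0 ↔ T.position m h 0 = 0 := by
  unfold Active
  rw [columns_zero]
  simp

theorem not_matched_zero (hm : 0 < m) (h : ℕ) : ¬ T.Matched P h 0 := by
  rintro ⟨p, r, -, hp, -⟩
  rw [columns_zero] at hp
  omega

/-! ### Concatenations of strings of the segments -/

/-- The concatenation of the chosen strings of the first `t` segments. -/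
def text (T : GDString σ n) (S : ∀ x, Fin (T.card x)) (t : ℕ) : List (Fin σ) :=
  ((List.finRange n).take t).flatMap fun x => T.word x (S x)

variable (S : ∀ x, Fin (T.card x))

theorem length_word (i : Fin n) (s : Fin (T.card i)) : (T.word i s).length = T.width i := by
  simp [word]

theorem take_finRange_succ (i : Fin n) :
    (List.finRange n).take (i + 1) = (List.finRange n).take i ++ [i] := by
  rw [List.take_add_one]
  simp

theorem text_succ (i : Fin n) : T.text S (i + 1) = T.text S i ++ T.word i (S i) := by
  unfold text
  rw [take_finRange_succ, List.flatMap_append, List.flatMap_singleton]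

theorem length_text {t : ℕ} (ht : t ≤ n) : (T.text S t).length = T.columns t := by
  induction t with
  | zero => simp [text, columns_zero]
  | succ t ih =>
    have h1 := text_succ S ⟨t, ht⟩
    have h2 := T.columns_succ ⟨t, ht⟩
    simp only at h1 h2
    rw [h1, h2, List.length_append, ih (by omega), length_word]

theorem text_eq_append {s t : ℕ} (h : s ≤ t) : T.text S t =
    T.text S s ++ (((List.finRange n).take t).drop s).flatMap fun x => T.word x (S x) := by
  unfold text
  rw [← List.flatMap_append]
  congr 1
  conv_lhs => rw [← List.take_append_drop s ((List.finRange n).take t)]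
  rw [List.take_take, min_eq_left h]

theorem text_prefix {s t : ℕ} (h : s ≤ t) : T.text S s <+: T.text S t :=
  ⟨_, (text_eq_append S h).symm⟩

theorem getElem?_text (x : Fin n) (v : Fin (T.width x)) :
    (T.text S n)[T.offset x + v]? = some (T.str x (S x) v) := by
  have h := text_prefix S (T := T) (show x.val + 1 ≤ n from x.isLt)
  have hlt : T.offset x + v < (T.text S (x + 1)).length := by
    rw [length_text S x.isLt, columns_succ, offset_eq]
    omega
  rw [List.prefix_iff_getElem?.1 h _ hlt, ← List.getElem?_eq_getElem hlt, text_succ,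
    List.getElem?_append_right (by rw [length_text S x.isLt.le, offset_eq]; omega),
    length_text S x.isLt.le, offset_eq, Nat.add_sub_cancel_left]
  simp [word]

theorem filter_finRange (i j : Fin n) (hij : i < j) :
    (List.finRange n).filter (fun x => i < x ∧ x < j) =
      ((List.finRange n).take j).drop (i + 1) := by
  have e : List.finRange n = ((List.finRange n).take (i + 1) ++
      ((List.finRange n).take j).drop (i + 1)) ++ (List.finRange n).drop j := by
    conv_lhs => rw [← List.take_append_drop j (List.finRange n)]
    congr 1
    conv_lhs => rw [← List.take_append_drop (i + 1) ((List.finRange n).take j)]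
    rw [List.take_take, min_eq_left (by omega)]
  conv_lhs => rw [e]
  rw [List.filter_append, List.filter_append]
  have h1 : ((List.finRange n).take (i + 1)).filter (fun x => i < x ∧ x < j) = [] := by
    rw [List.filter_eq_nil_iff]
    intro x hx
    obtain ⟨k, hk, rfl⟩ := List.mem_take_iff_getElem.1 hx
    simp [Fin.lt_def] at hk ⊢
    omega
  have h2 : ((List.finRange n).drop j).filter (fun x => i < x ∧ x < j) = [] := by
    rw [List.filter_eq_nil_iff]
    intro x hx
    obtain ⟨k, hk, rfl⟩ := List.mem_drop_iff_getElem.1 hx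
    simp [Fin.lt_def] at hk ⊢
  have h3 : (((List.finRange n).take j).drop (i + 1)).filter (fun x => i < x ∧ x < j) =
      ((List.finRange n).take j).drop (i + 1) := by
    rw [List.filter_eq_self]
    intro x hx
    obtain ⟨k, hk, rfl⟩ := List.mem_drop_iff_getElem.1 hx
    simp [Fin.lt_def] at hk ⊢
    omega
  rw [h1, h2, h3]
  simp

theorem factor_prefix {i j : Fin n} (hij : i < j) {a b : ℕ} (ha : 1 ≤ a) (hai : a ≤ T.width i) :
    (T.word i (S i)).drop (a - 1) ++
      ((List.finRange n).filter (fun x => i < x ∧ x < j)).flatMap (fun x => T.word x (S x)) ++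
      (T.word j (S j)).take b <+: (T.text S n).drop (T.offset i + (a - 1)) := by
  obtain ⟨rest, hrest⟩ := text_prefix S (T := T) (show j.val + 1 ≤ n from j.isLt)
  have e : (T.text S n).drop (T.offset i + (a - 1)) = (T.word i (S i)).drop (a - 1) ++
      (((List.finRange n).filter (fun x => i < x ∧ x < j)).flatMap (fun x => T.word x (S x)) ++
        (T.word j (S j) ++ rest)) := by
    rw [← hrest, text_succ, text_eq_append S (show i.val + 1 ≤ j.val from hij), text_succ,
      ← filter_finRange i j hij, List.append_assoc, List.append_assoc, List.append_assoc,
      offset_eq, ← length_text S i.isLt.le, List.drop_append, List.drop_eq_nil_of_le (by omega),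
      List.nil_append, Nat.add_sub_cancel_left,
      List.drop_append_of_le_length (by rw [length_word]; omega)]
  rw [e, List.append_assoc]
  refine ⟨(T.word j (S j)).drop b ++ rest, ?_⟩
  rw [List.append_assoc, List.append_assoc, ← List.append_assoc (List.take b _),
    List.take_append_drop]

theorem length_factor {i j : Fin n} (hij : i < j) {a b : ℕ} (ha : 1 ≤ a) (hai : a ≤ T.width i)
    (hb : b ≤ T.width j) :
    T.offset i + (a - 1) + ((T.word i (S i)).drop (a - 1) ++
      ((List.finRange n).filter (fun x => i < x ∧ x < j)).flatMap (fun x => T.word x (S x)) ++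
      (T.word j (S j)).take b).length = T.offset j + b := by
  have h1 := congrArg List.length (text_eq_append S (T := T) (show i.val + 1 ≤ j.val from hij))
  rw [List.length_append, length_text S j.isLt.le, length_text S (show i.val + 1 ≤ n by omega),
    ← filter_finRange i j hij, columns_succ] at h1
  rw [List.length_append, List.length_append, List.length_drop, List.length_take, length_word,
    length_word, offset_eq, offset_eq, h1]
  omega

variable {S}

/-- A match that starts after `p` columns is a choice of strings that agree with the pattern, as no
segment is long enough to contain the pattern. -/
theorem matchStartsAt_iff (hm : 0 < m) (hw : ∀ i, T.width i < m) (c : ℕ) :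
    T.MatchStartsAt P c ↔
      ∃ p, p + 1 = c ∧ p + m ≤ T.totalWidth ∧ ∀ i, T.Agrees P p m i := by
  constructor
  · rintro (⟨i, s, a, ha, hai, hc, hP⟩ | ⟨i, j, S, a, b, hij, ha, hai, hb, hbj, hc, hP⟩)
    · have := hP.length_le
      rw [List.length_ofFn, List.length_drop, length_word] at this
      have := hw i
      omega
    · have hpre := factor_prefix S (T := T) hij ha hai (b := b)
      have hlen := length_factor S (T := T) hij ha hai hbj
      rw [← hP] at hpre hlen
      rw [List.length_ofFn] at hlen
      refine ⟨T.offset i + (a - 1), by omega, ?_, fun x => ⟨S x, fun v u _ huv => ?_⟩⟩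
      · have := T.offset_add_width_le_columns (i := j) (t := n) j.isLt
        rw [columns_self] at this
        omega
      · have h1 := getElem?_text S x v
        have h2 := List.prefix_iff_getElem?.1 hpre u (by simp)
        rw [List.getElem?_drop, huv, h1] at h2
        simpa using h2
  · rintro ⟨p, hpc, hpW, H⟩
    choose S hS using H
    rw [← columns_self] at hpW
    -- The segments of the first and the last column of the match differ, as `T.width i < m`.
    obtain ⟨i, v, -, hv, hpi⟩ := T.exists_segment (p := p) le_rfl (by omega)
    obtain ⟨j, v', -, hv', hpj⟩ := T.exists_segment (p := p + m - 1) le_rfl (by omega)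
    have hwi := hw i
    have hij : i < j := by
      by_contra hij
      rcases lt_or_eq_of_le (not_lt.1 hij) with h | h
      · have := T.offset_add_width_le h
        omega
      · subst h
        omega
    right
    refine ⟨i, j, S, v + 1, v' + 1, hij, by omega, by omega, by omega, by omega, by omega, ?_⟩
    have hpre := factor_prefix S (T := T) hij (a := v + 1) (b := v' + 1) (by omega) (by omega)
    have hlen := length_factor S (T := T) hij (a := v + 1) (b := v' + 1) (by omega) (by omega)
      (by omega)
    have hP : List.ofFn P <+: (T.text S n).drop (T.offset i + (v + 1 - 1)) := by
      rw [List.prefix_iff_getElem?]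
      intro u hu
      rw [List.length_ofFn] at hu
      obtain ⟨x, y, -, hy, hxy⟩ := T.exists_segment (p := p + u) le_rfl (by omega)
      rw [List.getElem?_drop, show T.offset i + (v + 1 - 1) + u = T.offset x + y by omega,
        getElem?_text S x ⟨y, hy⟩, hS x ⟨y, hy⟩ ⟨u, hu⟩ hu hxy]
      simp
    refine (List.prefix_of_prefix_length_le hP hpre ?_).eq_of_length ?_ <;>
      rw [List.length_ofFn] <;> omega

/-- After the last segment, thread `h` has found a match iff `f₁ h = 1`. -/
theorem f₁_iff_matched (hw : ∀ i, T.width i < m) (hn : 0 < n) (h : Fin m) :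
    T.f₁ P h ↔ T.Matched P h n := by
  have hm : 2 ≤ m := by
    have h1 := hw ⟨0, hn⟩
    have h2 := T.width_pos ⟨0, hn⟩
    omega
  unfold f₁ Matched
  simp_rw [matchStartsAt_iff (P := P) (by omega : 0 < m) hw, columns_self]
  constructor
  · rintro ⟨r, -, p, hp, hpW, H⟩
    exact ⟨p, r, hp, hpW, fun i _ => H i⟩
  · rintro ⟨p, r, hp, hpW, H⟩
    exact ⟨r, by omega, p, hp, hpW, fun i => H i i.isLt⟩

end GDString

/-! ### Correctness of the for-loop -/

section Correctness

variable {σ n m M w : ℕ} {P : Fin m → Fin σ} {T : GDString σ n}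

theorem toNat_ofNat_of_lt {a : ℕ} (h : a < 2 ^ w) : (BitVec.ofNat w a).toNat = a := by
  rw [BitVec.toNat_ofNat, Nat.mod_eq_of_lt h]

theorem ofNat_add_ofNat (a b : ℕ) :
    BitVec.ofNat w a + BitVec.ofNat w b = BitVec.ofNat w (a + b) := (BitVec.ofNat_add a b).symm

theorem ofNat_sub_ofNat {a b : ℕ} (h : b ≤ a) :
    BitVec.ofNat w a - BitVec.ofNat w b = BitVec.ofNat w (a - b) := by
  rw [sub_eq_iff_eq_add, ofNat_add_ofNat, Nat.sub_add_cancel h]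

theorem ofNat_mod_ofNat {a b : ℕ} (ha : a < 2 ^ w) (hb : b < 2 ^ w) :
    BitVec.ofNat w a % BitVec.ofNat w b = BitVec.ofNat w (a % b) := by
  apply BitVec.eq_of_toNat_eq
  rw [BitVec.toNat_umod, toNat_ofNat_of_lt ha, toNat_ofNat_of_lt hb,
    toNat_ofNat_of_lt ((Nat.mod_le a b).trans_lt ha)]

/-- If no word overflows and both substrings lie within the arrays, the arithmetic on words is that on
numbers, and padding cells are never compared. -/
theorem occurs_iff {i : Fin n} (hσ : σ ≤ 2 ^ w) (hm : m < 2 ^ w) (hk : T.width i < 2 ^ w)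
    (hc : T.card i < 2 ^ w) {p q len : ℕ} (hp : p + len ≤ m) (hq : q + len ≤ T.width i) :
    Occurs P T i (BitVec.ofNat w p) (BitVec.ofNat w q) (BitVec.ofNat w len) ↔
      T.SegmentMatch P i p q len := by
  have hhit : ∀ s (hs : s < T.card i),
      IsHit P T i (Nat.clog 2 (T.width i)) (BitVec.ofNat w p) (BitVec.ofNat w q)
        (BitVec.ofNat w len) (BitVec.ofNat w s) ↔
      ∀ c < len, ∀ (v : Fin (T.width i)) (u : Fin m), u.val = p + c → v.val = q + c →
        T.str i ⟨s, hs⟩ v = P u := by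
    intro s hs
    have hcell : ∀ c (hc' : c < len),
        (patternCell P w (BitVec.ofNat w p + BitVec.ofNat w c).toNat =
          textCell T w i (BitVec.ofNat w s).toNat (BitVec.ofNat w q + BitVec.ofNat w c).toNat ↔
        P ⟨p + c, by omega⟩ = T.str i ⟨s, hs⟩ ⟨q + c, by omega⟩) := by
      intro c hc'
      rw [ofNat_add_ofNat, ofNat_add_ofNat, toNat_ofNat_of_lt (by omega : p + c < 2 ^ w),
        toNat_ofNat_of_lt (by omega : q + c < 2 ^ w), toNat_ofNat_of_lt (by omega : s < 2 ^ w),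
        patternCell, textCell, dif_pos (by omega), dif_pos ⟨hs, by omega⟩]
      constructor
      · intro h
        exact Fin.ext (ofNat_inj_of_lt le_rfl ((Fin.isLt _).trans_le hσ)
          ((Fin.isLt _).trans_le hσ) h)
      · intro h
        rw [h]
    unfold IsHit IsMismatch
    constructor
    · intro H c hc' v u hu hv
      by_contra hne
      refine H ⟨c, ?_, ?_, ?_⟩
      · calc c < T.width i := by omega
          _ ≤ 2 ^ Nat.clog 2 (T.width i) := Nat.le_pow_clog one_lt_two _
      · rw [Ne, hcell c hc']
        rw [show u = ⟨p + c, by omega⟩ from Fin.ext hu,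
          show v = ⟨q + c, by omega⟩ from Fin.ext hv] at hne
        exact fun h => hne h.symm
      · rwa [toNat_ofNat_of_lt (by omega : c < 2 ^ w), toNat_ofNat_of_lt (by omega : len < 2 ^ w)]
    · rintro H ⟨c, hcq, hne, hclen⟩
      have hcw : c < 2 ^ w := hcq.trans_le (Nat.pow_le_pow_right two_pos
        (Nat.clog_le_of_le_pow hk.le))
      rw [toNat_ofNat_of_lt hcw, toNat_ofNat_of_lt (by omega : len < 2 ^ w)] at hclen
      exact hne ((hcell c hclen).2 (H c hclen ⟨q + c, by omega⟩ ⟨p + c, by omega⟩ rfl rfl).symm)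
  unfold Occurs GDString.SegmentMatch
  constructor
  · rintro ⟨s, hs, hsc, H⟩
    have hsw : s < 2 ^ w := hs.trans_le (Nat.pow_le_pow_right two_pos
      (Nat.clog_le_of_le_pow hc.le))
    rw [toNat_ofNat_of_lt hsw, toNat_ofNat_of_lt hc] at hsc
    exact ⟨⟨s, hsc⟩, (hhit s hsc).1 H⟩
  · rintro ⟨⟨s, hs⟩, H⟩
    refine ⟨s, hs.trans_le (Nat.le_pow_clog one_lt_two _), ?_, (hhit s hs).2 H⟩
    rwa [toNat_ofNat_of_lt (hs.trans hc), toNat_ofNat_of_lt hc]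

/-- The ideal state of the registers of thread `h` before iteration `t`. -/
structure LoopState (P : Fin m → Fin σ) (T : GDString σ n) (h : ℕ) (t : Fin (n + 1))
    (z : Basis n M w) : Prop where
  id : z .id = BitVec.ofNat w h
  tmp : ∀ x, z (.tmp x) = 0#w
  scratch : ∀ r ∈ searchScratch, z r = 0#w
  tests : ∀ i : Fin n, t ≤ i.castSucc →
    z (.width i) = 0#w ∧ z (.ext i) = 0#w ∧ z (.suf i) = 0#w ∧ z (.pre i) = 0#w
  later : ∀ u, t < u → z (.pos u) = 0#w ∧ z (.act u) = 0#w ∧ z (.mat u) = 0#w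
  pos : z (.pos t) = BitVec.ofNat w (T.position m h t)
  act : z (.act t) = bit (T.Active P h t)
  mat : z (.mat t) = bit (T.Matched P h t)

/-- The basis state of thread `h` before the computation. -/
def startState (h : ℕ) : Basis n M w :=
  Function.update (fun _ => 0#w) Reg.id (BitVec.ofNat w h)

/-- The first part of the initialisation. -/
def startCircuit (m : ℕ) : Circuit n M :=
  [.load 1 (.tmp .one),
   .load m (.tmp .patLen),
   .op .add (.tmp .one) (.tmp .patLen) (.tmp .shift),
   .op .sub (.tmp .shift) .id (.tmp .start)]

theorem bit_congr {p p' : Prop} (h : p ↔ p') : (bit p : BitVec w) = bit p' := by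
  rw [propext h]

theorem exists_loopState_initCircuit {h : ℕ} (hh : h < m) (hmw : m + 1 < 2 ^ w) :
    ∃ z : Basis n M w, LoopState P T h 0 z ∧ Reaches P T (initCircuit m) (startState h) z 0 := by
  have e : (initCircuit m : Circuit n M) = startCircuit m ++
      ([.op .mod (.tmp .start) (.tmp .patLen) (.pos 0),
        .op .eq (.pos 0) (.tmp .zero) (.act 0)] ++ (startCircuit m).reverse) := by
    simp only [initCircuit, startCircuit, List.append_assoc]
  set j := (m + 1 - h) % m with hj
  have hjm : j < m := Nat.mod_lt _ (by omega)
  set res : Basis n M w → Basis n M w := fun y =>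
    Function.update (Function.update y (.pos 0) (BitVec.ofNat w j)) (.act 0) (bit (j = 0)) with hres
  have hcl : ∀ g ∈ (startCircuit m : Circuit n M), g.IsClassical := by
    simp [startCircuit, Gate.IsClassical]
  set zs := Circuit.exec P T (startCircuit m) (startState h : Basis n M w) with hzs
  have hstart : BitVec.ofNat w 1 + BitVec.ofNat w m - BitVec.ofNat w h =
      BitVec.ofNat w (m + 1 - h) := by
    rw [ofNat_add_ofNat, add_comm 1 m, ofNat_sub_ofNat (by omega)]
  have hzs' : zs = Function.update (Function.update (Function.update (Function.update
      (startState h) (.tmp .one) (BitVec.ofNat w 1)) (.tmp .patLen) (BitVec.ofNat w m))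
      (.tmp .shift) (BitVec.ofNat w 1 + BitVec.ofNat w m))
      (.tmp .start) (BitVec.ofNat w (m + 1 - h)) := by
    rw [← hstart]
    simp [hzs, startCircuit, Circuit.exec, Gate.exec, addTo, startState, eval_add, eval_sub]
  have r1 : Reaches P T (startCircuit m) (startState h) zs 0 := reaches_exec hcl _
  have r2 : Reaches P T [.op .mod (.tmp .start) (.tmp .patLen) (.pos 0),
      .op .eq (.pos 0) (.tmp .zero) (.act 0)] zs (res zs) 0 := by
    refine reaches_of_exec_eq (by simp [Gate.IsClassical]) ?_
    have hbit : (bit (BitVec.ofNat w j = 0#w) : BitVec w) = bit (j = 0) := by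
      refine bit_congr ⟨fun hb => ?_, fun hb => by rw [hb]⟩
      exact ofNat_inj_of_lt le_rfl (by omega) (by positivity) hb
    simp only [hres]
    rw [← hbit, hzs', hj, ← ofNat_mod_ofNat (by omega) (by omega)]
    simp [Circuit.exec, Gate.exec, addTo, startState, eval_mod, eval_eq]
  have hcomm : Circuit.exec P T (startCircuit m) (res (startState h)) = res zs := by
    simp only [hres]
    rw [Circuit.exec_update, Circuit.exec_update, ← hzs] <;>
      simp [startCircuit, Gate.Avoids]
  have r3 : Reaches P T (startCircuit m).reverse (res zs) (res (startState h)) 0 :=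
    (reaches_of_exec_eq hcl hcomm).reverse
  have hpos : T.position m h 0 = j := by
    rw [GDString.position, GDString.columns_zero, add_zero]
  refine ⟨res (startState h), ⟨?_, ?_, ?_, ?_, ?_, ?_, ?_, ?_⟩, ?_⟩
  · simp [hres, startState]
  · simp [hres, startState]
  · intro r hr
    simp only [hres, startState]
    rw [Function.update_of_ne, Function.update_of_ne, Function.update_of_ne] <;> rintro rfl <;>
      simp [searchScratch, stringScratch, charScratch] at hr
  · intro i _
    simp [hres, startState]
  · intro u hu
    simp [hres, startState, hu.ne']
  · simp [hres, hpos]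
  · rw [Fin.val_zero, bit_congr (GDString.active_zero h), hpos]
    simp [hres]
  · rw [Fin.val_zero, bit, if_neg (GDString.not_matched_zero (by omega) h)]
    simp [hres, startState]
  · rw [e]
    exact (r1.append (r2.append r3)).mono (by norm_num)

/-- The parameters are large enough: no word overflows, and the bit length `L` bounds the number of
qubits of the searches. -/
structure Suitable (T : GDString σ n) (m w L : ℕ) : Prop where
  alphabet : σ ≤ 2 ^ w
  pattern : 2 * m < 2 ^ w
  card : ∀ i, T.card i < 2 ^ w
  width : ∀ i, T.width i < m
  clog_width : ∀ i, Nat.clog 2 (T.width i) / 2 + 1 ≤ L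
  clog_card : ∀ i, Nat.clog 2 (T.card i) / 2 + 1 ≤ L

theorem exists_loopState_loopBody {L K : ℕ} (hM : M = K * (L + 1)) (hw : 0 < w)
    (hS : Suitable T m w L) {h : ℕ} (hh : h < m) (i : Fin n) {z : Basis n M w}
    (hz : LoopState P T h i.castSucc z) :
    ∃ z', LoopState P T h i.succ z' ∧
      Reaches P T (loopBody L m T.width T.card i) z z'
        (3 * segmentError K M (Nat.clog 2 (T.card i))) := by
  have hki := hS.width i
  have hmw := hS.pattern
  set j := T.position m h i with hj
  have hjm : j < m := GDString.position_lt (by omega) h i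
  obtain ⟨h1, h2, h3, h4⟩ := hz.tests i le_rfl
  obtain ⟨h5, h6, h7⟩ := hz.later i.succ Fin.castSucc_lt_succ
  have hreach := reaches_loopBody (P := P) (T := T) (m := m) hM hw i
    (Nat.clog_le_of_le_pow (by omega)) (hS.clog_width i)
    (Nat.clog_le_of_le_pow (hS.card i).le) (hS.clog_card i) hz.tmp hz.scratch h1 h2 h3 h4 h6 h7 h5
    hz.act hz.mat
  have hpos : z (.pos i.castSucc) = BitVec.ofNat w j := by rw [hz.pos, Fin.val_castSucc]
  refine ⟨_, ?_, hreach⟩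
  rw [hpos, ofNat_sub_ofNat hjm.le, ofNat_add_ofNat]
  set k := T.width i with hk
  have hless : ((BitVec.ofNat w (j + k)).toNat < (BitVec.ofNat w m).toNat) = (j + k < m) := by
    rw [toNat_ofNat_of_lt (by omega), toNat_ofNat_of_lt (by omega)]
  have hcard := hS.card i
  unfold afterBody
  rw [ofNat_add_ofNat, hless, ofNat_mod_ofNat (by omega) (by omega)]
  dsimp only
  set e := Occurs P T i (BitVec.ofNat w j) 0#w (BitVec.ofNat w k) with he
  set s := Occurs P T i (BitVec.ofNat w j) 0#w (BitVec.ofNat w (m - j)) with hs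
  set p := Occurs P T i 0#w (BitVec.ofNat w (m - j))
    (BitVec.ofNat w (j + k) - BitVec.ofNat w m) with hp
  have hsucc : i.succ ≠ i.castSucc := Fin.castSucc_lt_succ.ne'
  have hact : ((j + k < m ∧ T.Active P h i ∧ e) ∨ (p ∧ ¬ j + k < m)) ↔
      T.Active P h (i + 1) := by
    by_cases hlt : j + k < m
    · rw [GDString.active_succ_of_lt h i hlt]
      have : e ↔ T.SegmentMatch P i j 0 k :=
        occurs_iff hS.alphabet (by omega) (by omega) hcard (by omega) (by omega)
      simp [hlt, this, ← hj, ← hk]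
    · rw [GDString.active_succ_of_le (by omega) h i hki (not_lt.1 hlt)]
      have : p ↔ T.SegmentMatch P i 0 (m - j) (j + k - m) := by
        rw [hp, ofNat_sub_ofNat (not_lt.1 hlt)]
        exact occurs_iff (p := 0) hS.alphabet (by omega) (by omega) hcard (by omega) (by omega)
      simp [hlt, this, ← hj, ← hk]
  have hmat : (T.Matched P h i ∨ ((s ∧ T.Active P h i) ∧ ¬ j + k < m)) ↔
      T.Matched P h (i + 1) := by
    rw [GDString.matched_succ h hh i hki]
    by_cases hlt : j + k < m
    · simp [hlt, ← hj, ← hk]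
    · have : s ↔ T.SegmentMatch P i j 0 (m - j) :=
        occurs_iff (q := 0) hS.alphabet (by omega) (by omega) hcard (by omega) (by omega)
      simp [hlt, this, ← hj, ← hk]
  rw [Fin.val_castSucc, bit_congr hact, bit_congr hmat]
  refine ⟨?_, ?_, ?_, ?_, ?_, ?_, ?_, ?_⟩
  · simp [hz.id]
  · simp [hz.tmp]
  · intro r hr
    rw [Function.update_of_ne, Function.update_of_ne, Function.update_of_ne, Function.update_of_ne,
      Function.update_of_ne, Function.update_of_ne, Function.update_of_ne, hz.scratch r hr] <;>
      rintro rfl <;> simp [searchScratch, stringScratch, charScratch] at hr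
  · intro i' hi'
    have hii' : i < i' := Fin.succ_le_castSucc_iff.1 hi'
    have := hz.tests i' (Fin.castSucc_le_castSucc_iff.2 hii'.le)
    simp [this, hii'.ne']
  · intro u hu
    have := hz.later u (Fin.castSucc_lt_succ.trans hu)
    simp [this, hu.ne']
  · simp [GDString.position_succ, ← hj, ← hk]
  · simp
  · simp

theorem exists_loopState_forLoop {L K : ℕ} (hM : M = K * (L + 1)) (hw : 0 < w)
    (hS : Suitable T m w L) {h : ℕ} (hh : h < m) {ε : ℝ}
    (hε : ∀ i, segmentError K M (Nat.clog 2 (T.card i)) ≤ ε) :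
    ∃ z : Basis n M w, LoopState P T h (Fin.last n) z ∧
      Reaches P T (forLoop L m T.width T.card) (startState h) z (n * (3 * ε)) := by
  have key : ∀ t : Fin (n + 1), ∃ z : Basis n M w, LoopState P T h t z ∧
      Reaches P T (initCircuit m ++ ((List.finRange n).take t).flatMap
        (loopBody L m T.width T.card)) (startState h) z (t * (3 * ε)) := by
    intro t
    have hmw := hS.pattern
    induction t using Fin.induction with
    | zero =>
      obtain ⟨z, hz, hr⟩ := exists_loopState_initCircuit (P := P) (T := T) (M := M) (w := w) hh
        (by omega)
      exact ⟨z, hz, by simpa using hr⟩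
    | succ i ih =>
      obtain ⟨z, hz, hr⟩ := ih
      obtain ⟨z', hz', hr'⟩ := exists_loopState_loopBody hM hw hS hh i hz
      refine ⟨z', hz', ?_⟩
      rw [Fin.val_succ, GDString.take_finRange_succ, List.flatMap_append, List.flatMap_singleton,
        ← List.append_assoc]
      refine (hr.append hr').mono ?_
      have := hε i
      push_cast
      rw [Fin.val_castSucc]
      linarith
  obtain ⟨z, hz, hr⟩ := key (Fin.last n)
  refine ⟨z, hz, ?_⟩
  rwa [Fin.val_last, List.take_of_length_le (by simp)] at hr

/-- The thread identifier is never changed. -/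
theorem forLoop_writesIn (L m : ℕ) (k c : Fin n → ℕ) :
    Circuit.WritesIn {.id}ᶜ (forLoop L m k c : Circuit n M) := by
  have hseg : ∀ (i : Fin n) (p q len : Reg n M) {out : Reg n M}, out ≠ .id →
      Circuit.WritesIn {.id}ᶜ (segmentSearch L i (k i) (c i) p q len out : Circuit n M) := by
    intro i p q len out hout
    refine (segmentSearch_writesIn L i (k i) (c i) p q len out).mono ?_
    rintro r (hr | rfl) rfl
    · simp [searchScratch, stringScratch, charScratch] at hr
    · exact hout rfl
  have hprep : ∀ i, Circuit.WritesIn {.id}ᶜ (prepCircuit m c i : Circuit n M) := by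
    simp [Circuit.WritesIn, prepCircuit, Gate.WritesIn]
  have hupd : ∀ i, Circuit.WritesIn {.id}ᶜ (updateCircuit i : Circuit n M) := by
    simp [Circuit.WritesIn, updateCircuit, Gate.WritesIn]
  have hbody : ∀ i, Circuit.WritesIn {.id}ᶜ (loopBody L m k c i : Circuit n M) := by
    intro i
    rw [loopBody_eq]
    simp only [Circuit.writesIn_append, Circuit.writesIn_reverse]
    refine ⟨?_, hprep i, hseg _ _ _ _ (by simp), hseg _ _ _ _ (by simp), hseg _ _ _ _ (by simp),
      hupd i, ?_, hupd i, hprep i⟩ <;> simp [Circuit.WritesIn, Gate.WritesIn]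
  unfold forLoop
  rw [Circuit.writesIn_append]
  refine ⟨by simp [Circuit.WritesIn, initCircuit, Gate.WritesIn], fun g hg => ?_⟩
  obtain ⟨i, -, hg⟩ := List.mem_flatMap.1 hg
  exact hbody i g hg

/-- As the threads stay in orthogonal blocks, the outcome of thread `h` is independent of the other
threads. -/
theorem lt_measureProb {C : Circuit n M} (hC : Circuit.WritesIn {.id}ᶜ C) (hm : m < 2 ^ w)
    {ε : ℝ} (hε : ε ≤ 1 / 10) {h : Fin m} {z : Basis n M w}
    (hr : Reaches P T C (startState h) z ε) (α : Fin m → ℂ) (hα : α h ≠ 0)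
    {E : Basis n M w → Prop} (hzid : z .id = BitVec.ofNat w h) (hE : E z) :
    2 / 3 * ‖α h‖ ^ 2 < measureProb (C.run P T (initialState n M w α)) E := by
  classical
  have hinit : initialState n M w α =
      (∑ h : Fin m, α h • ket (startState (h : ℕ)) : StateSpace n M w).ofLp := by
    funext x
    rw [WithLp.ofLp_sum, Finset.sum_apply]
    refine Finset.sum_congr rfl fun h _ => ?_
    rw [PiLp.smul_apply, ket_apply, startState]
    split_ifs <;> simp
  have hamp : C.run P T (initialState n M w α) z =
      α h * (Circuit.isometry P T C (ket (startState (h : ℕ)))).ofLp z := by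
    rw [hinit, Circuit.run_eq_isometry, map_sum, WithLp.ofLp_sum, Finset.sum_apply,
      Finset.sum_eq_single h]
    · rw [map_smul]
      rfl
    · intro h' _ hne
      rw [map_smul, PiLp.smul_apply, Circuit.isometry_ket_mem P T hC, smul_zero]
      intro hz
      have := hz .id (by simp)
      rw [hzid, startState, Function.update_self] at this
      exact hne (Fin.ext (ofNat_inj_of_lt le_rfl (h.isLt.trans hm) (h'.isLt.trans hm) this).symm)
    · simp
  have hclose : 9 / 10 ≤ ‖(Circuit.isometry P T C (ket (startState (h : ℕ)))).ofLp z‖ := by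
    have h1 := PiLp.norm_apply_le (Circuit.isometry P T C (ket (startState (h : ℕ))) - ket z) z
    rw [PiLp.sub_apply, ket_apply, if_pos rfl] at h1
    have h2 : ‖Circuit.isometry P T C (ket (startState (h : ℕ))) - ket z‖ ≤ ε := hr
    have h3 := norm_sub_norm_le (1 : ℂ)
      ((Circuit.isometry P T C (ket (startState (h : ℕ)))).ofLp z)
    rw [norm_one, norm_sub_rev] at h3
    linarith
  unfold measureProb
  have hαpos : 0 < ‖α h‖ ^ 2 := by positivity
  calc 2 / 3 * ‖α h‖ ^ 2 < (9 / 10) ^ 2 * ‖α h‖ ^ 2 := by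
        refine mul_lt_mul_of_pos_right ?_ hαpos
        norm_num
    _ ≤ ‖(Circuit.isometry P T C (ket (startState (h : ℕ)))).ofLp z‖ ^ 2 * ‖α h‖ ^ 2 := by gcongr
    _ = if E z then ‖C.run P T (initialState n M w α) z‖ ^ 2 else 0 := by
        rw [if_pos hE, hamp, norm_mul]
        ring
    _ ≤ _ := by
        refine Finset.single_le_sum (f := fun x => if E x then
          ‖C.run P T (initialState n M w α) x‖ ^ 2 else 0) (fun x _ => ?_) (Finset.mem_univ z)
        split_ifs <;> positivity

end Correctness

/-! ### The running time -/

section RunningTime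

variable {n M : ℕ}

theorem length_hadamards (q : ℕ) (r : Reg n M) : (hadamards q r).length = q := by
  simp [hadamards]

theorem length_groverRun_le (L : ℕ) (l : Level) (q : ℕ) (b : Reg n M) (O : Reg n M → Circuit n M)
    (t : Fin M) {ℓ : ℕ} (hO : (O (.cand l t)).length ≤ ℓ) :
    (groverRun L l q b O t).length ≤ 2 ^ (q / 2) * (4 * ℓ + 3 * q + 5) := by
  have hit := iterations_le L q t
  have hX : 1 ≤ 2 ^ (q / 2) := Nat.one_le_two_pow
  set X := 2 ^ (q / 2)
  have e : (groverRun L l q b O t).length = q + iterations L q t *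
      (2 * (O (.cand l t)).length + 2 * q + 4) + (2 * (O (.cand l t)).length + 1) := by
    simp only [groverRun, groverStep, List.length_append, List.length_flatten, List.map_replicate,
      List.sum_replicate, List.length_reverse, length_hadamards, List.length_cons, List.length_nil,
      smul_eq_mul]
    ring
  rw [e]
  calc _ ≤ X * q + X * (2 * ℓ + 2 * q + 4) + X * (2 * ℓ + 1) := by
        refine add_le_add (add_le_add (Nat.le_mul_of_pos_left q hX)
          (Nat.mul_le_mul hit (by omega))) ?_
        exact (by omega : _ ≤ 2 * ℓ + 1).trans (Nat.le_mul_of_pos_left _ hX)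
    _ = _ := by ring

theorem length_flatMap_finRange_le {α : Type*} {M : ℕ} (f : Fin M → List α) {B : ℕ}
    (h : ∀ t, (f t).length ≤ B) : ((List.finRange M).flatMap f).length ≤ M * B := by
  rw [List.length_flatMap]
  calc ((List.finRange M).map fun t => (f t).length).sum
      ≤ ((List.finRange M).map fun t => (f t).length).length • B :=
        List.sum_le_card_nsmul _ _ (by simpa using h)
    _ = M * B := by simp

theorem length_groverSearch_le (L : ℕ) (l : Level) (q : ℕ) (b out : Reg n M)
    (O : Reg n M → Circuit n M) {ℓ : ℕ} (hO : ∀ r, (O r).length ≤ ℓ) :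
    (groverSearch L l q b out O).length ≤
      2 * M * (2 ^ (q / 2) * (4 * ℓ + 3 * q + 5)) + 1 := by
  have h := length_flatMap_finRange_le (groverRun L l q b O)
    fun t => length_groverRun_le L l q b O t (hO _)
  simp only [groverSearch, List.length_append, List.length_reverse, List.length_cons,
    List.length_nil]
  linarith

theorem length_segmentSearch_le (L : ℕ) (i : Fin n) (ki ci : ℕ) (p q len out : Reg n M)
    (hM : 1 ≤ M) (hL : 1 ≤ L) (hk : Nat.clog 2 ki ≤ L) (hc : Nat.clog 2 ci ≤ L) :
    (segmentSearch L i ki ci p q len out).length ≤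
      617 * L * M ^ 2 * (2 ^ (Nat.clog 2 ci / 2) * 2 ^ (Nat.clog 2 ki / 2)) := by
  have hX₃ : 1 ≤ 2 ^ (Nat.clog 2 ki / 2) := Nat.one_le_two_pow
  have hX₂ : 1 ≤ 2 ^ (Nat.clog 2 ci / 2) := Nat.one_le_two_pow
  have h1 : ∀ s, (stringOracle L i ki p q len s).length ≤
      2 * M * (2 ^ (Nat.clog 2 ki / 2) * (33 + 3 * Nat.clog 2 ki)) + 3 := by
    intro s
    have := length_groverSearch_le L .chars (Nat.clog 2 ki) (.tmp .mismatch) (.tmp .anyMismatch)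
      (mismatchOracle i p q len s) (ℓ := 7) (fun r => by simp [mismatchOracle])
    simp only [stringOracle, List.length_append, List.length_cons, List.length_nil]
    linarith
  have h2 := length_groverSearch_le L .strings (Nat.clog 2 ci) (.tmp .hit) out
    (stringOracle L i ki p q len) h1
  refine h2.trans ?_
  set X₂ := 2 ^ (Nat.clog 2 ci / 2)
  set X₃ := 2 ^ (Nat.clog 2 ki / 2)
  have hone : 1 ≤ L * M ^ 2 * (X₂ * X₃) := Nat.mul_pos (by positivity) (by positivity)
  have h3 : 33 + 3 * Nat.clog 2 ki ≤ 36 * L := by omega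
  have h4 : 17 + 3 * Nat.clog 2 ci ≤ 20 * L := by omega
  have h5 : M * X₂ * L ≤ L * M ^ 2 * (X₂ * X₃) := by
    calc M * X₂ * L = M * X₂ * L * 1 := by ring
      _ ≤ M * X₂ * L * (M * X₃) := Nat.mul_le_mul_left _ (Nat.mul_pos hM hX₃)
      _ = _ := by ring
  calc _ = 16 * (M ^ 2 * (X₂ * X₃)) * (33 + 3 * Nat.clog 2 ki) +
        2 * (M * X₂) * (17 + 3 * Nat.clog 2 ci) + 1 := by ring
    _ ≤ 16 * (M ^ 2 * (X₂ * X₃)) * (36 * L) + 2 * (M * X₂) * (20 * L) +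
        L * M ^ 2 * (X₂ * X₃) := by gcongr
    _ ≤ _ := by nlinarith

theorem length_forLoop_le (L m : ℕ) (k c : Fin n → ℕ) (hn : 0 < n) (hM : 1 ≤ M) (hL : 1 ≤ L)
    (hk : ∀ i, Nat.clog 2 (k i) ≤ L) (hc : ∀ i, Nat.clog 2 (c i) ≤ L) :
    (forLoop L m k c : Circuit n M).length ≤ 1887 * L * M ^ 2 *
      ∑ i, 2 ^ (Nat.clog 2 (c i) / 2) * 2 ^ (Nat.clog 2 (k i) / 2) := by
  have hbody : ∀ i, (loopBody L m k c i : Circuit n M).length ≤ 1877 * L * M ^ 2 *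
      (2 ^ (Nat.clog 2 (c i) / 2) * 2 ^ (Nat.clog 2 (k i) / 2)) := by
    intro i
    have hseg := fun p q len out => length_segmentSearch_le (M := M) L i (k i) (c i) p q len out hM
      hL (hk i) (hc i)
    have hone : 1 ≤ L * M ^ 2 * (2 ^ (Nat.clog 2 (c i) / 2) * 2 ^ (Nat.clog 2 (k i) / 2)) :=
      Nat.mul_pos (by positivity) (by positivity)
    have h1 := hseg (.pos i.castSucc) (.tmp .zero) (.width i) (.ext i)
    have h2 := hseg (.pos i.castSucc) (.tmp .zero) (.tmp .rem) (.suf i)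
    have h3 := hseg (.tmp .zero) (.tmp .rem) (.tmp .over) (.pre i)
    rw [loopBody_eq]
    simp only [prepCircuit, updateCircuit, List.length_append, List.length_reverse,
      List.length_cons, List.length_nil]
    linarith
  have hone : 1 ≤ L * M ^ 2 * ∑ i, 2 ^ (Nat.clog 2 (c i) / 2) * 2 ^ (Nat.clog 2 (k i) / 2) := by
    refine Nat.mul_pos (by positivity) (Finset.sum_pos (fun i _ => by positivity) ⟨⟨0, hn⟩, by simp⟩)
  have hsum : ((List.finRange n).flatMap (loopBody L m k c : Fin n → Circuit n M)).length ≤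
      1877 * L * M ^ 2 * ∑ i, 2 ^ (Nat.clog 2 (c i) / 2) * 2 ^ (Nat.clog 2 (k i) / 2) := by
    rw [List.length_flatMap, Finset.mul_sum, ← List.ofFn_eq_map, List.sum_ofFn]
    exact Finset.sum_le_sum fun i _ => hbody i
  have hinit : (initCircuit m : Circuit n M).length = 10 := by simp [initCircuit]
  rw [forLoop, List.length_append, hinit]
  linarith

theorem two_pow_clog_half_le {k : ℕ} (hk : 0 < k) :
    ((2 ^ (Nat.clog 2 k / 2) : ℕ) : ℝ) ≤ √(2 * k) := by
  apply Real.le_sqrt_of_sq_le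
  have h : (2 ^ (Nat.clog 2 k / 2)) ^ 2 ≤ 2 * k := by
    rw [← pow_mul]
    calc 2 ^ (Nat.clog 2 k / 2 * 2) ≤ 2 ^ Nat.clog 2 k :=
          Nat.pow_le_pow_right two_pos (by omega)
      _ ≤ 2 * k := by
          rcases Nat.lt_or_ge 1 k with h | h
          · have h1 := Nat.pow_pred_clog_lt_self one_lt_two h
            have h2 := Nat.clog_pos one_lt_two h
            calc 2 ^ Nat.clog 2 k = 2 * 2 ^ (Nat.clog 2 k).pred := by
                  rw [← pow_succ']
                  congr 1
                  simp only [Nat.pred_eq_sub_one]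
                  omega
              _ ≤ 2 * k := by omega
          · obtain rfl : k = 1 := by omega
            simp
  exact_mod_cast h

theorem size_le_three_mul_log {x : ℕ} (hx : 3 ≤ x) : (Nat.size x : ℝ) ≤ 3 * Real.log x := by
  have hx0 : (0 : ℝ) < x := by positivity
  have hlog3 : 1 ≤ Real.log x := by
    rw [Real.le_log_iff_exp_le hx0]
    have h1 := Real.exp_one_lt_d9
    have h2 : (3 : ℝ) ≤ x := by exact_mod_cast hx
    linarith
  have hs : 0 < Nat.size x := Nat.size_pos.2 (by omega)
  have hle : 2 ^ (Nat.size x - 1) ≤ x := Nat.lt_size.1 (by omega)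
  have h1 : ((Nat.size x - 1 : ℕ) : ℝ) * Real.log 2 ≤ Real.log x := by
    rw [← Real.log_pow]
    exact Real.log_le_log (by positivity) (by exact_mod_cast hle)
  rw [Nat.cast_sub hs, Nat.cast_one] at h1
  have h2 := Real.log_two_gt_d9
  nlinarith

end RunningTime

/-! ### The choice of the parameters -/

section Parameters

variable {σ n m : ℕ} {T : GDString σ n}

theorem GDString.width_le_size (i : Fin n) : T.width i ≤ T.size :=
  (Nat.le_mul_of_pos_left _ (T.card_pos i)).trans
    (Finset.single_le_sum (f := fun i => T.card i * T.width i) (fun _ _ => Nat.zero_le _)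
      (Finset.mem_univ i))

theorem GDString.card_le_size (i : Fin n) : T.card i ≤ T.size :=
  (Nat.le_mul_of_pos_right _ (T.width_pos i)).trans
    (Finset.single_le_sum (f := fun i => T.card i * T.width i) (fun _ _ => Nat.zero_le _)
      (Finset.mem_univ i))

theorem GDString.le_size : n ≤ T.size := by
  have : ∑ _i : Fin n, 1 ≤ T.size :=
    Finset.sum_le_sum fun i _ => Nat.mul_pos (T.card_pos i) (T.width_pos i)
  simpa using this

theorem clog_le_logSize {k : ℕ} (hk : k ≤ T.size) : Nat.clog 2 k ≤ logSize m T.size := by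
  apply Nat.clog_le_of_le_pow
  have : m + T.size < 2 ^ logSize m T.size := Nat.lt_size_self _
  omega

theorem suitable (hm : 2 ≤ m) (hw : ∀ i, T.width i < m) :
    Suitable T m (wordSize σ m T.size) (logSize m T.size) := by
  have h1 : m + T.size + σ < 2 ^ Nat.size (m + T.size + σ) := Nat.lt_size_self _
  have h2 : 2 ^ wordSize σ m T.size = 2 * 2 ^ Nat.size (m + T.size + σ) := pow_succ' _ _
  have hL : 2 ≤ logSize m T.size := Nat.lt_size.2 (by omega)
  refine ⟨by omega, by omega, fun i => ?_, hw, fun i => ?_, fun i => ?_⟩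
  · have := T.card_le_size i
    omega
  · have := clog_le_logSize (m := m) (T.width_le_size i)
    omega
  · have := clog_le_logSize (m := m) (T.card_le_size i)
    omega

/-- With `200 * L` cycles of runs the error of a search is at most `2 ^ (1 - 40 * L)`, whereas the
number of its oracle calls is at most a constant times `2 ^ (3 * L)`. -/
theorem segmentError_le {L q : ℕ} (hq : q / 2 ≤ L) :
    segmentError (200 * L) (200 * L * (L + 1)) q ≤ 3202 / (2 ^ L) ^ 37 := by
  have hx : (L : ℝ) + 1 ≤ 2 ^ L := by exact_mod_cast Nat.lt_two_pow_self
  have hs : searchError (200 * L) ≤ 2 / (2 ^ L) ^ 40 := by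
    have h1 : ((3 / 4 : ℝ)) ^ (200 * L) = (((3 / 4) ^ 100) ^ L) ^ 2 := by
      rw [← pow_mul, ← pow_mul]
      congr 1
      ring
    have h2 : ((3 / 4 : ℝ) ^ 100) ^ L ≤ ((1 / 2) ^ 40) ^ L :=
      pow_le_pow_left₀ (by positivity) (by norm_num) L
    rw [searchError, h1, Real.sqrt_sq (by positivity)]
    calc 2 * ((3 / 4 : ℝ) ^ 100) ^ L ≤ 2 * ((1 / 2) ^ 40) ^ L := by gcongr
      _ = 2 / (2 ^ L) ^ 40 := by
        rw [← pow_mul, ← pow_mul, mul_comm 40 L, one_div, inv_pow]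
        rfl
  have hp : (2 : ℝ) ^ (q / 2) ≤ 2 ^ L := pow_le_pow_right₀ (by norm_num) hq
  have hone : (1 : ℝ) ≤ 2 ^ L := one_le_pow₀ (by norm_num)
  rw [segmentError]
  push_cast
  set x : ℝ := 2 ^ L
  calc _ = (1 + 4 * (200 * L * (L + 1)) * (2 ^ (q / 2) + 1)) * searchError (200 * L) := by ring
    _ ≤ (x ^ 3 + 4 * (200 * x * x) * (x + x)) * (2 / x ^ 40) := by
      have h0 := searchError_nonneg (200 * L)
      have h1 : (1 : ℝ) ≤ x ^ 3 := one_le_pow₀ hone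
      have h2 : (L : ℝ) ≤ x := by linarith
      gcongr
    _ = 3202 / x ^ 37 := by
      have : x ≠ 0 := by positivity
      field_simp
      ring

theorem mul_error_le_one_tenth {L : ℕ} (hL : 1 ≤ L) (hn : n ≤ 2 ^ L) :
    (n : ℝ) * (3 * (3202 / (2 ^ L) ^ 37)) ≤ 1 / 10 := by
  have hn' : (n : ℝ) ≤ 2 ^ L := by exact_mod_cast hn
  have h2 : (2 : ℝ) ≤ 2 ^ L := by
    simpa using pow_le_pow_right₀ (by norm_num : (1 : ℝ) ≤ 2) hL
  set x : ℝ := 2 ^ L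
  have hx : 0 < x := by positivity
  calc (n : ℝ) * (3 * (3202 / x ^ 37)) ≤ x * (3 * (3202 / x ^ 37)) := by gcongr
    _ = 9606 / x ^ 36 := by
      field_simp
      norm_num
    _ ≤ 9606 / 2 ^ 36 := by gcongr
    _ ≤ 1 / 10 := by norm_num

/-- The bound on the number of gates in the form of the theorem, for `κ` times `L` cycles. -/
theorem cast_length_forLoop_le {κ : ℕ} (hκ : 1 ≤ κ) (hm : 2 ≤ m) (hn : 0 < n) :
    ((forLoop (logSize m T.size) m T.width T.card : Circuit n (numRuns κ m T.size)).length : ℝ) ≤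
      15096 * κ ^ 2 * 3 ^ 5 * Real.log (m + T.size) ^ 5 *
        ∑ i, √((T.card i : ℝ) * T.width i) := by
  have hn' : n ≤ T.size := GDString.le_size
  have hL : 1 ≤ logSize m T.size := Nat.lt_size.2 (by omega)
  have hlog := size_le_three_mul_log (x := m + T.size) (by omega)
  change (logSize m T.size : ℝ) ≤ _ at hlog
  rw [Nat.cast_add] at hlog
  have hlen := length_forLoop_le (M := numRuns κ m T.size) (logSize m T.size) m T.width T.card hn
    (by unfold numRuns; exact Nat.mul_pos (Nat.mul_pos hκ hL) (by omega)) hL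
    (fun i => clog_le_logSize (T.width_le_size i)) (fun i => clog_le_logSize (T.card_le_size i))
  have hsum : ∑ i, ((2 ^ (Nat.clog 2 (T.card i) / 2) : ℕ) : ℝ) *
      ((2 ^ (Nat.clog 2 (T.width i) / 2) : ℕ) : ℝ) ≤
        2 * ∑ i, √((T.card i : ℝ) * T.width i) := by
    rw [Finset.mul_sum]
    refine Finset.sum_le_sum fun i _ => ?_
    calc _ ≤ √(2 * T.card i) * √(2 * T.width i) :=
          mul_le_mul (two_pow_clog_half_le (T.card_pos i)) (two_pow_clog_half_le (T.width_pos i))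
            (by positivity) (by positivity)
      _ = √(2 ^ 2 * ((T.card i : ℝ) * T.width i)) := by
          rw [← Real.sqrt_mul (by positivity)]
          congr 1
          ring
      _ = _ := by rw [Real.sqrt_mul (by positivity), Real.sqrt_sq (by norm_num)]
  have hM : (numRuns κ m T.size : ℝ) ≤ 2 * κ * (logSize m T.size : ℝ) ^ 2 := by
    have h : numRuns κ m T.size ≤ 2 * κ * logSize m T.size ^ 2 := by
      unfold numRuns
      calc κ * logSize m T.size * (logSize m T.size + 1) ≤
            κ * logSize m T.size * (2 * logSize m T.size) := Nat.mul_le_mul_left _ (by omega)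
        _ = _ := by ring
    exact_mod_cast h
  have hlen' := (Nat.cast_le (α := ℝ)).2 hlen
  rw [Nat.cast_mul, Nat.cast_sum] at hlen'
  simp only [Nat.cast_mul] at hlen'
  refine hlen'.trans ?_
  push_cast at hsum ⊢
  set S := ∑ i, √((T.card i : ℝ) * T.width i)
  have hS : 0 ≤ S := Finset.sum_nonneg fun i _ => Real.sqrt_nonneg _
  calc _ ≤ 1887 * (logSize m T.size : ℝ) * (2 * κ * (logSize m T.size : ℝ) ^ 2) ^ 2 * (2 * S) := by
        gcongr
    _ = 15096 * κ ^ 2 * (logSize m T.size : ℝ) ^ 5 * S := by ring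
    _ ≤ 15096 * κ ^ 2 * (3 * Real.log (m + T.size)) ^ 5 * S := by gcongr
    _ = _ := by ring

end Parameters

theorem mainTheorem2 :
    ∃ (κ e : ℕ) (C : ℝ), ∀ (σ n m : ℕ) (P : Fin m → Fin σ) (T : GDString σ n),
      0 < n → (∀ i, T.width i < m) →
      ∀ F : Circuit n (numRuns κ m T.size),
        F = forLoop (logSize m T.size) m T.width T.card →
        (∀ (α : Fin m → ℂ) (h : Fin m), α h ≠ 0 →
          2 / 3 * ‖α h‖ ^ 2 <
            measureProb
              (F.run P T (initialState n (numRuns κ m T.size) (wordSize σ m T.size) α))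
              (fun x => x .id = BitVec.ofNat _ h ∧
                (T.f₁ P h → x (.mat (Fin.last n)) = 1) ∧
                (¬ T.f₁ P h → x (.mat (Fin.last n)) = 0))) ∧
        (F.length : ℝ) ≤
          C * Real.log (m + T.size) ^ e * ∑ i, √((T.card i : ℝ) * T.width i) := by
  -- `200 * L` cycles give the error bound of `segmentError_le`. In the time bound
  -- `15096 = 1887 * 2 ^ 2 * 2`, from `numRuns ≤ 2 * κ * L ^ 2` and the rounding of the sizes of the
  -- search spaces to powers of two, and the factor `3 ^ 5` comes from `L ≤ 3 * log (m + N)`.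
  refine ⟨200, 5, 15096 * 200 ^ 2 * 3 ^ 5, fun σ n m P T hn hw F hF => ?_⟩
  subst hF
  have hm : 2 ≤ m := by
    have h1 := hw ⟨0, hn⟩
    have h2 := T.width_pos ⟨0, hn⟩
    omega
  refine ⟨fun α h hα => ?_, by exact_mod_cast cast_length_forLoop_le (κ := 200) (by norm_num) hm hn⟩
  have hS : Suitable T m (wordSize σ m T.size) (logSize m T.size) := suitable hm hw
  obtain ⟨z, hz, hr⟩ := exists_loopState_forLoop (P := P) (K := 200 * logSize m T.size)
    (M := numRuns 200 m T.size) rfl (Nat.succ_pos _) hS h.isLt fun i => segmentError_le (by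
      have := hS.clog_card i
      omega)
  have hn2 : n ≤ 2 ^ logSize m T.size := by
    have h1 : n ≤ T.size := GDString.le_size
    have h2 : m + T.size < 2 ^ logSize m T.size := Nat.lt_size_self _
    omega
  have hL : 1 ≤ logSize m T.size := Nat.lt_size.2 (by omega)
  refine lt_measureProb (forLoop_writesIn _ _ _ _) ((Nat.le_mul_of_pos_left m two_pos).trans_lt hS.pattern)
    (mul_error_le_one_tenth hL hn2) hr α hα hz.id ⟨hz.id, fun hf => ?_, fun hf => ?_⟩
  · have h1 := (T.f₁_iff_matched hw hn h).1 hf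
    rw [hz.mat]
    exact if_pos h1
  · have h1 := mt (T.f₁_iff_matched hw hn h).2 hf
    rw [hz.mat]
    exact if_neg h1

end
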